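/- **Setting.** A single bit register is named by a focus $r{:}i$ with a role $r\in\{in,inout,out0,out1,aux0,aux1\}$ and a number $i$; its methods are the 16 methods $y/e$ with $y,e\in\{0,1,i,c\}$ (constants, identity, complement), which reply $y(b)$ and change the content $b$ to $e(b)$. A PGLB instruction sequence is a non-empty finite sequence of instructions $a$, $+a$, $-a$ (perform the basic action $a=f.m$; after $+a$ resp. $-a$ the next instruction is skipped if the reply is $0$ resp. $1$), $\#k$ and $\backslash\#k$ (jump $k$ positions forward resp. backward) and $!$ (terminate); leaving the range of positions and jumps by $0$ count as non-termination. A finite PGA (single pass) instruction sequence is one without backward jumps. $\mathsf{LLOC}(X)$ is the number of instructions of $X$. $X$ has low register indices if, for each role, the numbers of the registers occurring in $X$ form an initial segment of the positive integers. $X$ computes a partial function from the initial contents of the $in$ and $inout$ registers to the final contents of the $inout$, $out0$, $out1$ registers, where $out0,aux0$ registers start with $0$ and $out1,aux1$ registers with $1$. **Proposition.** Suppose there are a map $\Psi$ and a polynomial $p$ such that for each PGLB instruction sequence $X$ for single bit registers with low register indices, $\Psi(X)$ is a finite PGA instruction sequence with low register indices which uses only registers of $X$ and possibly further auxiliary registers,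 $\Psi(X)$ computes the same partial function as $X$, and $\mathsf{LLOC}(\Psi(X))\le p(\mathsf{LLOC}(X))$. Then 1. $\mathrm{NP}\subseteq \mathrm{P/poly}$; 2. in fact $\mathrm{NP}\subseteq \mathrm{P}/O(n\log n)$, where $n$ is the LLOC of single pass instruction sequences for the problem. Precisely: call a finite PGA instruction sequence $Y$ with low register indices a decider for $L$ at length $m$ if it uses only registers $in{:}1,\dots,in{:}m$, $out0{:}1$ and auxiliary ones and, for each $x\in\{0,1\}^m$ placed in $in{:}1,\dots,in{:}m$, terminates with $1$ in $out0{:}1$ if and only if $x\in L$ (and with $0$ otherwise). Then for every $L\in\mathrm{NP}$ there are deciders $Y_m$ for $L$ at all lengths $m$ with $\mathsf{LLOC}(Y_m)$ bounded by a polynomial in $m$, and $L$ is decidable in polynomial time with advice strings $a_m$ depending only on the input length $m$ such that, for a constant $c$, $|a_m|\le c\,(n\log_2 n+1)$ whenever $n$ is the LLOC of any decider for $L$ at length $m$ (in particular of a shortest one). -/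

import Mathlib

namespace InstrSeq

/-! ### Single bit registers -/

/-- The four functions on one bit, written `0`, `1`, `i` (identity), `c` (complement). -/
inductive BitFn
  | zero
  | one
  | ident
  | compl

def BitFn.apply : BitFn → Bool → Bool
  | .zero, _ => false
  | .one, _ => true
  | .ident, b => b
  | .compl, b => !b

/-- The 16 methods `y/e` of a single bit register: applied to content `b`, the method yields the
reply `y b` and changes the content to `e b`. -/
structure Method where
  yield : BitFn
  effect : BitFn

/-- The roles (kinds) of single bit registers. -/
inductive Role
  | inp
  | inout
  | out0
  | out1
  | aux0
  | aux1

/-- Registers of this role carry the arguments of the computed function. -/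
def Role.isInput : Role → Bool
  | .inp | .inout => true
  | _ => false

/-- Registers of this role carry the results of the computed function. -/
def Role.isOutput : Role → Bool
  | .inout | .out0 | .out1 => true
  | _ => false

def Role.isAux : Role → Bool
  | .aux0 | .aux1 => true
  | _ => false

/-- Initial content of the registers that are not input registers. -/
def Role.initial : Role → Bool
  | .out1 | .aux1 => true
  | _ => false

/-- A focus `role:index`, naming a single bit register. -/
@[ext] structure Focus where
  role : Role
  index : ℕ

/-- A basic action `f.m`. -/
structure Action where
  focus : Focus
  method : Method

/-! ### Instruction sequences -/

/-- PGLB instructions: `a`, `+a`, `-a`, `#k`, `\#k`, `!`. -/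
inductive Instr
  | basic (a : Action)
  | pos (a : Action)
  | neg (a : Action)
  | jump (k : ℕ)
  | bjump (k : ℕ)
  | term

/-- The focus that occurs in an instruction, if any. -/
def Instr.focus? : Instr → Option Focus
  | .basic a | .pos a | .neg a => some a.focus
  | _ => none

def Instr.IsBackwardJump : Instr → Prop
  | .bjump _ => True
  | _ => False

/-- PGLB instruction sequences `u₁;…;uₙ`, with `n ≥ 1`. -/
def IsPGLB (X : List Instr) : Prop := X ≠ []

/-- Finite PGA instruction sequences (single pass instruction sequences): no backward jumps,
no iteration. -/
def IsFinitePGA (X : List Instr) : Prop := X ≠ [] ∧ ∀ u ∈ X, ¬ u.IsBackwardJump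

/-- Logical lines of code: the number of instructions. -/
def LLOC (X : List Instr) : ℕ := X.length

/-- The register named by `f` is involved in a basic action of `X`. -/
def Uses (X : List Instr) (f : Focus) : Prop := ∃ u ∈ X, u.focus? = some f

/-- For each kind of register, the register numbers in use form an initial segment of the
positive natural numbers. -/
def LowRegisterIndices (X : List Instr) : Prop :=
  ∀ r : Role, ∃ k : ℕ, {i : ℕ | Uses X ⟨r, i⟩} = Set.Icc 1 k

/-! ### Execution -/

/-- Contents of the registers. -/
abbrev Memory := Focus → Bool

open Classical in
/-- Memory after performing a basic action. -/
noncomputable def Action.perform (a : Action) (M : Memory) : Memory :=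
  Function.update M a.focus (a.method.effect.apply (M a.focus))

/-- Reply to a basic action. -/
def Action.reply (a : Action) (M : Memory) : Bool := a.method.yield.apply (M a.focus)

/-- Execution of `X` during at most `t` instructions, from position `pc` (counted from `0`) and
memory `M`: the final memory if `!` has been reached within this bound. Leaving the range of
positions, by a jump or otherwise, is inaction, i.e. no termination; so is a jump by `0`, which is
repeated forever. -/
noncomputable def exec (X : List Instr) : ℕ → ℕ → Memory → Option Memory
  | 0, _, _ => none
  | t + 1, pc, M =>
    match X[pc]? with
    | none => none
    | some .term => some M
    | some (.basic a) => exec X t (pc + 1) (a.perform M)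
    | some (.pos a) => exec X t (if a.reply M then pc + 1 else pc + 2) (a.perform M)
    | some (.neg a) => exec X t (if a.reply M then pc + 2 else pc + 1) (a.perform M)
    | some (.jump k) => exec X t (pc + k) M
    | some (.bjump k) => if k ≤ pc then exec X t (pc - k) M else none

abbrev InReg := {f : Focus // f.role.isInput = true}

abbrev OutReg := {f : Focus // f.role.isOutput = true}

/-- Input registers hold the arguments, the other ones their initial contents. -/
def initMemory (ρ : InReg → Bool) : Memory := fun f =>
  if h : f.role.isInput = true then ρ ⟨f, h⟩ else f.role.initial

/-- The partial function computed by `X`: from the initial contents of the input registers to the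
final contents of the output registers, undefined where `X` does not terminate. -/
noncomputable def computed (X : List Instr) : (InReg → Bool) →. (OutReg → Bool) := fun ρ =>
  (Nat.rfindOpt fun t => exec X t 0 (initMemory ρ)).map fun M g => M g.1

/-- `Ψ` translates every PGLB instruction sequence with low register indices into a finite PGA
instruction sequence with low register indices that works on the same registers, apart from
auxiliary ones, and computes the same function. -/
def IsTranslation (Ψ : List Instr → List Instr) : Prop :=
  ∀ X, IsPGLB X → LowRegisterIndices X →
    IsFinitePGA (Ψ X) ∧ LowRegisterIndices (Ψ X) ∧
      (∀ f, Uses (Ψ X) f → f.role.isAux = true ∨ Uses X f) ∧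
      computed (Ψ X) = computed X

/-! ### Complexity classes -/

/-- Decidability in polynomial time by a Turing machine. -/
def PolyTimeDecidable {α Γ : Type} (e : Computability.Encoding α Γ) (S : Set α) : Prop :=
  ∃ χ : α → Bool, (∀ a, χ a = true ↔ a ∈ S) ∧
    Nonempty (Turing.TM2ComputableInPolyTime e.encode Computability.encodingBoolBool.encode χ)

/-- Encoding of pairs of bit strings. -/
def pairEncoding : Computability.Encoding (List Bool × List Bool) (Bool ⊕ Bool) :=
  Computability.encodingProd (Computability.encodingList Bool) (Computability.encodingList Bool)

/-- NP: polynomial time verifiable witnesses of polynomial length. -/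
def NP : Set (Language Bool) :=
  {L | ∃ (V : Set (List Bool × List Bool)) (q : Polynomial ℕ), PolyTimeDecidable pairEncoding V ∧
    ∀ x, x ∈ L ↔ ∃ w : List Bool, w.length ≤ q.eval x.length ∧ (x, w) ∈ V}

/-- `P/F` for a class `F` of functions: polynomial time with an advice string that depends on the
length of the input only, and whose length is a function in `F` of the length of the input. -/
def PAdvice (F : Set (ℕ → ℕ)) : Set (Language Bool) :=
  {L | ∃ a : ℕ → List Bool, (fun m => (a m).length) ∈ F ∧
    ∃ V : Set (List Bool × List Bool), PolyTimeDecidable pairEncoding V ∧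
      ∀ x, x ∈ L ↔ (x, a x.length) ∈ V}

def PPoly : Set (Language Bool) :=
  PAdvice {f | ∃ q : Polynomial ℕ, ∀ m, f m ≤ q.eval m}

/-- The bits of `x` as contents of `in:1, in:2, …`. -/
def inputBits (x : List Bool) : InReg → Bool := fun f => x.getD (f.1.index - 1) false

/-- `Y` is a finite PGA instruction sequence with low register indices that decides `L` on inputs
of length `m`, found in `in:1, …, in:m`, with its answer in `out0:1`; auxiliary registers are
allowed. -/
def DecidesAt (Y : List Instr) (L : Language Bool) (m : ℕ) : Prop :=
  IsFinitePGA Y ∧ LowRegisterIndices Y ∧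
    (∀ f, Uses Y f →
      (f.role = Role.inp ∧ f.index ≤ m) ∨ f = ⟨Role.out0, 1⟩ ∨ f.role.isAux = true) ∧
    ∀ x : List Bool, x.length = m →
      ∃ β ∈ computed Y (inputBits x), (β ⟨⟨Role.out0, 1⟩, rfl⟩ = true ↔ x ∈ L)

/-- `P/O(n log n)`, where `n` is the LLOC of single pass instruction sequences for the problem:
`L` has single pass instruction sequences of LLOC polynomial in the input length, and `L` can be
decided in polynomial time with advice of length `O(n log n)`, whenever `n` is the LLOC of a
single pass instruction sequence that decides `L` on the inputs of the given length (in
particular for the shortest one). The summand `1` is there because `n log n = 0` for `n = 1`. -/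
def PNLogN : Set (Language Bool) :=
  {L | (∃ (Y : ℕ → List Instr) (q : Polynomial ℕ),
      ∀ m, DecidesAt (Y m) L m ∧ LLOC (Y m) ≤ q.eval m) ∧
    L ∈ PAdvice {f | ∃ c : ℕ, ∀ m Y, DecidesAt Y L m →
      f m ≤ c * (LLOC Y * Nat.log 2 (LLOC Y) + 1)}}

end InstrSeq

/-! Backward jumps make programs short although not fast: an exhaustive search over all witnesses of
polynomial length fits into a PGLB sequence of polynomial length, since each nested loop over one
bit adds only a constant number of instructions (`size_forBits`). The loop body simulates the
verifying stack machine on bit registers. For inputs of a fixed length the running time is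
polynomially bounded, hence so are the stack heights, and each pair of a depth and a symbol gets one
register. So a language in NP has PGLB sequences of polynomial length (`exists_pglb_of_mem_NP`), and
the assumed translation turns them into single pass sequences of polynomial length.

Conversely, a single pass sequence of length `n` serves as advice. Control only moves forward, so
one sweep through the instructions suffices if memory holds, for each position, a bit telling
whether that position is reached. An instruction becomes at most four operations on addressed bits.
Low register indices keep all register numbers at most `n`, so an address takes `O(log n)` bits and
the whole code `O(n log n)` bits (`exists_advice`). One fixed stack machine evaluates such codes in
polynomial time; it keeps the memory as a log of addressed contents, searched linearly from the most
recent entry (`takes_evalProg`). Taking a shortest decider at each length gives advice whose bound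
holds for every decider (`mem_PNLogN`), and P/poly follows because a decider of polynomial length
exists.

Both programs, the search on registers and the evaluator on stacks, are written in the same
structured language `Prog`. It is compiled once to PGLB (`leads_of_run`), where only termination
matters, and once to stack machines (`flatSteps_of_run`), where the step bound in `Run` matters as
well. -/

namespace InstrSeq

/-! ### Structured programs -/

/-- Structured programs with basic actions from `A` and tests from `C`. -/
inductive Prog (A C : Type)
  | skip
  | act (a : A)
  | seq (p q : Prog A C)
  | ite (c : C) (p q : Prog A C)
  | loop (c : C) (p : Prog A C)

/-- Sequential composition of a list of programs. -/
def Prog.seqs {A C : Type} : List (Prog A C) → Prog A C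
  | [] => .skip
  | p :: l => .seq p (Prog.seqs l)

/-- `Run act tst p s t s'`: the program `p` takes state `s` to state `s'` in at most `t` steps. -/
inductive Run {A C S : Type} (act : A → S → S) (tst : C → S → Bool) :
    Prog A C → S → ℕ → S → Prop
  | skip (s : S) : Run act tst .skip s 0 s
  | act (a : A) (s : S) : Run act tst (.act a) s 1 (act a s)
  | seq {p q : Prog A C} {s s' s'' : S} {t t' : ℕ} : Run act tst p s t s' →
      Run act tst q s' t' s'' → Run act tst (.seq p q) s (t + t') s''
  | ite_true {c : C} {p q : Prog A C} {s s' : S} {t : ℕ} : tst c s = true →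
      Run act tst p s t s' → Run act tst (.ite c p q) s (t + 2) s'
  | ite_false {c : C} {p q : Prog A C} {s s' : S} {t : ℕ} : tst c s = false →
      Run act tst q s t s' → Run act tst (.ite c p q) s (t + 2) s'
  | loop_true {c : C} {p : Prog A C} {s s' s'' : S} {t t' : ℕ} : tst c s = true →
      Run act tst p s t s' → Run act tst (.loop c p) s' t' s'' →
      Run act tst (.loop c p) s (t + t' + 2) s''
  | loop_false {c : C} {p : Prog A C} {s : S} : tst c s = false →
      Run act tst (.loop c p) s 1 s
  | mono {p : Prog A C} {s r : S} {t u : ℕ} : t ≤ u → Run act tst p s t r → Run act tst p s u r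

/-- The list `l` occurs in `X` from position `pc` on. -/
def OccursAt {α : Type} (X : List α) : ℕ → List α → Prop
  | _, [] => True
  | pc, a :: l => X[pc]? = some a ∧ OccursAt X (pc + 1) l

theorem occursAt_append {α : Type} (X : List α) (l₁ l₂ : List α) (pc : ℕ) :
    OccursAt X pc (l₁ ++ l₂) ↔ OccursAt X pc l₁ ∧ OccursAt X (pc + l₁.length) l₂ := by
  induction l₁ generalizing pc with
  | nil => simp [OccursAt]
  | cons a l ih =>
    simp only [List.cons_append, OccursAt, ih, List.length_cons, and_assoc]
    rw [show pc + 1 + l.length = pc + (l.length + 1) by omega]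

theorem occursAt_append_append {α : Type} (pre l post : List α) :
    OccursAt (pre ++ (l ++ post)) pre.length l := by
  induction l generalizing pre with
  | nil => trivial
  | cons a l ih =>
    refine ⟨by simp, ?_⟩
    have := ih (pre ++ [a])
    simpa using this

/-! ### Register programs and their translation to PGLB -/

/-- Structured programs over bit variables: assignments of constants and tests. -/
abbrev RegProg (V : Type) := Prog (V × Bool) V

open Classical in
/-- Assignment of a constant to a variable. -/
noncomputable def assign {V : Type} (a : V × Bool) (ρ : V → Bool) : V → Bool :=
  Function.update ρ a.1 a.2

/-- Test of a variable. -/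
def testVar {V : Type} (v : V) (ρ : V → Bool) : Bool := ρ v

/-- A register program takes valuation `ρ` to valuation `τ`. -/
def Exec {V : Type} (p : RegProg V) (ρ τ : V → Bool) : Prop :=
  ∃ t, Run assign testVar p ρ t τ

/-- The constant function on bits with the given value. -/
def BitFn.const (b : Bool) : BitFn := if b then .one else .zero

theorem BitFn.const_apply (b b' : Bool) : (BitFn.const b).apply b' = b := by
  cases b <;> rfl

/-- The PGLB code of a register program, for a naming of the variables by foci. -/
def Prog.code {V : Type} (e : V → Focus) : RegProg V → List Instr
  | .skip => []
  | .act a => [.basic ⟨e a.1, ⟨.zero, .const a.2⟩⟩]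
  | .seq p q => p.code e ++ q.code e
  | .ite c p q => .pos ⟨e c, ⟨.ident, .ident⟩⟩ :: .jump 2 :: .jump ((p.code e).length + 2) ::
      (p.code e ++ .jump ((q.code e).length + 1) :: q.code e)
  | .loop c p => .pos ⟨e c, ⟨.ident, .ident⟩⟩ :: .jump 2 :: .jump ((p.code e).length + 2) ::
      (p.code e ++ [.bjump ((p.code e).length + 3)])

/-- Number of instructions of the code of a register program. -/
def Prog.size {A C : Type} : Prog A C → ℕ
  | .skip => 0
  | .act _ => 1
  | .seq p q => p.size + q.size
  | .ite _ p q => p.size + q.size + 4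
  | .loop _ p => p.size + 4

theorem length_code {V : Type} (e : V → Focus) (p : RegProg V) :
    (p.code e).length = p.size := by
  induction p with
  | skip => rfl
  | act => rfl
  | seq p q hp hq => simp [Prog.code, Prog.size, hp, hq]
  | ite c p q hp hq => simp [Prog.code, Prog.size, hp, hq]; omega
  | loop c p hp => simp [Prog.code, Prog.size, hp]

theorem focus_mem_range_of_mem_code {V : Type} (e : V → Focus) (p : RegProg V) :
    ∀ u ∈ p.code e, ∀ f, u.focus? = some f → f ∈ Set.range e := by
  induction p with
  | skip => simp [Prog.code]
  | act a => simp [Prog.code, Instr.focus?]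
  | seq p q hp hq =>
    intro u hu
    simp only [Prog.code, List.mem_append] at hu
    exact hu.elim (hp u) (hq u)
  | ite c p q hp hq =>
    intro u hu f hf
    simp only [Prog.code, List.mem_cons, List.mem_append] at hu
    rcases hu with rfl | rfl | rfl | hu | rfl | hu <;> simp_all [Instr.focus?]
    exacts [⟨c, hf⟩, hp u hu f hf, hq u hu f hf]
  | loop c p hp =>
    intro u hu f hf
    simp only [Prog.code, List.mem_cons, List.mem_append, List.not_mem_nil, or_false] at hu
    rcases hu with rfl | rfl | rfl | hu | rfl <;> simp_all [Instr.focus?]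
    exacts [⟨c, hf⟩, hp u hu f hf]

/-! ### Correctness of the compiled PGLB code -/

/-- Memory `M` at the foci `e v` holds the valuation `ρ`. -/
def Holds {V : Type} (e : V → Focus) (M : Memory) (ρ : V → Bool) : Prop := ∀ v, M (e v) = ρ v

theorem Action.perform_ident (f : Focus) (y : BitFn) (M : Memory) :
    (Action.mk f ⟨y, .ident⟩).perform M = M := by
  simp [Action.perform, BitFn.apply]

/-- Some number of instructions leads from `(pc, M)` to `(pc', M')`. -/
def Leads (X : List Instr) (pc : ℕ) (M : Memory) (pc' : ℕ) (M' : Memory) : Prop :=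
  ∃ n, ∀ t, exec X (n + t) pc M = exec X t pc' M'

theorem Leads.refl (X : List Instr) (pc : ℕ) (M : Memory) : Leads X pc M pc M :=
  ⟨0, fun t => by rw [Nat.zero_add]⟩

theorem Leads.trans {X : List Instr} {pc pc' pc'' : ℕ} {M M' M'' : Memory}
    (h : Leads X pc M pc' M') (h' : Leads X pc' M' pc'' M'') : Leads X pc M pc'' M'' := by
  obtain ⟨n, hn⟩ := h
  obtain ⟨n', hn'⟩ := h'
  exact ⟨n + n', fun t => by rw [Nat.add_assoc, hn, hn']⟩

theorem leads_basic {X : List Instr} {pc : ℕ} {a : Action} (M : Memory)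
    (h : X[pc]? = some (.basic a)) : Leads X pc M (pc + 1) (a.perform M) :=
  ⟨1, fun t => by rw [Nat.add_comm, exec, h]⟩

theorem leads_jump {X : List Instr} {pc k : ℕ} (M : Memory)
    (h : X[pc]? = some (.jump k)) : Leads X pc M (pc + k) M :=
  ⟨1, fun t => by rw [Nat.add_comm, exec, h]⟩

theorem leads_bjump {X : List Instr} {pc k : ℕ} (M : Memory) (hk : k ≤ pc)
    (h : X[pc]? = some (.bjump k)) : Leads X pc M (pc - k) M :=
  ⟨1, fun t => by rw [Nat.add_comm, exec, h]; simp [hk]⟩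

theorem leads_test {X : List Instr} {pc : ℕ} {f : Focus} (M : Memory)
    (h : X[pc]? = some (.pos ⟨f, ⟨.ident, .ident⟩⟩)) :
    Leads X pc M (if M f then pc + 1 else pc + 2) M :=
  ⟨1, fun t => by
    rw [Nat.add_comm, exec, h]
    simp only [Action.perform_ident]
    rfl⟩

/-- The code of a register program runs as the program does. -/
theorem leads_of_run {V : Type} {e : V → Focus} (he : Function.Injective e) {p : RegProg V}
    {ρ ρ' : V → Bool} {t : ℕ} (h : Run assign testVar p ρ t ρ') (X : List Instr) :
    ∀ pc M, OccursAt X pc (p.code e) → Holds e M ρ →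
      ∃ M', Holds e M' ρ' ∧ Leads X pc M (pc + p.size) M' := by
  induction h with
  | skip s => exact fun pc M _ hM => ⟨M, hM, Leads.refl _ _ _⟩
  | act a s =>
    intro pc M hX hM
    refine ⟨_, ?_, leads_basic M hX.1⟩
    classical
    intro v
    simp only [Action.perform, BitFn.const_apply, assign]
    by_cases hv : v = a.1
    · subst hv; simp
    · rw [Function.update_of_ne hv, Function.update_of_ne (he.ne hv), hM]
  | @seq p q s s' s'' t t' _ _ ih ih' =>
    intro pc M hX hM
    rw [Prog.code, occursAt_append, length_code] at hX
    obtain ⟨M', hM', h'⟩ := ih pc M hX.1 hM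
    obtain ⟨M'', hM'', h''⟩ := ih' _ M' hX.2 hM'
    exact ⟨M'', hM'', by rw [Prog.size, ← Nat.add_assoc]; exact h'.trans h''⟩
  | @ite_true c p q s s' t hc _ ih =>
    intro pc M hX hM
    simp only [Prog.code, OccursAt, occursAt_append, length_code] at hX
    obtain ⟨h0, h1, -, h3, h4, -⟩ := hX
    obtain ⟨M', hM', h'⟩ := ih _ M h3 hM
    refine ⟨M', hM', ?_⟩
    -- A reply `1` leads to `#2`, which hops over the second jump into the code of `p`; a reply `0`
    -- skips `#2` and takes the second jump, past `p` and its closing jump.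
    have e1 := leads_test M h0
    rw [hM c, show s c = true from hc, if_pos rfl] at e1
    have e2 := ((e1.trans (leads_jump M h1)).trans h').trans (leads_jump M' h4)
    convert e2 using 1
    simp only [Prog.size]
    omega
  | @ite_false c p q s s' t hc _ ih =>
    intro pc M hX hM
    simp only [Prog.code, OccursAt, occursAt_append, length_code] at hX
    obtain ⟨h0, -, h2, -, -, h5⟩ := hX
    have e1 := leads_test M h0
    rw [hM c, show s c = false from hc, if_neg (by simp)] at e1
    have e2 := e1.trans (leads_jump M h2)
    obtain ⟨M', hM', h'⟩ := ih _ M h5 hM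
    refine ⟨M', hM', ?_⟩
    rw [show pc + 1 + 1 + 1 + p.size + 1 = pc + 2 + (p.size + 2) by omega] at h'
    convert e2.trans h' using 1
    simp only [Prog.size]
    omega
  | @loop_true c p s s' s'' t t' hc _ _ ih ih' =>
    intro pc M hX hM
    have hX' := hX
    simp only [Prog.code, OccursAt, occursAt_append, length_code] at hX
    obtain ⟨h0, h1, -, h3, h4, -⟩ := hX
    obtain ⟨M', hM', h'⟩ := ih _ M h3 hM
    have e1 := leads_test M h0
    rw [hM c, show s c = true from hc, if_pos rfl] at e1
    have e2 := ((e1.trans (leads_jump M h1)).trans h').trans (leads_bjump M' (by omega) h4)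
    -- The backward jump returns exactly to the test, so the induction hypothesis for the remaining
    -- rounds applies at the same position.
    rw [show pc + 1 + 1 + 1 + p.size - (p.size + 3) = pc by omega] at e2
    obtain ⟨M'', hM'', h''⟩ := ih' pc M' hX' hM'
    exact ⟨M'', hM'', e2.trans h''⟩
  | @loop_false c p s hc =>
    intro pc M hX hM
    simp only [Prog.code, OccursAt, occursAt_append, length_code] at hX
    obtain ⟨h0, -, h2, -⟩ := hX
    have e1 := leads_test M h0
    rw [hM c, show s c = false from hc, if_neg (by simp)] at e1
    refine ⟨M, hM, ?_⟩
    convert e1.trans (leads_jump M h2) using 1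
    simp only [Prog.size]
    omega
  | mono _ _ ih => exact ih

/-- Extra fuel does not change a result once `!` is reached. This makes the unbounded search in
`computed` find the final memory of any terminating run. -/
theorem exec_mono {X : List Instr} {t t' : ℕ} (htt : t ≤ t') {pc : ℕ} {M M' : Memory}
    (h : exec X t pc M = some M') : exec X t' pc M = some M' := by
  induction t generalizing t' pc M with
  | zero => simp [exec] at h
  | succ t ih =>
    obtain ⟨t', rfl⟩ : ∃ s, t' = s + 1 := ⟨t' - 1, by omega⟩
    have htt : t ≤ t' := by omega
    rw [exec] at h ⊢
    cases hu : X[pc]? with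
    | none => simp [hu] at h
    | some u =>
      cases u with
      | term => simpa [hu] using h
      | bjump k =>
        simp only [hu] at h ⊢
        split at h
        · rename_i hk
          rw [if_pos hk]
          exact ih htt h
        · simp at h
      | _ =>
        simp only [hu] at h ⊢
        exact ih htt h

theorem mem_computed_iff {X : List Instr} {ρ : InReg → Bool} {β : OutReg → Bool} :
    β ∈ computed X ρ ↔
      ∃ t M, exec X t 0 (initMemory ρ) = some M ∧ (fun g : OutReg => M g.1) = β := by
  simp only [computed, Part.mem_map_iff]
  constructor
  · rintro ⟨M, hM, h⟩
    obtain ⟨t, ht⟩ := Nat.rfindOpt_spec hM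
    exact ⟨t, M, ht, h⟩
  · rintro ⟨t, M, ht, h⟩
    refine ⟨M, ?_, h⟩
    rw [Nat.rfindOpt_mono (fun h hm => exec_mono h hm)]
    exact ⟨t, ht⟩

end InstrSeq

namespace InstrSeq

/-! ### Derived register programs -/

section RegProg

variable {V : Type}

theorem Exec.skip (ρ : V → Bool) : Exec .skip ρ ρ := ⟨_, Run.skip ρ⟩

theorem Exec.act (a : V × Bool) (ρ : V → Bool) : Exec (.act a) ρ (assign a ρ) := ⟨_, Run.act a ρ⟩

theorem Exec.seq {p q : RegProg V} {ρ ρ' ρ'' : V → Bool} (h : Exec p ρ ρ') (h' : Exec q ρ' ρ'') :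
    Exec (.seq p q) ρ ρ'' := by
  obtain ⟨t, h⟩ := h
  obtain ⟨t', h'⟩ := h'
  exact ⟨_, h.seq h'⟩

theorem Exec.ite {c : V} {p q : RegProg V} {ρ ρ' : V → Bool}
    (h : Exec (if ρ c then p else q) ρ ρ') : Exec (.ite c p q) ρ ρ' := by
  obtain ⟨t, h⟩ := h
  cases hc : ρ c with
  | true => exact ⟨_, Run.ite_true hc (by simpa [hc] using h)⟩
  | false => exact ⟨_, Run.ite_false hc (by simpa [hc] using h)⟩

theorem Exec.loop_true {c : V} {p : RegProg V} {ρ ρ' ρ'' : V → Bool} (hc : ρ c = true)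
    (h : Exec p ρ ρ') (h' : Exec (.loop c p) ρ' ρ'') : Exec (.loop c p) ρ ρ'' := by
  obtain ⟨t, h⟩ := h
  obtain ⟨t', h'⟩ := h'
  exact ⟨_, Run.loop_true hc h h'⟩

theorem Exec.loop_false {c : V} {p : RegProg V} {ρ : V → Bool} (hc : ρ c = false) :
    Exec (.loop c p) ρ ρ := ⟨_, Run.loop_false hc⟩

theorem assign_self (v : V) (b : Bool) (ρ : V → Bool) : assign (v, b) ρ v = b := by
  simp [assign]

theorem assign_of_ne {v w : V} (h : w ≠ v) (b : Bool) (ρ : V → Bool) :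
    assign (v, b) ρ w = ρ w := by
  simp [assign, h]

/-- Assignment of a variable to a variable. -/
def copyVar (v w : V) : RegProg V := .ite w (.act (v, true)) (.act (v, false))

theorem exec_copyVar (v w : V) (ρ : V → Bool) : Exec (copyVar v w) ρ (assign (v, ρ w) ρ) := by
  refine Exec.ite ?_
  cases ρ w <;> exact Exec.act _ _

/-- A sequence of assignments which do not interfere acts as a simultaneous assignment. -/
theorem exec_seqs_assign {ι : Type} (p : ι → RegProg V) (d : ι → V) (f : ι → (V → Bool) → Bool)
    (hp : ∀ i ρ, Exec (p i) ρ (assign (d i, f i ρ) ρ)) (l : List ι)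
    (hl : l.Pairwise fun i j => d j ≠ d i ∧ ∀ ρ b, f j (assign (d i, b) ρ) = f j ρ)
    (ρ : V → Bool) :
    ∃ ρ', Exec (.seqs (l.map p)) ρ ρ' ∧ (∀ i ∈ l, ρ' (d i) = f i ρ) ∧
      ∀ v, (∀ i ∈ l, v ≠ d i) → ρ' v = ρ v := by
  induction l generalizing ρ with
  | nil => exact ⟨ρ, Exec.skip ρ, by simp, fun _ _ => rfl⟩
  | cons i l ih =>
    rw [List.pairwise_cons] at hl
    obtain ⟨ρ', h, h1, h2⟩ := ih hl.2 (assign (d i, f i ρ) ρ)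
    refine ⟨ρ', (hp i ρ).seq h, ?_, ?_⟩
    · intro j hj
      rcases List.mem_cons.1 hj with rfl | hj
      · rw [h2 _ fun k hk => ((hl.1 k hk).1).symm, assign_self]
      · rw [h1 j hj, (hl.1 j hj).2]
    · intro v hv
      rw [h2 v fun k hk => hv k (List.mem_cons_of_mem _ hk),
        assign_of_ne (hv i List.mem_cons_self)]

/-- Constant assignments to the variables `d i`. -/
theorem exec_seqs_const {ι : Type} (d : ι → V) (hd : Function.Injective d) (b : ι → Bool)
    (l : List ι) (hl : l.Nodup) (ρ : V → Bool) :
    ∃ ρ', Exec (.seqs (l.map fun i => .act (d i, b i))) ρ ρ' ∧ (∀ i ∈ l, ρ' (d i) = b i) ∧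
      ∀ v, (∀ i ∈ l, v ≠ d i) → ρ' v = ρ v :=
  exec_seqs_assign _ d (fun i _ => b i) (fun _ ρ => Exec.act _ ρ) l
    (hl.imp fun h => ⟨fun h' => h (hd h').symm, fun _ _ => rfl⟩) ρ

/-- Case distinction: the first variable `c i` which holds determines the program. -/
def switch {ι : Type} (c : ι → V) (p : ι → RegProg V) (q : RegProg V) : List ι → RegProg V
  | [] => q
  | i :: l => .ite (c i) (p i) (switch c p q l)

/-- Since exactly one of the tested variables holds, the order of the list is irrelevant. -/
theorem exec_switch {ι : Type} (c : ι → V) (p : ι → RegProg V) (q : RegProg V) (l : List ι)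
    {i : ι} (hi : i ∈ l) {ρ ρ' : V → Bool} (h : ∀ j, ρ (c j) = true ↔ j = i)
    (hr : Exec (p i) ρ ρ') : Exec (switch c p q l) ρ ρ' := by
  induction l with
  | nil => simp at hi
  | cons j l ih =>
    refine Exec.ite ?_
    by_cases hj : ρ (c j) = true
    · rw [if_pos hj, (h j).1 hj]
      exact hr
    · rw [if_neg hj]
      refine ih ((List.mem_cons.1 hi).resolve_left ?_)
      rintro rfl
      exact hj ((h i).2 rfl)

theorem exec_switch_default {ι : Type} (c : ι → V) (p : ι → RegProg V) (q : RegProg V)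
    (l : List ι) {ρ ρ' : V → Bool} (h : ∀ j, ρ (c j) = false) (hr : Exec q ρ ρ') :
    Exec (switch c p q l) ρ ρ' := by
  induction l with
  | nil => exact hr
  | cons j l ih =>
    refine Exec.ite ?_
    rw [h j]
    exact ih

theorem size_seqs_map_le {A C ι : Type} (p : ι → Prog A C) (l : List ι) (n : ℕ)
    (h : ∀ i ∈ l, (p i).size ≤ n) : (Prog.seqs (l.map p)).size ≤ l.length * n := by
  induction l with
  | nil => simp [Prog.seqs, Prog.size]
  | cons i l ih =>
    simp only [List.map_cons, Prog.seqs, Prog.size, List.length_cons]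
    have := ih fun j hj => h j (List.mem_cons_of_mem _ hj)
    have := h i List.mem_cons_self
    linarith

theorem size_switch_le {ι : Type} (c : ι → V) (p : ι → RegProg V) (q : RegProg V)
    (l : List ι) (n : ℕ) (h : ∀ i ∈ l, (p i).size ≤ n) :
    (switch c p q l).size ≤ l.length * (n + 4) + q.size := by
  induction l with
  | nil => simp [switch]
  | cons i l ih =>
    simp only [switch, Prog.size, List.length_cons]
    have := ih fun j hj => h j (List.mem_cons_of_mem _ hj)
    have := h i List.mem_cons_self
    linarith

/-- Run `p` for both values of the variable `v`; the variable `d` controls the loop. -/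
def forBit (v d : V) (p : RegProg V) : RegProg V :=
  .seq (.act (v, false)) <| .seq (.act (d, true)) <| .loop d <| .seq p <|
    .ite v (.act (d, false)) (.seq (.act (v, true)) (.act (d, true)))

/-- Nested loops over all values of the given variables. -/
def forBits (d : V) (p : RegProg V) : List V → RegProg V
  | [] => p
  | v :: l => forBit v d (forBits d p l)

theorem size_forBits (d : V) (p : RegProg V) (l : List V) :
    (forBits d p l).size = p.size + 13 * l.length := by
  induction l with
  | nil => rfl
  | cons v l ih =>
    simp only [forBits, forBit, Prog.size, ih, List.length_cons]
    omega

/-- The body `p` leaves the variables satisfying `E` alone and adds `P`, a property of these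
variables, to the variable `o`. -/
def Accumulates (E : V → Prop) (o : V) (p : RegProg V) (P : (V → Bool) → Prop) : Prop :=
  ∀ ρ, ∃ ρ', Exec p ρ ρ' ∧ (∀ v, E v → ρ' v = ρ v) ∧ (ρ' o = true ↔ ρ o = true ∨ P ρ)

/-- The loop makes exactly two rounds, with `v` false and then true; `v` itself remembers which
round is over because the body preserves it. The body need not preserve `d`, which is reset after
each round. Hence nested loops can share one control variable. -/
theorem accumulates_forBit {E : V → Prop} {o v d : V} {p : RegProg V} {P : (V → Bool) → Prop}
    (hp : Accumulates E o p P) (hP : ∀ ρ ρ', (∀ w, E w → ρ w = ρ' w) → P ρ → P ρ')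
    (hv : E v) (hd : ¬ E d) (ho : ¬ E o) (hdo : d ≠ o) :
    Accumulates (fun w => E w ∧ w ≠ v) o (forBit v d p) fun ρ => ∃ b, P (assign (v, b) ρ) := by
  intro ρ
  have hvd : v ≠ d := fun h => hd (h ▸ hv)
  have hvo : v ≠ o := fun h => ho (h ▸ hv)
  set ρ₀ := assign (d, true) (assign (v, false) ρ) with hρ₀
  obtain ⟨ρ₁, h1, e1, o1⟩ := hp ρ₀
  have hv1 : ρ₁ v = false := by
    rw [e1 v hv, hρ₀, assign_of_ne hvd, assign_self]
  set ρ₂ := assign (d, true) (assign (v, true) ρ₁) with hρ₂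
  obtain ⟨ρ₃, h3, e3, o3⟩ := hp ρ₂
  have hv3 : ρ₃ v = true := by
    rw [e3 v hv, hρ₂, assign_of_ne hvd, assign_self]
  refine ⟨assign (d, false) ρ₃, ?_, ?_, ?_⟩
  · refine (Exec.act _ _).seq ((Exec.act _ _).seq ?_)
    refine Exec.loop_true (assign_self _ _ _) (h1.seq (Exec.ite (ρ' := ρ₂) ?_)) ?_
    · rw [hv1]
      exact (Exec.act _ _).seq (Exec.act _ _)
    · refine Exec.loop_true (assign_self _ _ _)
        (h3.seq (Exec.ite (ρ' := assign (d, false) ρ₃) ?_)) ?_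
      · rw [hv3]
        exact Exec.act _ _
      · exact Exec.loop_false (assign_self _ _ _)
  · rintro w ⟨hw, hwv⟩
    have hwd : w ≠ d := fun h => hd (h ▸ hw)
    rw [assign_of_ne hwd, e3 w hw, hρ₂, assign_of_ne hwd, assign_of_ne hwv, e1 w hw, hρ₀,
      assign_of_ne hwd, assign_of_ne hwv]
  · have a0 : P ρ₀ ↔ P (assign (v, false) ρ) := by
      constructor <;> apply hP <;> intro w hw <;>
        rw [hρ₀, assign_of_ne (fun h => hd (h ▸ hw) : w ≠ d)]
    have a2 : P ρ₂ ↔ P (assign (v, true) ρ) := by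
      have : ∀ w, E w → ρ₂ w = assign (v, true) ρ w := by
        intro w hw
        have hwd : w ≠ d := fun h => hd (h ▸ hw)
        rw [hρ₂, assign_of_ne hwd]
        by_cases hwv : w = v
        · rw [hwv, assign_self, assign_self]
        · rw [assign_of_ne hwv, assign_of_ne hwv, e1 w hw, hρ₀, assign_of_ne hwd,
            assign_of_ne hwv]
      exact ⟨hP _ _ this, hP _ _ fun w hw => (this w hw).symm⟩
    rw [assign_of_ne hdo.symm, o3, hρ₂, assign_of_ne hdo.symm, assign_of_ne hvo.symm, o1, hρ₀,
      assign_of_ne hdo.symm, assign_of_ne hvo.symm, ← hρ₀, ← hρ₂, a0, a2]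
    simp only [Bool.exists_bool, or_assoc]

/-- Nested loops compute an existential quantification over the loop variables. -/
theorem accumulates_forBits {E : V → Prop} {o d : V} {p : RegProg V} {P : (V → Bool) → Prop}
    (hp : Accumulates E o p P) (hP : ∀ ρ ρ', (∀ w, E w → ρ w = ρ' w) → P ρ → P ρ')
    (hd : ¬ E d) (ho : ¬ E o) (hdo : d ≠ o) (l : List V) (hl : l.Nodup) (hE : ∀ v ∈ l, E v) :
    Accumulates (fun w => E w ∧ w ∉ l) o (forBits d p l)
      fun ρ => ∃ ρ', (∀ w, E w → w ∉ l → ρ' w = ρ w) ∧ P ρ' := by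
  induction l with
  | nil =>
    intro ρ
    obtain ⟨ρ', h, e, h'⟩ := hp ρ
    refine ⟨ρ', h, fun v hv => e v hv.1, h'.trans (or_congr_right ?_)⟩
    exact ⟨fun h => ⟨ρ, fun _ _ _ => rfl, h⟩,
      fun ⟨ρ'', h1, h2⟩ => hP _ _ (fun w hw => h1 w hw (by simp)) h2⟩
  | cons v l ih =>
    rw [List.nodup_cons] at hl
    have ih := ih hl.2 fun w hw => hE w (List.mem_cons_of_mem _ hw)
    have hv := hE v List.mem_cons_self
    have key := accumulates_forBit ih
      (fun ρ ρ' h => fun ⟨ρ'', h1, h2⟩ =>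
        ⟨ρ'', fun w hw hwl => (h1 w hw hwl).trans (h w ⟨hw, hwl⟩), h2⟩)
      ⟨hv, hl.1⟩ (fun h => hd h.1) (fun h => ho h.1) hdo
    intro ρ
    obtain ⟨ρ', h, e, h'⟩ := key ρ
    refine ⟨ρ', h, fun w hw => e w ?_, h'.trans (or_congr_right ?_)⟩
    · have := hw.2
      rw [List.mem_cons, not_or] at this
      exact ⟨⟨hw.1, this.2⟩, this.1⟩
    · constructor
      · rintro ⟨b, ρ'', h1, h2⟩
        refine ⟨ρ'', fun w hw hwl => ?_, h2⟩
        rw [List.mem_cons, not_or] at hwl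
        rw [h1 w hw hwl.2, assign_of_ne hwl.1]
      · rintro ⟨ρ'', h1, h2⟩
        refine ⟨ρ'' v, ρ'', fun w hw hwl => ?_, h2⟩
        by_cases hwv : w = v
        · rw [hwv, assign_self]
        · rw [assign_of_ne hwv, h1 w hw (by simp [hwv, hwl])]

end RegProg

end InstrSeq

namespace InstrSeq

open Turing TM2.Stmt StateTransition

/-! ### Stack machines on registers -/

/-- The variables of a register program that searches for a witness of length at most `W` for an
input of length `m`, simulating the stack machine `tm` with stacks of height at most `B` and
symbols from `syms`. -/
inductive Var (tm : FinTM2) (syms : ∀ k, Finset (tm.Γ k)) (m W B : ℕ) : Type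
  | inp (i : Fin m)
  | out
  | cell (i : Fin (B + 1)) (k : tm.K) (g : {g // g ∈ syms k})
  | st (c : tm.Λ × tm.σ)
  | running
  | choice (c : Fin W × Bool)
  | again

/-- The number of symbols that a statement pushes at most. -/
def pushes {tm : FinTM2} : TM2.Stmt tm.Γ tm.Λ tm.σ → ℕ
  | push _ _ q => pushes q + 1
  | peek _ _ q => pushes q
  | pop _ _ q => pushes q
  | load _ q => pushes q
  | branch _ q₁ q₂ => pushes q₁ + pushes q₂
  | goto _ => 0
  | halt => 0

/-- The statement pushes only symbols from `syms`. -/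
def PushesIn {tm : FinTM2} (syms : ∀ k, Finset (tm.Γ k)) : TM2.Stmt tm.Γ tm.Λ tm.σ → Prop
  | push k f q => (∀ v, f v ∈ syms k) ∧ PushesIn syms q
  | peek _ _ q => PushesIn syms q
  | pop _ _ q => PushesIn syms q
  | load _ q => PushesIn syms q
  | branch _ q₁ q₂ => PushesIn syms q₁ ∧ PushesIn syms q₂
  | goto _ => True
  | halt => True

/-- Growth per step is bounded by a constant of the machine, so a time bound yields a height bound
and thereby the number of registers needed. -/
theorem length_stepAux_le {tm : FinTM2} (q : TM2.Stmt tm.Γ tm.Λ tm.σ) (v : tm.σ)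
    (S : ∀ k, List (tm.Γ k)) (k : tm.K) :
    ((TM2.stepAux q v S).stk k).length ≤ (S k).length + pushes q := by
  induction q generalizing v S with
  | push k' f q ih =>
    refine (ih _ _).trans ?_
    by_cases h : k = k'
    · subst h
      simp [pushes]
      omega
    · simp [h, pushes]
  | peek k' f q ih => exact ih _ _
  | pop k' f q ih =>
    refine (ih _ _).trans ?_
    by_cases h : k = k'
    · subst h
      simp [pushes]
    · simp [h, pushes]
  | load a q ih => exact ih _ _
  | branch f q₁ q₂ ih₁ ih₂ =>
    rw [TM2.stepAux]
    cases f v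
    · exact (ih₂ _ _).trans (by simp only [pushes]; omega)
    · exact (ih₁ _ _).trans (by simp only [pushes]; omega)
  | goto f => simp
  | halt => simp

section Simulation

variable {tm : FinTM2} {syms : ∀ k, Finset (tm.Γ k)} {m W B : ℕ}

attribute [local instance] FinTM2.kFin FinTM2.ΛFin FinTM2.σFin

local notation "𝕍" => Var tm syms m W B

/-- Variables that the simulation does not touch. -/
def Var.IsExternal : 𝕍 → Prop
  | .inp _ => True
  | .out => True
  | .choice _ => True
  | _ => False

/-- The stack cells. -/
def Var.IsCell : 𝕍 → Prop
  | .cell _ _ _ => True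
  | _ => False

/-- The valuation represents the stacks: `cell i k g` tells whether the symbol `g` is at depth `i`
in stack `k`. -/
structure Represents (ρ : 𝕍 → Bool) (S : ∀ k, List (tm.Γ k)) : Prop where
  cell : ∀ i k g, ρ (.cell i k g) = true ↔ (S k)[(i : ℕ)]? = some g.1
  mem : ∀ k, ∀ g ∈ S k, g ∈ syms k

/-- All pairs of a depth and a symbol. -/
noncomputable def cellList (syms : ∀ k, Finset (tm.Γ k)) (B : ℕ) (k : tm.K) :
    List (Fin (B + 1) × {g // g ∈ syms k}) :=
  (List.finRange (B + 1)).flatMap fun i => (Finset.univ : Finset {g // g ∈ syms k}).toList.map (i, ·)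

theorem mem_cellList (k : tm.K) (c : Fin (B + 1) × {g // g ∈ syms k}) :
    c ∈ cellList syms B k := by
  simp only [cellList, List.mem_flatMap, List.mem_finRange, List.mem_map, Finset.mem_toList,
    Finset.mem_univ, true_and]
  exact ⟨c.1, c.2, rfl⟩

/-- Ordering by depth lets the cells be shifted in place: a pop works through the list forwards, a
push backwards, and each cell is read before it is overwritten. -/
theorem pairwise_cellList (k : tm.K) :
    (cellList syms B k).Pairwise fun c c' => c ≠ c' ∧ c.1 ≤ c'.1 := by
  rw [cellList, List.pairwise_flatMap]
  refine ⟨fun i _ => ?_, ?_⟩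
  · rw [List.pairwise_map]
    exact (Finset.nodup_toList _).imp fun h => ⟨by simpa using h, le_rfl⟩
  · refine (List.pairwise_lt_finRange (B + 1)).imp fun {i j} hij => ?_
    simp only [List.mem_map, Finset.mem_toList, Finset.mem_univ, true_and]
    rintro _ ⟨g, rfl⟩ _ ⟨g', rfl⟩
    exact ⟨fun h => hij.ne (congrArg Prod.fst h), hij.le⟩

theorem length_cellList (k : tm.K) :
    (cellList syms B k).length = (B + 1) * (syms k).card := by
  simp [cellList, List.length_flatMap]

open Classical in
/-- Push the symbol `g` on stack `k`. -/
noncomputable def pushCode (k : tm.K) (g : tm.Γ k) : RegProg 𝕍 :=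
  .seqs <| (cellList syms B k).reverse.map fun c =>
    if h : (c.1 : ℕ) = 0 then .act (.cell c.1 k c.2, decide (c.2.1 = g))
    else copyVar (.cell c.1 k c.2) (.cell ⟨c.1 - 1, by omega⟩ k c.2)

/-- Remove the top symbol of stack `k`. -/
noncomputable def popCode (k : tm.K) : RegProg 𝕍 :=
  .seqs <| (cellList syms B k).map fun c =>
    if h : (c.1 : ℕ) = B then .act (.cell c.1 k c.2, false)
    else copyVar (.cell c.1 k c.2) (.cell ⟨c.1 + 1, by omega⟩ k c.2)

theorem size_pushCode_le (k : tm.K) (g : tm.Γ k) :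
    (pushCode k g : RegProg 𝕍).size ≤ (B + 1) * (syms k).card * 6 := by
  rw [← length_cellList, ← List.length_reverse]
  refine size_seqs_map_le _ _ _ fun c _ => ?_
  split <;> simp [copyVar, Prog.size]

theorem size_popCode_le (k : tm.K) :
    (popCode k : RegProg 𝕍).size ≤ (B + 1) * (syms k).card * 6 := by
  rw [← length_cellList]
  refine size_seqs_map_le _ _ _ fun c _ => ?_
  split <;> simp [copyVar, Prog.size]

/-- Every cell receives the one above it, and depth `0` the indicator of `g`. No height bound is
needed, as `Represents` records nothing below depth `B`. -/
theorem exec_pushCode {ρ : 𝕍 → Bool} {S : ∀ k, List (tm.Γ k)} (hR : Represents ρ S) (k : tm.K)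
    {g : tm.Γ k} (hg : g ∈ syms k) :
    ∃ ρ', Exec (pushCode k g) ρ ρ' ∧ Represents ρ' (Function.update S k (g :: S k)) ∧
      ∀ v : 𝕍, ¬ v.IsCell → ρ' v = ρ v := by
  classical
  obtain ⟨ρ', h, h1, h2⟩ := exec_seqs_assign
    (fun c : Fin (B + 1) × {g // g ∈ syms k} => (if h : (c.1 : ℕ) = 0 then
        .act (.cell c.1 k c.2, decide (c.2.1 = g))
      else copyVar (.cell c.1 k c.2) (.cell ⟨c.1 - 1, by omega⟩ k c.2) : RegProg 𝕍))
    (fun c => .cell c.1 k c.2)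
    (fun c ρ => if h : (c.1 : ℕ) = 0 then decide (c.2.1 = g)
      else ρ (.cell ⟨c.1 - 1, by omega⟩ k c.2))
    (fun c ρ => by
      split
      · exact Exec.act _ _
      · exact exec_copyVar _ _ _)
    (cellList syms B k).reverse
    (by
      rw [List.pairwise_reverse]
      refine (pairwise_cellList k).imp fun {c c'} hc => ⟨fun h => hc.1 ?_, fun ρ b => ?_⟩
      · simp only [Var.cell.injEq, heq_eq_eq, true_and] at h
        exact Prod.ext h.1 h.2
      · split
        · rfl
        · rw [assign_of_ne]
          intro h
          simp only [Var.cell.injEq] at h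
          have h1 := congrArg Fin.val h.1
          have h2 : (c.1 : ℕ) ≤ c'.1 := hc.2
          simp only at h1
          omega) ρ
  refine ⟨ρ', h, ⟨?_, ?_⟩, ?_⟩
  · intro i k' g'
    by_cases hk : k' = k
    · subst hk
      rw [h1 (i, g') (by simpa using mem_cellList _ _), Function.update_self]
      split
      · rename_i h0
        simp only at h0
        simp [h0, eq_comm]
      · rename_i h0
        simp only at h0
        rw [hR.cell]
        obtain ⟨j, hj⟩ : ∃ j, (i : ℕ) = j + 1 := ⟨i - 1, by omega⟩
        simp [hj]
    · rw [h2 _ (by simp [hk]), Function.update_of_ne hk, hR.cell]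
  · intro k' g' hg'
    by_cases hk : k' = k
    · subst hk
      rw [Function.update_self, List.mem_cons] at hg'
      rcases hg' with rfl | hg'
      exacts [hg, hR.mem _ _ hg']
    · rw [Function.update_of_ne hk] at hg'
      exact hR.mem _ _ hg'
  · intro v hv
    refine h2 v fun c _ hc => hv ?_
    rw [hc]
    trivial

/-- The deepest cell has no cell below it to copy from and is cleared; the height bound ensures that
nothing should have moved up into it. -/
theorem exec_popCode {ρ : 𝕍 → Bool} {S : ∀ k, List (tm.Γ k)} (hR : Represents ρ S) (k : tm.K)
    (hB : (S k).length ≤ B) :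
    ∃ ρ', Exec (popCode k) ρ ρ' ∧ Represents ρ' (Function.update S k (S k).tail) ∧
      ∀ v : 𝕍, ¬ v.IsCell → ρ' v = ρ v := by
  classical
  obtain ⟨ρ', h, h1, h2⟩ := exec_seqs_assign
    (fun c : Fin (B + 1) × {g // g ∈ syms k} => (if h : (c.1 : ℕ) = B then
        .act (.cell c.1 k c.2, false)
      else copyVar (.cell c.1 k c.2) (.cell ⟨c.1 + 1, by omega⟩ k c.2) : RegProg 𝕍))
    (fun c => .cell c.1 k c.2)
    (fun c ρ => if h : (c.1 : ℕ) = B then false else ρ (.cell ⟨c.1 + 1, by omega⟩ k c.2))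
    (fun c ρ => by
      split
      · exact Exec.act _ _
      · exact exec_copyVar _ _ _)
    (cellList syms B k)
    (by
      refine (pairwise_cellList k).imp fun {c c'} hc => ⟨fun h => hc.1 ?_, fun ρ b => ?_⟩
      · simp only [Var.cell.injEq, heq_eq_eq, true_and] at h
        exact (Prod.ext h.1 h.2).symm
      · split
        · rfl
        · rw [assign_of_ne]
          intro h
          simp only [Var.cell.injEq] at h
          have h1 := congrArg Fin.val h.1
          have h2 : (c.1 : ℕ) ≤ c'.1 := hc.2
          simp only at h1
          omega) ρ
  refine ⟨ρ', h, ⟨?_, ?_⟩, ?_⟩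
  · intro i k' g'
    by_cases hk : k' = k
    · subst hk
      rw [h1 (i, g') (mem_cellList _ _), Function.update_self]
      split
      · rename_i h0
        simp only at h0
        rw [List.getElem?_eq_none (by rw [List.length_tail]; omega)]
        simp
      · rw [hR.cell]
        simp
    · rw [h2 _ (by simp [hk]), Function.update_of_ne hk, hR.cell]
  · intro k' g' hg'
    by_cases hk : k' = k
    · subst hk
      rw [Function.update_self] at hg'
      exact hR.mem _ _ (List.mem_of_mem_tail hg')
    · rw [Function.update_of_ne hk] at hg'
      exact hR.mem _ _ hg'
  · intro v hv
    refine h2 v fun c _ hc => hv ?_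
    rw [hc]
    trivial

/-- Case distinction on the top of stack `k`. -/
noncomputable def topSwitch (k : tm.K) (p : Option (tm.Γ k) → RegProg 𝕍) : RegProg 𝕍 :=
  switch (fun g => .cell 0 k g) (fun g => p (some g.1)) (p none)
    (Finset.univ : Finset {g // g ∈ syms k}).toList

/-- The cells at depth `0` are one-hot: the top symbol is unique, and the field `mem` guarantees
that it has a cell. -/
theorem exec_topSwitch {ρ ρ' : 𝕍 → Bool} {S : ∀ k, List (tm.Γ k)} (hR : Represents ρ S)
    (k : tm.K) (p : Option (tm.Γ k) → RegProg 𝕍) (h : Exec (p (S k).head?) ρ ρ') :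
    Exec (topSwitch k p) ρ ρ' := by
  cases hS : S k with
  | nil =>
    rw [hS] at h
    refine exec_switch_default _ _ _ _ (fun g => ?_) h
    rw [Bool.eq_false_iff, Ne, hR.cell, hS]
    simp
  | cons g l =>
    rw [hS] at h
    have hg : g ∈ syms k := hR.mem k g (by rw [hS]; exact List.mem_cons_self)
    refine exec_switch (i := (⟨g, hg⟩ : {g // g ∈ syms k})) _ _ _ _
      (Finset.mem_toList.2 (Finset.mem_univ _)) (fun g' => ?_) h
    rw [hR.cell, hS]
    simp [Subtype.ext_iff, eq_comm]

open Classical in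
/-- Set the control state. -/
noncomputable def setState (c : tm.Λ × tm.σ) : RegProg 𝕍 :=
  .seq (.act (.running, true)) <| .seqs <|
    (Finset.univ : Finset (tm.Λ × tm.σ)).toList.map fun d =>
      .act (.st d, decide (d = c))

/-- The valuation represents the control state. -/
def HasState (ρ : 𝕍 → Bool) (l : Option tm.Λ) (v : tm.σ) : Prop :=
  match l with
  | none => ρ .running = false
  | some l => ρ .running = true ∧ ∀ c, ρ (.st c) = true ↔ c = (l, v)

theorem exec_setState (ρ : 𝕍 → Bool) (l : tm.Λ) (v : tm.σ) :
    ∃ ρ', Exec (setState (l, v)) ρ ρ' ∧ HasState ρ' (some l) v ∧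
      (∀ v : 𝕍, v.IsExternal ∨ v.IsCell → ρ' v = ρ v) := by
  classical
  obtain ⟨ρ', h, h1, h2⟩ := exec_seqs_const (V := 𝕍) Var.st (fun _ _ h => by simpa using h)
    (fun c' => decide (c' = (l, v)))
    (Finset.univ : Finset (tm.Λ × tm.σ)).toList
    (Finset.nodup_toList _) (assign (.running, true) ρ)
  refine ⟨ρ', (Exec.act _ _).seq h, ⟨?_, ?_⟩, ?_⟩
  · rw [h2 _ (by simp), assign_self]
  · intro c
    rw [h1 c (by simp)]
    simp
  · intro w hw
    rw [h2 w, assign_of_ne]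
    · rintro rfl
      simp [Var.IsExternal, Var.IsCell] at hw
    · rintro c - rfl
      simp [Var.IsExternal, Var.IsCell] at hw

/-- The code of a statement of the stack machine, for a given internal state. -/
noncomputable def stmtCode : TM2.Stmt tm.Γ tm.Λ tm.σ → tm.σ → RegProg 𝕍
  | push k f q, v => .seq (pushCode k (f v)) (stmtCode q v)
  | peek k f q, v => topSwitch k fun o => stmtCode q (f v o)
  | pop k f q, v => topSwitch k fun o => .seq (popCode k) (stmtCode q (f v o))
  | load f q, v => stmtCode q (f v)
  | branch f q₁ q₂, v => if f v then stmtCode q₁ v else stmtCode q₂ v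
  | goto f, v => setState (f v, v)
  | halt, _ => .act (.running, false)

theorem Var.not_isCell_of_isExternal {v : 𝕍} (h : v.IsExternal) : ¬ v.IsCell := by
  cases v <;> simp_all [Var.IsExternal, Var.IsCell]

/-- The internal state is a parameter of the code generator, not data at run time: each read of a
stack branches on the finitely many tops and continues with code for the resulting state. Only
`goto` writes a state to registers. -/
theorem exec_stmtCode (q : TM2.Stmt tm.Γ tm.Λ tm.σ) (hq : PushesIn syms q) (v : tm.σ)
    {ρ : 𝕍 → Bool} {S : ∀ k, List (tm.Γ k)} (hR : Represents ρ S)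
    (hB : ∀ k, (S k).length + pushes q ≤ B) :
    ∃ ρ', Exec (stmtCode q v) ρ ρ' ∧ Represents ρ' (TM2.stepAux q v S).stk ∧
      HasState ρ' (TM2.stepAux q v S).l (TM2.stepAux q v S).var ∧
      ∀ v : 𝕍, v.IsExternal → ρ' v = ρ v := by
  induction q generalizing v ρ S with
  | push k f q ih =>
    obtain ⟨ρ₁, h1, R1, e1⟩ := exec_pushCode hR k (hq.1 v)
    obtain ⟨ρ₂, h2, R2, s2, e2⟩ := ih hq.2 v R1 (by
      intro k'
      have := hB k'
      simp only [pushes] at this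
      by_cases hk : k' = k
      · subst hk
        simp
        omega
      · simp [hk]
        omega)
    exact ⟨ρ₂, h1.seq h2, R2, s2, fun w hw =>
      (e2 w hw).trans (e1 w (Var.not_isCell_of_isExternal hw))⟩
  | peek k f q ih =>
    obtain ⟨ρ₂, h2, R2, s2, e2⟩ := ih hq (f v (S k).head?) hR hB
    exact ⟨ρ₂, exec_topSwitch hR k _ h2, R2, s2, e2⟩
  | pop k f q ih =>
    obtain ⟨ρ₁, h1, R1, e1⟩ := exec_popCode hR k (by have := hB k; omega)
    obtain ⟨ρ₂, h2, R2, s2, e2⟩ := ih hq (f v (S k).head?) R1 (by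
      intro k'
      have := hB k'
      simp only [pushes] at this
      by_cases hk : k' = k
      · subst hk
        simp
        omega
      · simp [hk]
        omega)
    exact ⟨ρ₂, exec_topSwitch hR k _ (h1.seq h2), R2, s2, fun w hw =>
      (e2 w hw).trans (e1 w (Var.not_isCell_of_isExternal hw))⟩
  | load f q ih => exact ih hq (f v) hR hB
  | branch f q₁ q₂ ih₁ ih₂ =>
    rw [stmtCode, TM2.stepAux]
    cases f v
    · exact ih₂ hq.2 v hR fun k => by have := hB k; simp only [pushes] at this; omega
    · exact ih₁ hq.1 v hR fun k => by have := hB k; simp only [pushes] at this; omega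
  | goto f =>
    obtain ⟨ρ', h, h1, h2⟩ := exec_setState ρ (f v) v
    refine ⟨ρ', h, ⟨fun i k g => ?_, hR.mem⟩, h1, fun w hw => h2 w (Or.inl hw)⟩
    rw [h2 (.cell i k g) (Or.inr trivial)]
    exact hR.cell i k g
  | halt =>
    refine ⟨_, Exec.act _ _, ⟨fun i k g => ?_, hR.mem⟩, assign_self _ _ _, fun w hw => ?_⟩
    · rw [assign_of_ne (by simp)]
      exact hR.cell i k g
    · refine assign_of_ne ?_ _ _
      rintro rfl
      exact hw

/-- One step of the stack machine. -/
noncomputable def stepCode : RegProg 𝕍 :=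
  switch (fun c => .st c) (fun c => stmtCode (tm.m c.1) c.2) .skip
    (Finset.univ : Finset (tm.Λ × tm.σ)).toList

/-- A halting computation of the stack machine is simulated. -/
theorem exec_loop_stepCode (hm : ∀ l, PushesIn syms (tm.m l)) {P : ℕ}
    (hP : ∀ l, pushes (tm.m l) ≤ P) (n : ℕ) (c c' : TM2.Cfg tm.Γ tm.Λ tm.σ) (hc' : c'.l = none)
    (h : (flip bind (TM2.step tm.m))^[n] (some c) = some c') {ρ : 𝕍 → Bool}
    (hR : Represents ρ c.stk) (hs : HasState ρ c.l c.var)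
    (hB : ∀ k, (c.stk k).length + n * P ≤ B) :
    ∃ ρ', Exec (.loop .running stepCode) ρ ρ' ∧ Represents ρ' c'.stk ∧
      ∀ v : 𝕍, v.IsExternal → ρ' v = ρ v := by
  induction n generalizing c ρ with
  | zero =>
    simp only [Function.iterate_zero, id_eq, Option.some.injEq] at h
    subst h
    rw [hc'] at hs
    exact ⟨ρ, Exec.loop_false hs, hR, fun _ _ => rfl⟩
  | succ n ih =>
    obtain ⟨l, v, S⟩ := c
    rw [Function.iterate_succ_apply] at h
    cases l with
    | none =>
      -- A halted configuration has no successor, and `none` is a fixed point of the iteration, so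
      -- it cannot lead to `c'`.
      exfalso
      have h0 : flip bind (TM2.step tm.m) (some ⟨none, v, S⟩) = none := rfl
      rw [h0] at h
      have : ∀ k, (flip bind (TM2.step tm.m))^[k] none = none := by
        intro k
        exact Function.iterate_fixed rfl k
      rw [this] at h
      cases h
    | some l =>
      have h0 : flip bind (TM2.step tm.m) (some ⟨some l, v, S⟩) =
        some (TM2.stepAux (tm.m l) v S) := rfl
      rw [h0] at h
      have hPl := hP l
      have hB' : ∀ k, (S k).length + (n * P + P) ≤ B := fun k => by
        have := hB k
        rwa [Nat.succ_mul] at this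
      obtain ⟨ρ₁, h1, R1, s1, e1⟩ := exec_stmtCode (tm.m l) (hm l) v hR
        (fun k => by have := hB' k; dsimp only; omega)
      obtain ⟨ρ₂, h2, R2, e2⟩ := ih _ h R1 s1 (fun k => by
        have := hB' k
        have := length_stepAux_le (tm.m l) v S k
        omega)
      refine ⟨ρ₂, Exec.loop_true hs.1 ?_ h2, R2, fun w hw => (e2 w hw).trans (e1 w hw)⟩
      exact exec_switch (i := (l, v)) _ _ _ _ (by simp) hs.2 h1

/-- Empty all stacks. -/
noncomputable def clearCode : RegProg 𝕍 :=
  .seqs <| (Finset.univ : Finset (Fin (B + 1) × Σ k, {g // g ∈ syms k})).toList.map fun c =>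
      .act (.cell c.1 c.2.1 c.2.2, false)

/-- Nothing is assumed of `ρ`, because each round of the search starts from whatever the previous
simulation left in the cells. -/
theorem exec_clearCode (ρ : 𝕍 → Bool) :
    ∃ ρ', Exec clearCode ρ ρ' ∧ Represents ρ' (fun _ => []) ∧
      ∀ v : 𝕍, ¬ v.IsCell → ρ' v = ρ v := by
  obtain ⟨ρ', h, h1, h2⟩ := exec_seqs_const (V := 𝕍)
    (fun c : Fin (B + 1) × Σ k, {g // g ∈ syms k} => .cell c.1 c.2.1 c.2.2)
    (by
      rintro ⟨i, k, g⟩ ⟨i', k', g'⟩ h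
      simp only [Var.cell.injEq] at h
      obtain ⟨rfl, rfl, h⟩ := h
      rw [eq_of_heq h])
    (fun _ => false) (Finset.univ : Finset (Fin (B + 1) × Σ k, {g // g ∈ syms k})).toList
    (Finset.nodup_toList _) ρ
  refine ⟨ρ', h, ⟨fun i k g => ?_, by simp⟩, fun v hv => h2 v fun c _ hc => hv ?_⟩
  · rw [h1 (i, ⟨k, g⟩) (by simp)]
    simp
  · rw [hc]
    trivial

/-- Push the symbols given by the programs `p i` in such a way that the first one is on top. -/
def pushAll {ι : Type} (p : ι → RegProg 𝕍) : List ι → RegProg 𝕍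
  | [] => .skip
  | i :: l => .seq (pushAll p l) (p i)

theorem size_pushAll_le {ι : Type} (p : ι → RegProg 𝕍) (l : List ι) (n : ℕ)
    (h : ∀ i, (p i).size ≤ n) : (pushAll p l).size ≤ l.length * n := by
  induction l with
  | nil => simp [pushAll, Prog.size]
  | cons i l ih =>
    simp only [pushAll, Prog.size, List.length_cons]
    have := h i
    linarith

/-- The symbols depend on external variables only, which pushes leave alone, so all of them can be
read off the initial valuation. The value `none` stands for pushing nothing. -/
theorem exec_pushAll {ι : Type} (k : tm.K) (p : ι → RegProg 𝕍)
    (o : ι → (𝕍 → Bool) → Option (tm.Γ k))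
    (ho : ∀ i ρ ρ', (∀ v : 𝕍, v.IsExternal → ρ' v = ρ v) → o i ρ' = o i ρ)
    (hp : ∀ i ρ S, Represents ρ S → ∃ ρ', Exec (p i) ρ ρ' ∧
      Represents ρ' (Function.update S k ((o i ρ).toList ++ S k)) ∧
      ∀ v : 𝕍, v.IsExternal → ρ' v = ρ v)
    (l : List ι) {ρ : 𝕍 → Bool} {S : ∀ k, List (tm.Γ k)} (hR : Represents ρ S) :
    ∃ ρ', Exec (pushAll p l) ρ ρ' ∧
      Represents ρ' (Function.update S k (l.filterMap (o · ρ) ++ S k)) ∧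
      ∀ v : 𝕍, v.IsExternal → ρ' v = ρ v := by
  induction l with
  | nil => exact ⟨ρ, Exec.skip ρ, by simpa using hR, fun _ _ => rfl⟩
  | cons i l ih =>
    obtain ⟨ρ₁, h1, R1, e1⟩ := ih
    obtain ⟨ρ₂, h2, R2, e2⟩ := hp i ρ₁ _ R1
    refine ⟨ρ₂, h1.seq h2, ?_, fun v hv => (e2 v hv).trans (e1 v hv)⟩
    rw [ho i ρ ρ₁ e1] at R2
    simp only [Function.update_self, Function.update_idem, ← List.append_assoc] at R2
    rw [List.filterMap_cons]
    cases h : o i ρ <;> simpa [h] using R2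

end Simulation

end InstrSeq

namespace InstrSeq

open Turing TM2.Stmt StateTransition

/-! ### Search for witnesses by a register program -/

section Search

variable {tm : FinTM2} {syms : ∀ k, Finset (tm.Γ k)} {m W B : ℕ}

attribute [local instance] FinTM2.kFin FinTM2.ΛFin FinTM2.σFin

local notation "𝕍" => Var tm syms m W B

/-- The input held by a valuation. -/
def heldInput (ρ : 𝕍 → Bool) : List Bool := (List.finRange m).map fun i => ρ (.inp i)

/-- The candidate witness held by a valuation. -/
def heldWitness (ρ : 𝕍 → Bool) : List Bool :=
  (List.finRange W).filterMap fun j =>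
    if ρ (.choice (j, false)) then some (ρ (.choice (j, true))) else none

theorem length_heldInput (ρ : 𝕍 → Bool) : (heldInput ρ).length = m := by
  simp [heldInput]

theorem length_heldWitness_le (ρ : 𝕍 → Bool) : (heldWitness ρ).length ≤ W := by
  refine (List.length_filterMap_le _ _).trans ?_
  simp

theorem filterMap_range_getElem? {α : Type} (w : List α) (n : ℕ) (h : w.length ≤ n) :
    (List.range n).filterMap (fun j => w[j]?) = w := by
  induction w generalizing n with
  | nil => simp
  | cons a w ih =>
    obtain ⟨n, rfl⟩ : ∃ k, n = k + 1 := ⟨n - 1, by simp at h; omega⟩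
    rw [List.range_succ_eq_map, List.filterMap_cons, List.filterMap_map]
    simp only [List.length_cons, add_le_add_iff_right] at h
    simpa [Function.comp_def] using ih n h

theorem filterMap_finRange_getElem? {α : Type} (w : List α) (n : ℕ) (h : w.length ≤ n) :
    (List.finRange n).filterMap (fun j : Fin n => w[(j : ℕ)]?) = w := by
  have := filterMap_range_getElem? w n h
  rw [← List.map_coe_finRange_eq_range, List.filterMap_map] at this
  exact this

theorem map_finRange_getD (x : List Bool) (hx : x.length = m) :
    (List.finRange m).map (fun i : Fin m => x.getD (i : ℕ) false) = x := by
  subst hx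
  apply List.ext_getElem
  · simp
  · intro i h1 h2
    simp

/-- Run the stack machine on the input and the candidate witness, and add its answer to `out`. -/
noncomputable def searchBody (sym : Bool ⊕ Bool → tm.Γ tm.k₀) (a : {g // g ∈ syms tm.k₁}) :
    RegProg 𝕍 :=
  .seq clearCode <|
  .seq (pushAll (fun j => .ite (.choice (j, false))
    (.ite (.choice (j, true)) (pushCode tm.k₀ (sym (.inr true)))
      (pushCode tm.k₀ (sym (.inr false)))) .skip) (List.finRange W)) <|
  .seq (pushAll (fun i => .ite (.inp i) (pushCode tm.k₀ (sym (.inl true)))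
    (pushCode tm.k₀ (sym (.inl false)))) (List.finRange m)) <|
  .seq (setState (tm.main, tm.initialState)) <|
  .seq (.loop .running stepCode) <|
  .ite (.cell 0 tm.k₁ a) (.act (.out, true)) .skip

theorem initList_eq (s : List (tm.Γ tm.k₀)) :
    (initList tm s).stk = Function.update (fun _ => []) tm.k₀ s := by
  funext k
  by_cases h : k = tm.k₀
  · subst h
    simp [initList]
  · simp [initList, h]

theorem haltList_eq (s : List (tm.Γ tm.k₁)) :
    (haltList tm s).stk = Function.update (fun _ => []) tm.k₁ s := by
  funext k
  by_cases h : k = tm.k₁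
  · subst h
    simp [haltList]
  · simp [haltList, h]

theorem exec_pushSym {ρ : 𝕍 → Bool} {S : ∀ k, List (tm.Γ k)} (hR : Represents ρ S)
    (sym : Bool → tm.Γ tm.k₀) (hsym : ∀ b, sym b ∈ syms tm.k₀) (v : 𝕍) :
    ∃ ρ', Exec (.ite v (pushCode tm.k₀ (sym true)) (pushCode tm.k₀ (sym false))) ρ ρ' ∧
      Represents ρ' (Function.update S tm.k₀ ((some (sym (ρ v))).toList ++ S tm.k₀)) ∧
      ∀ v : 𝕍, v.IsExternal → ρ' v = ρ v := by
  obtain ⟨ρ', h, h1, h2⟩ := exec_pushCode hR tm.k₀ (hsym (ρ v))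
  refine ⟨ρ', Exec.ite ?_, h1, fun w hw => h2 w (Var.not_isCell_of_isExternal hw)⟩
  cases hv : ρ v <;> simpa [hv] using h

/-- One full simulation for the current candidate. It leaves input and candidate in place and can
only raise `out`, which is what the surrounding loops require of their body. -/
theorem exec_searchBody (hm : ∀ l, PushesIn syms (tm.m l)) {P : ℕ}
    (hP : ∀ l, pushes (tm.m l) ≤ P) (sym : Bool ⊕ Bool → tm.Γ tm.k₀)
    (hsym : ∀ b, sym b ∈ syms tm.k₀) (a : {g // g ∈ syms tm.k₁}) (ρ : 𝕍 → Bool)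
    {n : ℕ} {s : List (tm.Γ tm.k₁)}
    (h : (flip bind (TM2.step tm.m))^[n] (some (initList tm
      ((((heldInput ρ).map Sum.inl) ++ ((heldWitness ρ).map Sum.inr)).map sym))) =
        some (haltList tm s))
    (hB : m + W + n * P ≤ B) :
    ∃ ρ', Exec (searchBody sym a) ρ ρ' ∧ (∀ v : 𝕍, v.IsExternal ∧ v ≠ .out → ρ' v = ρ v) ∧
      (ρ' .out = true ↔ ρ .out = true ∨ s.head? = some a.1) := by
  obtain ⟨ρ₁, h1, R1, e1⟩ := exec_clearCode ρ
  obtain ⟨ρ₂, h2, R2, e2⟩ := exec_pushAll tm.k₀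
    (fun j => .ite (.choice (j, false)) (.ite (.choice (j, true))
      (pushCode tm.k₀ (sym (.inr true))) (pushCode tm.k₀ (sym (.inr false)))) .skip)
    (fun j ρ => if ρ (.choice (j, false)) then some (sym (.inr (ρ (.choice (j, true))))) else none)
    (fun j ρ ρ' h => by
      simp only [h (.choice (j, false)) trivial, h (.choice (j, true)) trivial])
    (fun j ρ S hR => by
      cases hj : ρ (.choice (j, false)) with
      | false =>
        refine ⟨ρ, Exec.ite ?_, by simpa using hR, fun _ _ => rfl⟩
        rw [hj]
        exact Exec.skip ρ
      | true =>
        obtain ⟨ρ', h, h1, h2⟩ := exec_pushSym hR (fun b => sym (.inr b)) (fun b => hsym _)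
          (.choice (j, true))
        refine ⟨ρ', Exec.ite ?_, h1, h2⟩
        rw [hj]
        exact h)
    (List.finRange W) R1
  obtain ⟨ρ₃, h3, R3, e3⟩ := exec_pushAll tm.k₀
    (fun i => .ite (.inp i) (pushCode tm.k₀ (sym (.inl true))) (pushCode tm.k₀ (sym (.inl false))))
    (fun i ρ => some (sym (.inl (ρ (.inp i)))))
    (fun i ρ ρ' h => by simp only [h (.inp i) trivial])
    (fun i ρ S hR => exec_pushSym hR (fun b => sym (.inl b)) (fun b => hsym _) (.inp i))
    (List.finRange m) R2
  obtain ⟨ρ₄, h4, s4, e4⟩ := exec_setState ρ₃ tm.main tm.initialState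
  have E1 : ∀ v : 𝕍, v.IsExternal → ρ₁ v = ρ v := fun v hv =>
    e1 v (Var.not_isCell_of_isExternal hv)
  have E2 : ∀ v : 𝕍, v.IsExternal → ρ₂ v = ρ v := fun v hv => (e2 v hv).trans (E1 v hv)
  have E4 : ∀ v : 𝕍, v.IsExternal → ρ₄ v = ρ v := fun v hv =>
    (e4 v (Or.inl hv)).trans ((e3 v hv).trans (E2 v hv))
  -- The witness is pushed first, so the input lies on top of it, as in the encoding of the pair.
  have hS : Function.update (Function.update (fun k => ([] : List (tm.Γ k))) tm.k₀
      ((List.finRange W).filterMap (fun j => if ρ₁ (.choice (j, false)) then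
        some (sym (.inr (ρ₁ (.choice (j, true))))) else none) ++ [])) tm.k₀
      ((List.finRange m).filterMap (fun i => some (sym (.inl (ρ₂ (.inp i))))) ++
        Function.update (fun k => ([] : List (tm.Γ k))) tm.k₀
      ((List.finRange W).filterMap (fun j => if ρ₁ (.choice (j, false)) then
        some (sym (.inr (ρ₁ (.choice (j, true))))) else none) ++ []) tm.k₀) =
      (initList tm
      ((((heldInput ρ).map Sum.inl) ++ ((heldWitness ρ).map Sum.inr)).map sym)).stk := by
    rw [initList_eq, Function.update_idem, Function.update_self, List.append_nil]
    congr 1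
    rw [List.map_append, heldInput, heldWitness]
    congr 1
    · rw [List.map_map, List.map_map, ← List.filterMap_eq_map]
      refine List.filterMap_congr fun i _ => ?_
      simp [E2 (.inp i) trivial]
    · simp only [List.map_filterMap]
      refine List.filterMap_congr fun j _ => ?_
      rw [E1 (.choice (j, false)) trivial, E1 (.choice (j, true)) trivial]
      cases ρ (.choice (j, false)) <;> simp
  have R4 : Represents ρ₄ (initList tm
      ((((heldInput ρ).map Sum.inl) ++ ((heldWitness ρ).map Sum.inr)).map sym)).stk := by
    rw [← hS]
    refine ⟨fun i k g => ?_, R3.mem⟩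
    rw [e4 (.cell i k g) (Or.inr trivial)]
    exact R3.cell i k g
  obtain ⟨ρ₅, h5, R5, e5⟩ := exec_loop_stepCode hm hP n _ _ rfl h R4 s4 (by
    intro k
    have hl : ((initList tm
      ((((heldInput ρ).map Sum.inl) ++ ((heldWitness ρ).map Sum.inr)).map sym)).stk k).length ≤
        m + W := by
      rw [initList_eq]
      by_cases hk : k = tm.k₀
      · subst hk
        have := length_heldInput ρ
        have := length_heldWitness_le ρ
        simp only [Function.update_self, List.length_map, List.length_append]
        omega
      · simp [hk]
    omega)
  have E5 : ∀ v : 𝕍, v.IsExternal → ρ₅ v = ρ v := fun v hv => (e5 v hv).trans (E4 v hv)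
  have h6 := R5.cell 0 tm.k₁ a
  rw [haltList_eq, Function.update_self] at h6
  have h6' : ρ₅ (.cell 0 tm.k₁ a) = true ↔ s.head? = some a.1 := by
    rw [h6, List.head?_eq_getElem?]
    rfl
  cases hb : ρ₅ (.cell 0 tm.k₁ a) with
  | true =>
    refine ⟨assign (.out, true) ρ₅, h1.seq (h2.seq (h3.seq (h4.seq (h5.seq (Exec.ite ?_))))),
      fun v hv => ?_, ?_⟩
    · rw [hb]
      exact Exec.act _ _
    · rw [assign_of_ne hv.2, E5 v hv.1]
    · rw [assign_self, ← h6', hb]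
      simp
  | false =>
    refine ⟨ρ₅, h1.seq (h2.seq (h3.seq (h4.seq (h5.seq (Exec.ite ?_))))),
      fun v hv => E5 v hv.1, ?_⟩
    · rw [hb]
      exact Exec.skip _
    · rw [E5 .out trivial, ← h6', hb]
      simp

/-- The loop variables that hold a candidate witness. -/
def choiceList : List 𝕍 :=
  (List.finRange W).flatMap fun j => [.choice (j, false), .choice (j, true)]

theorem nodup_choiceList : (choiceList : List 𝕍).Nodup := by
  rw [choiceList, List.nodup_flatMap]
  refine ⟨fun j _ => by simp, (List.nodup_finRange W).imp fun {i j} hij => ?_⟩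
  simp [Function.onFun, List.disjoint_left, hij]

theorem mem_choiceList (v : 𝕍) : v ∈ (choiceList : List 𝕍) ↔ ∃ c, v = .choice c := by
  simp only [choiceList, List.mem_flatMap, List.mem_finRange, true_and, List.mem_cons,
    List.not_mem_nil, or_false, Prod.exists, Bool.exists_bool]

/-- Search for a witness that the stack machine accepts. -/
noncomputable def searchProg (sym : Bool ⊕ Bool → tm.Γ tm.k₀) (a : {g // g ∈ syms tm.k₁}) :
    RegProg 𝕍 :=
  forBits .again (searchBody sym a) choiceList

/-- Quantifying over the choice bits amounts to quantifying over witnesses of length at most `W`: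
each place has a presence bit and a value bit, so shorter witnesses are covered, possibly several
times. -/
theorem exec_searchProg (hm : ∀ l, PushesIn syms (tm.m l)) {P : ℕ}
    (hP : ∀ l, pushes (tm.m l) ≤ P) (sym : Bool ⊕ Bool → tm.Γ tm.k₀)
    (hsym : ∀ b, sym b ∈ syms tm.k₀) (a : {g // g ∈ syms tm.k₁})
    (χ : List Bool × List Bool → Bool) (T : ℕ) (hB : m + W + T * P ≤ B)
    (hχ : ∀ x w : List Bool, x.length = m → w.length ≤ W → ∃ n ≤ T, ∃ s : List (tm.Γ tm.k₁),
      (flip bind (TM2.step tm.m))^[n] (some (initList tm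
        ((x.map Sum.inl ++ w.map Sum.inr).map sym))) = some (haltList tm s) ∧
      (s.head? = some a.1 ↔ χ (x, w) = true))
    (ρ : 𝕍 → Bool) (x : List Bool) (hx : x.length = m)
    (hρ : ∀ i, ρ (.inp i) = x.getD i false) (hout : ρ .out = false) :
    ∃ ρ', Exec (searchProg sym a) ρ ρ' ∧
      (ρ' .out = true ↔ ∃ w : List Bool, w.length ≤ W ∧ χ (x, w) = true) := by
  have hbody : Accumulates (fun v : 𝕍 => v.IsExternal ∧ v ≠ .out) .out (searchBody sym a)
      fun ρ => χ (heldInput ρ, heldWitness ρ) = true := by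
    intro ρ
    obtain ⟨n, hn, s, h, h'⟩ := hχ (heldInput ρ) (heldWitness ρ) (length_heldInput ρ)
      (length_heldWitness_le ρ)
    obtain ⟨ρ', h1, h2, h3⟩ := exec_searchBody hm hP sym hsym a ρ h
      (le_trans (Nat.add_le_add_left (Nat.mul_le_mul_right P hn) _) hB)
    exact ⟨ρ', h1, h2, h3.trans (or_congr_right h')⟩
  obtain ⟨ρ', h, -, h'⟩ := accumulates_forBits hbody
    (by
      intro ρ ρ' h hρ
      have h1 : heldInput ρ = heldInput ρ' := by
        refine List.map_congr_left fun i _ => h _ ⟨trivial, by simp⟩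
      have h2 : heldWitness ρ = heldWitness ρ' := by
        refine List.filterMap_congr fun j _ => ?_
        rw [h (.choice (j, false)) ⟨trivial, by simp⟩, h (.choice (j, true)) ⟨trivial, by simp⟩]
      rwa [← h1, ← h2])
    (d := .again) (by simp [Var.IsExternal]) (by simp) (by simp) choiceList nodup_choiceList
    (by
      intro v hv
      obtain ⟨c, rfl⟩ := (mem_choiceList v).1 hv
      exact ⟨trivial, by simp⟩) ρ
  refine ⟨ρ', h, ?_⟩
  rw [h', hout]
  simp only [Bool.false_eq_true, false_or]
  have hin : ∀ ρ' : 𝕍 → Bool, (∀ i, ρ' (.inp i) = ρ (.inp i)) → heldInput ρ' = x := by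
    intro ρ' h
    rw [← map_finRange_getD x hx]
    exact List.map_congr_left fun i _ => (h i).trans (hρ i)
  constructor
  · rintro ⟨ρ'', h1, h2⟩
    refine ⟨heldWitness ρ'', length_heldWitness_le _, ?_⟩
    rwa [hin ρ''] at h2
    intro i
    exact h1 _ ⟨trivial, by simp⟩ (by rw [mem_choiceList]; simp)
  · rintro ⟨w, hw, hχw⟩
    -- The first `w.length` places are declared present and hold `w`; the default `false` beyond
    -- them is filtered out.
    set ρ'' : 𝕍 → Bool := fun v => match v with
      | .choice (j, false) => decide ((j : ℕ) < w.length)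
      | .choice (j, true) => w.getD j false
      | v => ρ v with hρ''
    refine ⟨ρ'', ?_, ?_⟩
    · intro v hv hv'
      rw [mem_choiceList] at hv'
      cases v with
      | choice c => exact absurd ⟨c, rfl⟩ hv'
      | _ => rfl
    · rw [hin ρ'' fun i => rfl]
      convert hχw
      rw [heldWitness]
      conv_rhs => rw [← filterMap_finRange_getElem? w W hw]
      refine List.filterMap_congr fun j _ => ?_
      by_cases hj : (j : ℕ) < w.length
      · simp [hρ'', hj]
      · simp [hρ'', hj]

end Search

end InstrSeq

namespace InstrSeq

open Turing TM2.Stmt StateTransition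

/-! ### Size of the search program -/

section Size

variable {tm : FinTM2}

attribute [local instance] FinTM2.kFin FinTM2.ΛFin FinTM2.σFin

theorem size_topSwitch_le {syms : ∀ k, Finset (tm.Γ k)} {m W B : ℕ} (k : tm.K)
    (p : Option (tm.Γ k) → RegProg (Var tm syms m W B)) (n : ℕ) (h : ∀ o, (p o).size ≤ n) :
    (topSwitch k p).size ≤ (syms k).card * (n + 4) + n := by
  refine (size_switch_le _ _ _ _ n fun g _ => h _).trans ?_
  have := h none
  simp only [Finset.length_toList, Finset.card_univ, Fintype.card_coe]
  omega

theorem size_setState {syms : ∀ k, Finset (tm.Γ k)} {m W B : ℕ} (c : tm.Λ × tm.σ) :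
    (setState c : RegProg (Var tm syms m W B)).size ≤ 1 + Fintype.card (tm.Λ × tm.σ) := by
  simp only [setState, Prog.size]
  refine Nat.add_le_add_left ((size_seqs_map_le _ _ 1 fun c _ => le_rfl).trans ?_) _
  simp

/-- Code is duplicated at each read of a stack, but the blow-up depends only on the statement and
the alphabet; the height `B` enters linearly, through the shifts. -/
theorem exists_size_stmtCode_le (syms : ∀ k, Finset (tm.Γ k)) (q : TM2.Stmt tm.Γ tm.Λ tm.σ) :
    ∃ C, ∀ m W B v, (stmtCode q v : RegProg (Var tm syms m W B)).size ≤ C * (B + 1) := by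
  induction q with
  | push k f q ih =>
    obtain ⟨C, hC⟩ := ih
    refine ⟨(syms k).card * 6 + C, fun m W B v => ?_⟩
    have h1 := size_pushCode_le (m := m) (W := W) (B := B) (syms := syms) k (f v)
    have h2 := hC m W B v
    simp only [stmtCode, Prog.size]
    linarith
  | peek k f q ih =>
    obtain ⟨C, hC⟩ := ih
    refine ⟨(syms k).card * (C + 4) + C, fun m W B v => ?_⟩
    refine (size_topSwitch_le k _ _ fun o => hC m W B _).trans ?_
    nlinarith [Nat.zero_le ((syms k).card * B)]
  | pop k f q ih =>
    obtain ⟨C, hC⟩ := ih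
    refine ⟨(syms k).card * ((syms k).card * 6 + C + 4) + ((syms k).card * 6 + C),
      fun m W B v => ?_⟩
    refine (size_topSwitch_le k _ (((syms k).card * 6 + C) * (B + 1)) fun o => ?_).trans ?_
    · have h1 := size_popCode_le (m := m) (W := W) (B := B) (syms := syms) k
      have h2 := hC m W B (f v o)
      simp only [Prog.size]
      linarith
    · nlinarith [Nat.zero_le ((syms k).card * B)]
  | load f q ih =>
    obtain ⟨C, hC⟩ := ih
    exact ⟨C, fun m W B v => hC m W B (f v)⟩
  | branch f q₁ q₂ ih₁ ih₂ =>
    obtain ⟨C₁, hC₁⟩ := ih₁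
    obtain ⟨C₂, hC₂⟩ := ih₂
    refine ⟨C₁ + C₂, fun m W B v => ?_⟩
    rw [stmtCode, Nat.add_mul]
    split
    · exact (hC₁ m W B v).trans (Nat.le_add_right _ _)
    · exact (hC₂ m W B v).trans (Nat.le_add_left _ _)
  | goto f =>
    refine ⟨1 + Fintype.card (tm.Λ × tm.σ), fun m W B v => (size_setState _).trans ?_⟩
    exact Nat.le_mul_of_pos_right _ (Nat.succ_pos _)
  | halt => exact ⟨1, fun m W B v => by simp [stmtCode, Prog.size]⟩

theorem exists_size_stepCode_le (syms : ∀ k, Finset (tm.Γ k)) :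
    ∃ C, ∀ m W B, (stepCode : RegProg (Var tm syms m W B)).size ≤ C * (B + 1) := by
  choose C hC using fun l => exists_size_stmtCode_le syms (tm.m l)
  refine ⟨Fintype.card (tm.Λ × tm.σ) * (∑ l, C l + 4), fun m W B => ?_⟩
  refine (size_switch_le _ _ _ _ ((∑ l, C l) * (B + 1)) fun c _ => ?_).trans ?_
  · refine (hC c.1 m W B c.2).trans (Nat.mul_le_mul_right _ ?_)
    exact Finset.single_le_sum (f := C) (fun _ _ => Nat.zero_le _) (Finset.mem_univ c.1)
  · simp only [Finset.length_toList, Finset.card_univ, Prog.size, Nat.add_zero]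
    rw [Nat.mul_assoc]
    refine Nat.mul_le_mul_left _ ?_
    linarith

theorem exists_size_searchProg_le (syms : ∀ k, Finset (tm.Γ k)) :
    ∃ C, ∀ m W B sym a, (searchProg sym a : RegProg (Var tm syms m W B)).size ≤
      C * ((B + 1) * (m + W + 1)) := by
  obtain ⟨C, hC⟩ := exists_size_stepCode_le syms
  set G := Fintype.card (Σ k, {g // g ∈ syms k}) with hG
  set Q := Fintype.card (tm.Λ × tm.σ) with hQ
  set D := (syms tm.k₀).card * 6 with hD
  -- The summands pay for clearing, pushing the witness, pushing the input, setting the state, the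
  -- main loop, the final test, and twice the cost `13` of a loop over one bit for each witness
  -- place.
  refine ⟨G + (2 * D + 8) + (2 * D + 4) + (1 + Q) + (C + 4) + 5 + 26, fun m W B sym a => ?_⟩
  have hch : (choiceList : List (Var tm syms m W B)).length = 2 * W := by
    simp [choiceList, List.length_flatMap, Nat.mul_comm]
  rw [searchProg, size_forBits, hch]
  simp only [searchBody, Prog.size]
  have hpush : ∀ g, (pushCode tm.k₀ g : RegProg (Var tm syms m W B)).size ≤ D * (B + 1) := by
    intro g
    have := size_pushCode_le (m := m) (W := W) (B := B) (syms := syms) tm.k₀ g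
    rw [hD]
    linarith
  have h1 : (clearCode : RegProg (Var tm syms m W B)).size ≤ G * (B + 1) := by
    refine (size_seqs_map_le _ _ 1 fun c _ => le_rfl).trans ?_
    rw [Finset.length_toList, Finset.card_univ, Fintype.card_prod, Fintype.card_fin, ← hG]
    linarith
  have h2 := size_pushAll_le (syms := syms) (m := m) (W := W) (B := B)
    (fun j => .ite (.choice (j, false))
    (.ite (.choice (j, true)) (pushCode tm.k₀ (sym (.inr true)))
      (pushCode tm.k₀ (sym (.inr false)))) .skip) (List.finRange W) ((2 * D + 8) * (B + 1))
    (fun j => by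
      have h1 := hpush (sym (.inr true))
      have h2 := hpush (sym (.inr false))
      simp only [Prog.size]
      nlinarith)
  have h3 := size_pushAll_le (syms := syms) (m := m) (W := W) (B := B)
    (fun i => .ite (.inp i) (pushCode tm.k₀ (sym (.inl true)))
    (pushCode tm.k₀ (sym (.inl false)))) (List.finRange m) ((2 * D + 4) * (B + 1))
    (fun j => by
      have h1 := hpush (sym (.inl true))
      have h2 := hpush (sym (.inl false))
      simp only [Prog.size]
      nlinarith)
  have h4 := size_setState (syms := syms) (m := m) (W := W) (B := B) (tm.main, tm.initialState)
  have h5 := hC m W B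
  rw [List.length_finRange] at h2 h3
  rw [← hQ] at h4
  have hu : 1 ≤ (B + 1) * (m + W + 1) := Nat.mul_pos (by omega) (by omega)
  have hB : B + 1 ≤ (B + 1) * (m + W + 1) := Nat.le_mul_of_pos_right _ (by omega)
  have hW : W ≤ (B + 1) * (m + W + 1) :=
    (by omega : W ≤ m + W + 1).trans (Nat.le_mul_of_pos_left _ (by omega))
  have hW' : W * (B + 1) ≤ (B + 1) * (m + W + 1) := by
    rw [Nat.mul_comm]
    exact Nat.mul_le_mul_left _ (by omega)
  have hm' : m * (B + 1) ≤ (B + 1) * (m + W + 1) := by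
    rw [Nat.mul_comm]
    exact Nat.mul_le_mul_left _ (by omega)
  generalize (B + 1) * (m + W + 1) = U at *
  have k1 := Nat.mul_le_mul_left G hB
  have k2 := Nat.mul_le_mul_left (2 * D + 8) hW'
  have k3 := Nat.mul_le_mul_left (2 * D + 4) hm'
  have k4 := Nat.mul_le_mul_left (1 + Q) hu
  have k5 := Nat.mul_le_mul_left C hB
  have h2' : (2 * D + 8) * (W * (B + 1)) = W * ((2 * D + 8) * (B + 1)) := by ring
  have h3' : (2 * D + 4) * (m * (B + 1)) = m * ((2 * D + 4) * (B + 1)) := by ring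
  simp only [Nat.add_mul _ _ U]
  rw [Nat.add_mul] at k4
  rw [Nat.add_mul _ _ (W * (B + 1))] at k2
  rw [Nat.add_mul _ _ (m * (B + 1))] at k3
  linarith

end Size

/-! ### Finitely many symbols suffice -/

/-- The symbols that a statement may push. -/
def pushedSyms {tm : FinTM2} : TM2.Stmt tm.Γ tm.Λ tm.σ → Set (Σ k, tm.Γ k)
  | push k f q => Set.range (fun v => ⟨k, f v⟩) ∪ pushedSyms q
  | peek _ _ q => pushedSyms q
  | pop _ _ q => pushedSyms q
  | load _ q => pushedSyms q
  | branch _ q₁ q₂ => pushedSyms q₁ ∪ pushedSyms q₂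
  | goto _ => ∅
  | halt => ∅

theorem finite_pushedSyms {tm : FinTM2} (q : TM2.Stmt tm.Γ tm.Λ tm.σ) :
    (pushedSyms q).Finite := by
  have := tm.σFin
  induction q with
  | push k f q ih => exact (Set.finite_range _).union ih
  | peek k f q ih => exact ih
  | pop k f q ih => exact ih
  | load f q ih => exact ih
  | branch f q₁ q₂ ih₁ ih₂ => exact ih₁.union ih₂
  | goto f => exact Set.finite_empty
  | halt => exact Set.finite_empty

theorem pushesIn_of_subset {tm : FinTM2} {syms : ∀ k, Finset (tm.Γ k)}
    (q : TM2.Stmt tm.Γ tm.Λ tm.σ) (h : ∀ c ∈ pushedSyms q, c.2 ∈ syms c.1) :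
    PushesIn syms q := by
  induction q with
  | push k f q ih =>
    exact ⟨fun v => h ⟨k, f v⟩ (Or.inl ⟨v, rfl⟩), ih fun c hc => h c (Or.inr hc)⟩
  | peek k f q ih => exact ih h
  | pop k f q ih => exact ih h
  | load f q ih => exact ih h
  | branch f q₁ q₂ ih₁ ih₂ =>
    exact ⟨ih₁ fun c hc => h c (Or.inl hc), ih₂ fun c hc => h c (Or.inr hc)⟩
  | goto f => trivial
  | halt => trivial

/-- The stack alphabets may be infinite, but pushed symbols are functions of the internal state, so
finitely many labels and states produce finitely many of them. `A` adds the input symbols and the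
accepting output symbol. -/
theorem exists_syms (tm : FinTM2) (A : Set (Σ k, tm.Γ k)) (hA : A.Finite) :
    ∃ syms : ∀ k, Finset (tm.Γ k), (∀ l, PushesIn syms (tm.m l)) ∧ ∀ c ∈ A, c.2 ∈ syms c.1 := by
  have := tm.ΛFin
  have hfin : ((⋃ l, pushedSyms (tm.m l)) ∪ A).Finite :=
    (Set.finite_iUnion fun l => finite_pushedSyms _).union hA
  have hk : ∀ k, (Sigma.mk k ⁻¹' ((⋃ l, pushedSyms (tm.m l)) ∪ A)).Finite := fun k =>
    hfin.preimage sigma_mk_injective.injOn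
  refine ⟨fun k => (hk k).toFinset, fun l => pushesIn_of_subset _ fun c hc => ?_, fun c hc => ?_⟩
  · rw [Set.Finite.mem_toFinset]
    exact Or.inl (Set.mem_iUnion.2 ⟨l, hc⟩)
  · rw [Set.Finite.mem_toFinset]
    exact Or.inr hc

/-! ### PGLB instruction sequences for NP -/

section Naming

attribute [local instance] FinTM2.kFin FinTM2.ΛFin FinTM2.σFin

/-- The auxiliary variables. -/
abbrev AuxVar (tm : FinTM2) (syms : ∀ k, Finset (tm.Γ k)) (W B : ℕ) : Type :=
  (Fin (B + 1) × Σ k, {g // g ∈ syms k}) ⊕ (tm.Λ × tm.σ) ⊕ (Fin W × Bool) ⊕ Bool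

variable {tm : FinTM2} {syms : ∀ k, Finset (tm.Γ k)} {m W B : ℕ}

/-- The number of an auxiliary variable. -/
noncomputable def auxFocus (v : AuxVar tm syms W B) : Focus :=
  ⟨.aux0, (Fintype.equivFin (AuxVar tm syms W B) v : ℕ) + 1⟩

theorem auxFocus_injective : Function.Injective (auxFocus : AuxVar tm syms W B → Focus) := by
  intro v w h
  simp only [auxFocus, Focus.mk.injEq, true_and, add_left_inj] at h
  exact (Fintype.equivFin _).injective (Fin.ext h)

/-- The registers that hold the variables. -/
noncomputable def varFocus : Var tm syms m W B → Focus
  | .inp i => ⟨.inp, i + 1⟩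
  | .out => ⟨.out0, 1⟩
  | .cell i k g => auxFocus (W := W) (B := B) (syms := syms) (.inl (i, ⟨k, g⟩))
  | .st c => auxFocus (W := W) (B := B) (syms := syms) (.inr (.inl c))
  | .choice c => auxFocus (W := W) (B := B) (syms := syms) (.inr (.inr (.inl c)))
  | .running => auxFocus (W := W) (B := B) (syms := syms) (.inr (.inr (.inr false)))
  | .again => auxFocus (W := W) (B := B) (syms := syms) (.inr (.inr (.inr true)))

theorem varFocus_injective : Function.Injective (varFocus : Var tm syms m W B → Focus) := by
  intro v w h
  cases v <;> cases w <;> simp only [varFocus] at h <;>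
    first
    | rfl
    | (have h' := auxFocus_injective h; simp at h'; done)
    | (have h' := auxFocus_injective h
       simp only [Sum.inl.injEq, Sum.inr.injEq, Prod.mk.injEq] at h'
       first
       | (obtain ⟨rfl, h''⟩ := h'; cases h''; rfl)
       | rw [h'])
    | (simp [auxFocus] at h; done)
    | (simp only [Focus.mk.injEq, true_and, add_left_inj] at h; rw [Fin.ext h])

/-- The registers used by the search program. -/
noncomputable def searchFoci (m N : ℕ) : List Focus :=
  (List.range m).map (fun i => ⟨.inp, i + 1⟩) ++ ⟨.out0, 1⟩ ::
    (List.range N).map (fun i => ⟨.aux0, i + 1⟩)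

theorem varFocus_mem (v : Var tm syms m W B) :
    varFocus v ∈ searchFoci m (Fintype.card (AuxVar tm syms W B)) := by
  have haux : ∀ w : AuxVar tm syms W B,
      auxFocus w ∈ searchFoci m (Fintype.card (AuxVar tm syms W B)) := by
    intro w
    refine List.mem_append_right _ (List.mem_cons_of_mem _ (List.mem_map.2 ⟨_, ?_, rfl⟩))
    exact List.mem_range.2 (Fin.is_lt _)
  cases v with
  | inp i => exact List.mem_append_left _ (List.mem_map.2 ⟨i, List.mem_range.2 i.2, rfl⟩)
  | out => exact List.mem_append_right _ List.mem_cons_self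
  | _ => exact haux _

/-- Unreachable instructions that involve the given registers. -/
def padding (l : List Focus) : List Instr := l.map fun f => .basic ⟨f, ⟨.zero, .ident⟩⟩

/-- Instructions after `!` never run but count as uses, so padding makes the used registers exactly
the list `l`. This secures low register indices without inspecting the code. -/
theorem uses_code_iff {V : Type} {e : V → Focus} {l : List Focus} (he : ∀ v, e v ∈ l)
    (p : RegProg V) (f : Focus) : Uses (p.code e ++ .term :: padding l) f ↔ f ∈ l := by
  constructor
  · rintro ⟨u, hu, hf⟩
    rcases List.mem_append.1 hu with hu | hu
    · obtain ⟨v, rfl⟩ := focus_mem_range_of_mem_code e p u hu f hf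
      exact he v
    · rcases List.mem_cons.1 hu with rfl | hu
      · simp [Instr.focus?] at hf
      · obtain ⟨g, hg, rfl⟩ := List.mem_map.1 hu
        simp only [Instr.focus?, Option.some.injEq] at hf
        rwa [← hf]
  · intro hf
    exact ⟨.basic ⟨f, ⟨.zero, .ident⟩⟩, by simp [padding, hf], rfl⟩

theorem lowRegisterIndices_of_uses_iff {X : List Instr} {m N : ℕ}
    (h : ∀ f, Uses X f ↔ f ∈ searchFoci m N) : LowRegisterIndices X := by
  intro r
  refine ⟨match r with | .inp => m | .out0 => 1 | .aux0 => N | _ => 0, ?_⟩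
  ext i
  rw [Set.mem_ofPred_eq, h]
  cases r <;> simp [searchFoci]
  · constructor
    · rintro ⟨a, h, rfl⟩
      omega
    · intro h
      exact ⟨i - 1, by omega, by omega⟩
  · constructor
    · rintro ⟨a, h, rfl⟩
      omega
    · intro h
      exact ⟨i - 1, by omega, by omega⟩

theorem eval_le_eval_of_le (p : Polynomial ℕ) {a b : ℕ} (h : a ≤ b) : p.eval a ≤ p.eval b := by
  rw [Polynomial.eval_eq_sum_range, Polynomial.eval_eq_sum_range]
  exact Finset.sum_le_sum fun i _ => Nat.mul_le_mul_left _ (Nat.pow_le_pow_left h i)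

/-- Every language in NP is decided, at each input length, by a PGLB instruction sequence of
polynomial size. -/
theorem exists_pglb_of_mem_NP {L : Language Bool} (hL : L ∈ NP) :
    ∃ q : Polynomial ℕ, ∀ m, ∃ X, IsPGLB X ∧ LowRegisterIndices X ∧
      (∀ f, Uses X f →
        (f.role = Role.inp ∧ f.index ≤ m) ∨ f = ⟨Role.out0, 1⟩ ∨ f.role.isAux = true) ∧
      (∀ x : List Bool, x.length = m →
        ∃ β ∈ computed X (inputBits x), (β ⟨⟨Role.out0, 1⟩, rfl⟩ = true ↔ x ∈ L)) ∧
      LLOC X ≤ q.eval m := by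
  obtain ⟨U, q, ⟨χ, hχU, ⟨M⟩⟩, hLU⟩ := hL
  obtain ⟨⟨tm, inA, outA⟩, T, hM⟩ := M
  obtain ⟨syms, hm, hA⟩ := exists_syms tm
    (Set.range (fun b => ⟨tm.k₀, inA.symm b⟩) ∪ {⟨tm.k₁, outA.symm true⟩})
    ((Set.finite_range _).union (Set.finite_singleton _))
  have hsym : ∀ b, inA.symm b ∈ syms tm.k₀ := fun b => hA ⟨tm.k₀, inA.symm b⟩ (Or.inl ⟨b, rfl⟩)
  have ha : outA.symm true ∈ syms tm.k₁ := hA ⟨tm.k₁, outA.symm true⟩ (Or.inr rfl)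
  obtain ⟨C, hC⟩ := exists_size_searchProg_le syms
  set P := ∑ l, pushes (tm.m l) with hP
  have hPl : ∀ l, pushes (tm.m l) ≤ P := fun l =>
    Finset.single_le_sum (f := fun l => pushes (tm.m l)) (fun _ _ => Nat.zero_le _)
      (Finset.mem_univ l)
  -- The input stack starts with at most `m + W` symbols, and each of the at most `T (m + W)` steps
  -- pushes at most `P` more.
  set Bp : Polynomial ℕ := .X + q + T.comp (.X + q) * .C P with hBp
  set N : ℕ → ℕ := fun m => Fintype.card (AuxVar tm syms (q.eval m) (Bp.eval m)) with hN
  set G := Fintype.card (Σ k, {g // g ∈ syms k}) with hG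
  set Q := Fintype.card (tm.Λ × tm.σ) with hQ
  refine ⟨.C C * ((Bp + 1) * (.X + q + 1)) + (1 + .X + 1 +
    ((Bp + 1) * .C G + (.C Q + (q * 2 + 2)))), fun m => ?_⟩
  set W := q.eval m with hW
  set B := Bp.eval m with hB
  set p : RegProg (Var tm syms m W B) := searchProg inA.symm ⟨_, ha⟩ with hp
  have huses := uses_code_iff (fun v => varFocus_mem v) p
  refine ⟨p.code varFocus ++ .term :: padding (searchFoci m (N m)), by simp [IsPGLB],
    lowRegisterIndices_of_uses_iff huses, ?_, ?_, ?_⟩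
  · intro f hf
    rw [huses, searchFoci] at hf
    simp only [List.mem_append, List.mem_map, List.mem_range, List.mem_cons] at hf
    rcases hf with ⟨i, hi, rfl⟩ | rfl | ⟨i, hi, rfl⟩
    · exact Or.inl ⟨rfl, hi⟩
    · exact Or.inr (Or.inl rfl)
    · exact Or.inr (Or.inr rfl)
  · intro x hx
    obtain ⟨ρ', ⟨t, hrun⟩, hout⟩ := exec_searchProg (B := B) (W := W) hm hPl inA.symm hsym
      ⟨_, ha⟩ χ (T.eval (m + W)) (by simp [hB, hBp, hW]) (by
        intro x w hx hw
        have hMxw := hM (x, w)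
        refine ⟨hMxw.steps, hMxw.steps_le_m.trans ?_, [outA.symm (χ (x, w))], ?_, ?_⟩
        · refine eval_le_eval_of_le T ?_
          simp [pairEncoding, Computability.encodingProd, Computability.encodingList, hx, hw]
        · exact hMxw.evals_in_steps
        · simp)
      (fun v => initMemory (inputBits x) (varFocus v)) x hx
      (by
        intro i
        simp [initMemory, varFocus, Role.isInput, inputBits])
      (by simp [initMemory, varFocus, Role.isInput, Role.initial])
    obtain ⟨M', hM', n, hn⟩ := leads_of_run varFocus_injective hrun
      (p.code varFocus ++ .term :: padding (searchFoci m (N m))) 0 (initMemory (inputBits x))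
      (by simpa using occursAt_append_append [] (p.code varFocus) _) (fun v => rfl)
    -- The extra unit of fuel is for `!` itself.
    refine ⟨fun g => M' g.1, mem_computed_iff.2 ⟨n + 1, M', ?_, rfl⟩, ?_⟩
    · rw [hn, exec, Nat.zero_add]
      have : (p.code varFocus ++ .term :: padding (searchFoci m (N m)))[p.size]? =
          some .term := by
        rw [← length_code varFocus p]
        simp
      rw [this]
    · have := hM' .out
      rw [varFocus] at this
      simp only [this, hout, hLU x, hx]
      exact exists_congr fun w => and_congr Iff.rfl (hχU (x, w))
  · have h1 := hC m W B inA.symm ⟨_, ha⟩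
    have h2 : N m = (B + 1) * G + (Q + (W * 2 + 2)) := by
      simp [hN, hG, hQ, AuxVar, hB, hW]
    simp only [LLOC, List.length_append, List.length_cons, padding, List.length_map, searchFoci,
      List.length_range, length_code, h2]
    simp only [Polynomial.eval_add, Polynomial.eval_mul, Polynomial.eval_C, Polynomial.eval_X,
      Polynomial.eval_one, Polynomial.eval_ofNat, ← hB, ← hW]
    rw [← hp] at h1
    omega

end Naming

end InstrSeq

namespace InstrSeq

open Turing StateTransition

/-! ### Structured programs for stack machines -/

/-- Basic actions on stacks and an internal state. -/
inductive StackAct (K : Type) (Γ : K → Type) (σ : Type) : Type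
  | push (k : K) (f : σ → Γ k)
  | peek (k : K) (f : σ → Option (Γ k) → σ)
  | pop (k : K) (f : σ → Option (Γ k) → σ)
  | load (f : σ → σ)

section StackProg

variable {K : Type} {Γ : K → Type} {σ : Type}

/-- Structured programs for stack machines. -/
abbrev StackProg (K : Type) (Γ : K → Type) (σ : Type) := Prog (StackAct K Γ σ) (σ → Bool)

/-- Test of the internal state. -/
def testState (c : σ → Bool) (s : σ × (∀ k, List (Γ k))) : Bool := c s.1

/-- Instructions of unstructured stack programs: basic actions, jumps to an absolute position if
a test fails, and unconditional jumps. -/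
inductive Flat (K : Type) (Γ : K → Type) (σ : Type) : Type
  | act (a : StackAct K Γ σ)
  | unless (c : σ → Bool) (t : ℕ)
  | jump (t : ℕ)

/-- Number of instructions of the unstructured program. -/
def Prog.flatSize {A C : Type} : Prog A C → ℕ
  | .skip => 0
  | .act _ => 1
  | .seq p q => p.flatSize + q.flatSize
  | .ite _ p q => p.flatSize + q.flatSize + 2
  | .loop _ p => p.flatSize + 2

/-- The unstructured program for `p`, placed at position `n`. -/
def Prog.flat : StackProg K Γ σ → ℕ → List (Flat K Γ σ)
  | .skip, _ => []
  | .act a, _ => [.act a]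
  | .seq p q, n => p.flat n ++ q.flat (n + p.flatSize)
  | .ite c p q, n => .unless c (n + 1 + p.flatSize + 1) ::
      (p.flat (n + 1) ++ .jump (n + (p.flatSize + q.flatSize + 2)) ::
        q.flat (n + 1 + p.flatSize + 1))
  | .loop c p, n => .unless c (n + (p.flatSize + 2)) :: (p.flat (n + 1) ++ [.jump n])

theorem length_flat (p : StackProg K Γ σ) (n : ℕ) : (p.flat n).length = p.flatSize := by
  induction p generalizing n with
  | skip => rfl
  | act => rfl
  | seq p q hp hq => simp [Prog.flat, Prog.flatSize, hp, hq]
  | ite c p q hp hq => simp [Prog.flat, Prog.flatSize, hp, hq]; omega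
  | loop c p hp => simp [Prog.flat, Prog.flatSize, hp]

/-- The label of a position. -/
def flatLabel (N n : ℕ) : Fin (N + 1) := ⟨min n N, by omega⟩

/-- The statement for an instruction of an unstructured program. -/
def Flat.stmt (N n : ℕ) : Flat K Γ σ → TM2.Stmt Γ (Fin (N + 1)) σ
  | .act (.push k f) => .push k f (.goto fun _ => flatLabel N (n + 1))
  | .act (.peek k f) => .peek k f (.goto fun _ => flatLabel N (n + 1))
  | .act (.pop k f) => .pop k f (.goto fun _ => flatLabel N (n + 1))
  | .act (.load f) => .load f (.goto fun _ => flatLabel N (n + 1))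
  | .unless c t => .branch c (.goto fun _ => flatLabel N (n + 1)) (.goto fun _ => flatLabel N t)
  | .jump t => .goto fun _ => flatLabel N t

/-- The stack machine that executes an unstructured program. -/
def flatMachine (X : List (Flat K Γ σ)) (i : Fin (X.length + 1)) :
    TM2.Stmt Γ (Fin (X.length + 1)) σ :=
  match X[(i : ℕ)]? with
  | none => .halt
  | some u => u.stmt X.length i

theorem flatMachine_label {X : List (Flat K Γ σ)} {n : ℕ} {u : Flat K Γ σ}
    (h : X[n]? = some u) : flatMachine X (flatLabel X.length n) = u.stmt X.length n := by
  have hn : n < X.length := (List.getElem?_eq_some_iff.1 h).1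
  have : ((flatLabel X.length n : Fin (X.length + 1)) : ℕ) = n := by
    simp [flatLabel, hn.le]
  rw [flatMachine, this, h]

variable [DecidableEq K]

/-- The effect of a basic action. -/
def StackAct.apply : StackAct K Γ σ → σ × (∀ k, List (Γ k)) → σ × (∀ k, List (Γ k))
  | .push k f, (v, S) => (v, Function.update S k (f v :: S k))
  | .peek k f, (v, S) => (f v (S k).head?, S)
  | .pop k f, (v, S) => (f v (S k).head?, Function.update S k (S k).tail)
  | .load f, (v, S) => (f v, S)

/-- The configuration at position `n`. -/
def flatCfg (N n : ℕ) (s : σ × (∀ k, List (Γ k))) : TM2.Cfg Γ (Fin (N + 1)) σ :=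
  ⟨some (flatLabel N n), s.1, s.2⟩

/-- The machine for `X` gets from position `n` to position `n'` in `t` steps. -/
def FlatSteps (X : List (Flat K Γ σ)) (n : ℕ) (s : σ × (∀ k, List (Γ k))) (t n' : ℕ)
    (s' : σ × (∀ k, List (Γ k))) : Prop :=
  (flip bind (TM2.step (flatMachine X)))^[t] (some (flatCfg X.length n s)) =
    some (flatCfg X.length n' s')

theorem FlatSteps.trans {X : List (Flat K Γ σ)} {n n' n'' t t' : ℕ}
    {s s' s'' : σ × (∀ k, List (Γ k))} (h : FlatSteps X n s t n' s')
    (h' : FlatSteps X n' s' t' n'' s'') : FlatSteps X n s (t + t') n'' s'' := by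
  rw [FlatSteps] at *
  rw [Nat.add_comm t, Function.iterate_add_apply, h, h']

theorem flatSteps_one {X : List (Flat K Γ σ)} {n : ℕ} {u : Flat K Γ σ}
    (h : X[n]? = some u) (s : σ × (∀ k, List (Γ k))) {n' : ℕ} {s' : σ × (∀ k, List (Γ k))}
    (hs : TM2.stepAux (u.stmt X.length n) s.1 s.2 = flatCfg X.length n' s') :
    FlatSteps X n s 1 n' s' := by
  rw [FlatSteps, Function.iterate_one, ← hs, ← flatMachine_label h]
  rfl

theorem flatSteps_act {X : List (Flat K Γ σ)} {n : ℕ} {a : StackAct K Γ σ}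
    (h : X[n]? = some (.act a)) (s : σ × (∀ k, List (Γ k))) :
    FlatSteps X n s 1 (n + 1) (a.apply s) := by
  refine flatSteps_one h s ?_
  cases a <;> rfl

theorem flatSteps_jump {X : List (Flat K Γ σ)} {n t : ℕ}
    (h : X[n]? = some (.jump t)) (s : σ × (∀ k, List (Γ k))) : FlatSteps X n s 1 t s :=
  flatSteps_one h s rfl

theorem flatSteps_unless {X : List (Flat K Γ σ)} {n t : ℕ} {c : σ → Bool}
    (h : X[n]? = some (.unless c t)) (s : σ × (∀ k, List (Γ k))) :
    FlatSteps X n s 1 (if c s.1 then n + 1 else t) s := by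
  refine flatSteps_one h s ?_
  rw [Flat.stmt, TM2.stepAux]
  cases c s.1 <;> rfl

/-- The machine for a structured program runs as the program does. -/
theorem flatSteps_of_run {p : StackProg K Γ σ} {s s' : σ × (∀ k, List (Γ k))} {t : ℕ}
    (h : Run StackAct.apply testState p s t s') (X : List (Flat K Γ σ)) :
    ∀ n, OccursAt X n (p.flat n) → ∃ t' ≤ t, FlatSteps X n s t' (n + p.flatSize) s' := by
  induction h with
  | skip s => exact fun n _ => ⟨0, le_rfl, rfl⟩
  | act a s => exact fun n hX => ⟨1, le_rfl, flatSteps_act hX.1 s⟩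
  | seq _ _ ih ih' =>
    intro n hX
    rw [Prog.flat, occursAt_append, length_flat] at hX
    obtain ⟨t₁, h₁, h₁'⟩ := ih n hX.1
    obtain ⟨t₂, h₂, h₂'⟩ := ih' _ hX.2
    exact ⟨t₁ + t₂, Nat.add_le_add h₁ h₂, by
      rw [Prog.flatSize, ← Nat.add_assoc]; exact h₁'.trans h₂'⟩
  | @ite_true c p q s s' t hc _ ih =>
    intro n hX
    simp only [Prog.flat, OccursAt, occursAt_append, length_flat] at hX
    obtain ⟨h0, h1, h2, -⟩ := hX
    obtain ⟨t₁, h₁, h₁'⟩ := ih _ h1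
    have e1 := flatSteps_unless h0 s
    rw [show c s.1 = true from hc, if_pos rfl] at e1
    exact ⟨_, by omega, (e1.trans h₁').trans (flatSteps_jump h2 s')⟩
  | @ite_false c p q s s' t hc _ ih =>
    intro n hX
    simp only [Prog.flat, OccursAt, occursAt_append, length_flat] at hX
    obtain ⟨h0, -, -, h3⟩ := hX
    obtain ⟨t₁, h₁, h₁'⟩ := ih _ h3
    have e1 := flatSteps_unless h0 s
    rw [show c s.1 = false from hc, if_neg (by simp)] at e1
    refine ⟨1 + t₁, by omega, ?_⟩
    convert e1.trans h₁' using 1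
    simp only [Prog.flatSize]
    omega
  | @loop_true c p s s' s'' t t' hc _ _ ih ih' =>
    intro n hX
    have hX' := hX
    simp only [Prog.flat, OccursAt, occursAt_append, length_flat] at hX
    obtain ⟨h0, h1, h2, -⟩ := hX
    obtain ⟨t₁, h₁, h₁'⟩ := ih _ h1
    obtain ⟨t₂, h₂, h₂'⟩ := ih' n hX'
    have e1 := flatSteps_unless h0 s
    rw [show c s.1 = true from hc, if_pos rfl] at e1
    exact ⟨_, by omega, ((e1.trans h₁').trans (flatSteps_jump h2 s')).trans h₂'⟩
  | @loop_false c p s hc =>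
    intro n hX
    simp only [Prog.flat, OccursAt] at hX
    have e1 := flatSteps_unless hX.1 s
    rw [show c s.1 = false from hc, if_neg (by simp)] at e1
    exact ⟨1, le_rfl, e1⟩
  | mono htt _ ih =>
    intro n hX
    obtain ⟨t₁, h₁, h₁'⟩ := ih n hX
    exact ⟨t₁, h₁.trans htt, h₁'⟩

/-- The position just past the last instruction carries the label of `halt`, which costs the one
additional step. -/
theorem evals_of_run {p : StackProg K Γ σ} {s s' : σ × (∀ k, List (Γ k))} {t : ℕ}
    (h : Run StackAct.apply testState p s t s') : ∃ t' ≤ t + 1,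
      (flip bind (TM2.step (flatMachine (p.flat 0))))^[t']
        (some (flatCfg (p.flat 0).length 0 s)) = some ⟨none, s'.1, s'.2⟩ := by
  obtain ⟨t', ht, h'⟩ := flatSteps_of_run h (p.flat 0) 0
    (by simpa using occursAt_append_append [] (p.flat 0) [])
  refine ⟨t' + 1, by omega, ?_⟩
  rw [Function.iterate_succ_apply', h', Nat.zero_add]
  have : flatMachine (p.flat 0) (flatLabel (p.flat 0).length p.flatSize) = .halt := by
    rw [flatMachine]
    simp [flatLabel, length_flat]
  change some (TM2.stepAux (flatMachine (p.flat 0) (flatLabel (p.flat 0).length p.flatSize))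
    s'.1 s'.2) = _
  rw [this]
  rfl

/-- The bundled stack machine for a structured program. -/
def stackMachine [Fintype K] [Fintype σ] (k₀ k₁ : K) [Fintype (Γ k₀)] (v₀ : σ)
    (p : StackProg K Γ σ) : FinTM2 where
  K := K
  k₀ := k₀
  k₁ := k₁
  Γ := Γ
  Λ := Fin ((p.flat 0).length + 1)
  main := flatLabel _ 0
  σ := σ
  initialState := v₀
  m := flatMachine (p.flat 0)

/-- A structured program that computes a function within a polynomial number of steps yields a
polynomial time stack machine. -/
theorem nonempty_polyTime_of_run [Fintype K] [Fintype σ] (k₀ k₁ : K) [Fintype (Γ k₀)] (v₀ : σ)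
    (p : StackProg K Γ σ) {α β αΓ βΓ : Type} (ea : α → List αΓ) (eb : β → List βΓ) (f : α → β)
    (inA : Γ k₀ ≃ αΓ) (outA : Γ k₁ ≃ βΓ) (T : Polynomial ℕ)
    (h : ∀ a, Run StackAct.apply testState p
      (v₀, Function.update (fun _ => []) k₀ ((ea a).map inA.symm)) (T.eval (ea a).length)
      (v₀, Function.update (fun _ => []) k₁ ((eb (f a)).map outA.symm))) :
    Nonempty (TM2ComputableInPolyTime ea eb f) := by
  have key : ∀ a, ∃ t, t ≤ (T + 1).eval (ea a).length ∧
      (flip bind (stackMachine k₀ k₁ v₀ p).step)^[t]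
        (some (initList (stackMachine k₀ k₁ v₀ p) ((ea a).map inA.symm))) =
        some (haltList (stackMachine k₀ k₁ v₀ p) ((eb (f a)).map outA.symm)) := by
    intro a
    obtain ⟨t, ht, h'⟩ := evals_of_run (h a)
    refine ⟨t, by simpa using ht, ?_⟩
    have e₀ : initList (stackMachine k₀ k₁ v₀ p) ((ea a).map inA.symm) = flatCfg _ 0
        (v₀, Function.update (fun _ => []) k₀ ((ea a).map inA.symm)) :=
      congrArg (TM2.Cfg.mk _ _) (initList_eq (tm := stackMachine k₀ k₁ v₀ p) _)
    have e₁ : haltList (stackMachine k₀ k₁ v₀ p) ((eb (f a)).map outA.symm) =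
        ⟨none, v₀, Function.update (fun _ => []) k₁ ((eb (f a)).map outA.symm)⟩ :=
      congrArg (TM2.Cfg.mk _ _) (haltList_eq (tm := stackMachine k₀ k₁ v₀ p) _)
    rw [e₀, e₁]
    exact h'
  choose t ht h' using key
  exact ⟨{ tm := stackMachine k₀ k₁ v₀ p
           inputAlphabet := inA
           outputAlphabet := outA
           time := T + 1
           outputsFun := fun a =>
            { steps := t a
              evals_in_steps := h' a
              steps_le_m := ht a } }⟩

end StackProg

end InstrSeq

namespace InstrSeq

open Turing StateTransition

/-! ### Moving and clearing stacks -/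

section Drain

variable {K : Type} [DecidableEq K] {Γ : K → Type} {σ : Type}

/-- A stack program takes state `s` to state `s'` within `t` steps. -/
abbrev Takes (p : StackProg K Γ σ) (s : σ × (∀ k, List (Γ k))) (t : ℕ)
    (s' : σ × (∀ k, List (Γ k))) : Prop := Run StackAct.apply testState p s t s'

theorem takes_act (a : StackAct K Γ σ) {s s' : σ × (∀ k, List (Γ k))} (h : a.apply s = s') :
    Takes (.act a) s 1 s' := h ▸ Run.act a s

theorem Takes.congr {p : StackProg K Γ σ} {s s₁ s' s₁' : σ × (∀ k, List (Γ k))} {t : ℕ}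
    (h : Takes p s t s') (hs : s₁ = s) (hr : s₁' = s') : Takes p s₁ t s₁' := by
  rwa [hs, hr]

/-- Move the symbols of stack `k` to stack `d`. -/
def drain (k d : K) (wr : σ → Option (Γ k) → σ) (rd : σ → Option (Γ k)) (g : σ → Γ d) :
    StackProg K Γ σ :=
  .seq (.act (.pop k wr)) (.loop (fun v => (rd v).isSome)
    (.seq (.act (.push d g)) (.act (.pop k wr))))

/-- Each round costs two actions and two units for the loop. The state always holds the symbol
popped last, so the auxiliary claim speaks of a list `l` whose head is in the state and whose tail
is on the stack. -/
theorem takes_drain {k d : K} (hkd : k ≠ d) {wr : σ → Option (Γ k) → σ}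
    {rd : σ → Option (Γ k)} {g : σ → Γ d} (h : Γ k → Γ d) (h₁ : ∀ v o, rd (wr v o) = o)
    (h₂ : ∀ v o o', wr (wr v o) o' = wr v o') (h₃ : ∀ v a, g (wr v (some a)) = h a)
    (v : σ) (S : ∀ k, List (Γ k)) :
    Takes (drain k d wr rd g) (v, S) (4 * (S k).length + 2)
      (wr v none, Function.update (Function.update S k []) d (((S k).map h).reverse ++ S d)) := by
  have key : ∀ (l : List (Γ k)) (S : ∀ k, List (Γ k)), S k = l.tail →
      Takes (.loop (fun v => (rd v).isSome) (.seq (.act (.push d g)) (.act (.pop k wr))))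
        (wr v l.head?, S) (4 * l.length + 1)
        (wr v none, Function.update (Function.update S k []) d ((l.map h).reverse ++ S d)) := by
    intro l
    induction l with
    | nil =>
      intro S hS
      have : Function.update (Function.update S k []) d ([] ++ S d) = S := by
        funext j
        by_cases hj : j = d
        · subst hj
          simp
        · by_cases hj' : j = k
          · subst hj'
            simpa [hj] using hS.symm
          · simp [hj, hj']
      simp only [List.map_nil, List.reverse_nil, this]
      exact Run.loop_false (by simp [testState, h₁])
    | cons a l ih =>
      intro S hS
      set S₁ := Function.update (Function.update S d (h a :: S d)) k l.tail with hS₁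
      have hi := ih S₁ (by simp [hS₁])
      have e : Function.update (Function.update S₁ k []) d ((l.map h).reverse ++ S₁ d) =
          Function.update (Function.update S k []) d (((a :: l).map h).reverse ++ S d) := by
        funext j
        by_cases hj : j = d
        · subst hj
          simp [hS₁, hkd.symm]
        · by_cases hj' : j = k
          · subst hj'
            simp [hj]
          · simp [hS₁, hj, hj']
      rw [e] at hi
      refine Run.mono (t := 1 + 1 + (4 * l.length + 1) + 2) (by simp; omega)
        (Run.loop_true (by simp [testState, h₁]) (Run.seq (takes_act _ rfl) (takes_act _ ?_)) hi)
      simp [StackAct.apply, h₃, h₂, hS, hS₁, Function.update_of_ne hkd]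
  have := key (S k) (Function.update S k (S k).tail) (by simp)
  simp only [Function.update_idem, Function.update_of_ne hkd.symm] at this
  exact Run.mono (by omega) (Run.seq (takes_act _ rfl) this)

/-- Empty stack `k`. -/
def clearStack (k : K) (wr : σ → Option (Γ k) → σ) (rd : σ → Option (Γ k)) : StackProg K Γ σ :=
  .seq (.act (.pop k wr)) (.loop (fun v => (rd v).isSome) (.act (.pop k wr)))

theorem takes_clearStack {k : K} {wr : σ → Option (Γ k) → σ}
    {rd : σ → Option (Γ k)} (h₁ : ∀ v o, rd (wr v o) = o)
    (h₂ : ∀ v o o', wr (wr v o) o' = wr v o') (v : σ) (S : ∀ k, List (Γ k)) :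
    Takes (clearStack k wr rd) (v, S) (4 * (S k).length + 2)
      (wr v none, Function.update S k []) := by
  have key : ∀ (l : List (Γ k)) (S : ∀ k, List (Γ k)), S k = l.tail →
      Takes (.loop (fun v => (rd v).isSome) (.act (.pop k wr)))
        (wr v l.head?, S) (4 * l.length + 1) (wr v none, Function.update S k []) := by
    intro l
    induction l with
    | nil =>
      intro S hS
      rw [Function.update_eq_self_iff.2 hS.symm]
      exact Run.loop_false (by simp [testState, h₁])
    | cons a l ih =>
      intro S hS
      have hi := ih (Function.update S k l.tail) (by simp)
      rw [Function.update_idem] at hi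
      refine Run.mono (t := 1 + (4 * l.length + 1) + 2) (by simp; omega)
        (Run.loop_true (by simp [testState, h₁]) (takes_act _ ?_) hi)
      simp [StackAct.apply, h₂, hS]
  have := key (S k) (Function.update S k (S k).tail) (by simp)
  rw [Function.update_idem] at this
  exact Run.mono (by omega) (Run.seq (takes_act _ rfl) this)

end Drain

/-! ### Machines with a random access memory in polynomial time -/

/-- The stacks of the evaluator. -/
inductive Stk
  | inp
  | xs
  | tmp
  | pat
  | log
  | dump
  | out
  deriving DecidableEq

instance : Fintype Stk :=
  ⟨{.inp, .xs, .tmp, .pat, .log, .dump, .out}, by rintro ⟨⟩ <;> decide⟩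

/-- The alphabets of the evaluator. -/
abbrev Stk.Sym : Stk → Type
  | .inp | .log | .dump => Bool ⊕ Bool
  | .xs | .tmp | .pat | .out => Bool

/-- Operations on a bit of memory, coded by six bits. -/
structure Op where
  m₀ : Bool
  m₁ : Bool
  y₀ : Bool
  y₁ : Bool
  e₀ : Bool
  e₁ : Bool

noncomputable instance : Fintype Op :=
  Fintype.ofInjective (fun o => (o.m₀, o.m₁, o.y₀, o.y₁, o.e₀, o.e₁))
    (by rintro ⟨⟩ ⟨⟩ h; simpa using h)

/-- The internal state of the evaluator: the symbols read last, the status of a comparison of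
addresses, the content found, two flags, and the current operation. -/
structure Ctl where
  sym : Option (Bool ⊕ Bool)
  bit : Option Bool
  eq : Bool
  res : Option Bool
  act : Bool
  cond : Bool
  op : Op

noncomputable instance : Fintype Ctl :=
  Fintype.ofInjective (fun c => (c.sym, c.bit, c.eq, c.res, c.act, c.cond, c.op))
    (by rintro ⟨⟩ ⟨⟩ h; simpa using h)

/-- The contents of all stacks. -/
def stackFn (inp : List (Bool ⊕ Bool)) (xs tmp pat : List Bool) (log dump : List (Bool ⊕ Bool))
    (out : List Bool) : ∀ k : Stk, List k.Sym
  | .inp => inp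
  | .xs => xs
  | .tmp => tmp
  | .pat => pat
  | .log => log
  | .dump => dump
  | .out => out

section Update

variable (inp : List (Bool ⊕ Bool)) (xs tmp pat : List Bool) (log dump : List (Bool ⊕ Bool))
  (out : List Bool)

theorem update_inp (l : List (Bool ⊕ Bool)) :
    Function.update (stackFn inp xs tmp pat log dump out) .inp l =
      stackFn l xs tmp pat log dump out := by
  funext k; cases k <;> rfl

theorem update_xs (l : List Bool) : Function.update (stackFn inp xs tmp pat log dump out) .xs l =
    stackFn inp l tmp pat log dump out := by
  funext k; cases k <;> rfl

theorem update_tmp (l : List Bool) : Function.update (stackFn inp xs tmp pat log dump out) .tmp l =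
    stackFn inp xs l pat log dump out := by
  funext k; cases k <;> rfl

theorem update_pat (l : List Bool) : Function.update (stackFn inp xs tmp pat log dump out) .pat l =
    stackFn inp xs tmp l log dump out := by
  funext k; cases k <;> rfl

theorem update_log (l : List (Bool ⊕ Bool)) :
    Function.update (stackFn inp xs tmp pat log dump out) .log l =
      stackFn inp xs tmp pat l dump out := by
  funext k; cases k <;> rfl

theorem update_dump (l : List (Bool ⊕ Bool)) :
    Function.update (stackFn inp xs tmp pat log dump out) .dump l =
      stackFn inp xs tmp pat log l out := by
  funext k; cases k <;> rfl

theorem update_out (l : List Bool) : Function.update (stackFn inp xs tmp pat log dump out) .out l =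
    stackFn inp xs tmp pat log dump l := by
  funext k; cases k <;> rfl

end Update

/-- Programs of the evaluator. -/
abbrev EvalProg := StackProg Stk Stk.Sym Ctl

/-- The bit in a symbol. -/
def bitOf : Option (Bool ⊕ Bool) → Bool
  | none => false
  | some (.inl b) => b
  | some (.inr b) => b

/-- Record the symbol read from a stack of marked bits. -/
def setSym (c : Ctl) (o : Option (Bool ⊕ Bool)) : Ctl := { c with sym := o }

/-- Record the bit read from a stack of bits. -/
def setBit (c : Ctl) (o : Option Bool) : Ctl := { c with bit := o }

/-- The program that moves `tmp` to `pat`. -/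
def tmpToPat : EvalProg := drain .tmp .pat setBit Ctl.bit fun c => c.bit.getD false

/-- Move the stack `tmp` to the stack `xs`. -/
def tmpToXs : EvalProg := drain .tmp .xs setBit Ctl.bit fun c => c.bit.getD false

/-- Move the stack `pat` to the stack `tmp`. -/
def patToTmp : EvalProg := drain .pat .tmp setBit Ctl.bit fun c => c.bit.getD false

/-- Move the stack `tmp` to the stack `log`. -/
def tmpToLog : EvalProg := drain .tmp .log setBit Ctl.bit fun c => .inl (c.bit.getD false)

/-- Move the stack `dump` to the stack `log`. -/
def dumpToLog : EvalProg := drain .dump .log setSym Ctl.sym fun c => c.sym.getD (.inl false)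

section Moves

variable (c : Ctl) (inp : List (Bool ⊕ Bool)) (xs tmp pat : List Bool)
  (log dump : List (Bool ⊕ Bool)) (out : List Bool)

theorem takes_tmpToPat : Takes tmpToPat (c, stackFn inp xs tmp pat log dump out)
    (4 * tmp.length + 2)
    (setBit c none, stackFn inp xs [] (tmp.reverse ++ pat) log dump out) := by
  have := takes_drain (K := Stk) (Γ := Stk.Sym) (k := .tmp) (d := .pat) (by decide) (wr := setBit)
    (rd := Ctl.bit) (g := fun c => c.bit.getD false) id (fun _ _ => rfl) (fun _ _ _ => rfl)
    (fun _ _ => rfl) c (stackFn inp xs tmp pat log dump out)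
  rw [update_tmp, update_pat, List.map_id] at this
  exact this

theorem takes_tmpToXs : Takes tmpToXs (c, stackFn inp xs tmp pat log dump out)
    (4 * tmp.length + 2)
    (setBit c none, stackFn inp (tmp.reverse ++ xs) [] pat log dump out) := by
  have := takes_drain (K := Stk) (Γ := Stk.Sym) (k := .tmp) (d := .xs) (by decide) (wr := setBit)
    (rd := Ctl.bit) (g := fun c => c.bit.getD false) id (fun _ _ => rfl) (fun _ _ _ => rfl)
    (fun _ _ => rfl) c (stackFn inp xs tmp pat log dump out)
  rw [update_tmp, update_xs, List.map_id] at this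
  exact this

theorem takes_patToTmp : Takes patToTmp (c, stackFn inp xs tmp pat log dump out)
    (4 * pat.length + 2)
    (setBit c none, stackFn inp xs (pat.reverse ++ tmp) [] log dump out) := by
  have := takes_drain (K := Stk) (Γ := Stk.Sym) (k := .pat) (d := .tmp) (by decide) (wr := setBit)
    (rd := Ctl.bit) (g := fun c => c.bit.getD false) id (fun _ _ => rfl) (fun _ _ _ => rfl)
    (fun _ _ => rfl) c (stackFn inp xs tmp pat log dump out)
  rw [update_pat, update_tmp, List.map_id] at this
  exact this

theorem takes_tmpToLog : Takes tmpToLog (c, stackFn inp xs tmp pat log dump out)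
    (4 * tmp.length + 2)
    (setBit c none, stackFn inp xs [] pat ((tmp.map Sum.inl).reverse ++ log) dump out) := by
  have := takes_drain (K := Stk) (Γ := Stk.Sym) (k := .tmp) (d := .log) (by decide) (wr := setBit)
    (rd := Ctl.bit) (g := fun c => .inl (c.bit.getD false)) Sum.inl (fun _ _ => rfl)
    (fun _ _ _ => rfl) (fun _ _ => rfl) c (stackFn inp xs tmp pat log dump out)
  rw [update_tmp, update_log] at this
  exact this

theorem takes_dumpToLog : Takes dumpToLog (c, stackFn inp xs tmp pat log dump out)
    (4 * dump.length + 2)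
    (setSym c none, stackFn inp xs tmp pat (dump.reverse ++ log) [] out) := by
  have := takes_drain (K := Stk) (Γ := Stk.Sym) (k := .dump) (d := .log) (by decide) (wr := setSym)
    (rd := Ctl.sym) (g := fun c => c.sym.getD (.inl false)) id (fun _ _ => rfl) (fun _ _ _ => rfl)
    (fun _ _ => rfl) c (stackFn inp xs tmp pat log dump out)
  rw [update_dump, update_log, List.map_id] at this
  exact this

end Moves

/-! ### Lookup in the log -/

/-- A log is a list of addresses with contents, the most recent one first. -/
abbrev Log := List (List Bool × Bool)

/-- The representation of a log on a stack. -/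
def encodeLog (rs : Log) : List (Bool ⊕ Bool) :=
  rs.flatMap fun r => r.1.map Sum.inl ++ [.inr r.2]

/-- The most recent content at an address. -/
def lookup (a : List Bool) : Log → Option Bool
  | [] => none
  | r :: rs => if r.1.isPrefixOf a then some r.2 else lookup a rs

/-- Compare the symbol read with the pattern. -/
def compareSym (c : Ctl) : Ctl := { c with eq := c.eq && c.bit == some (bitOf c.sym) }

/-- Note the content if the address has matched. -/
def noteContent (c : Ctl) : Ctl :=
  { c with
    res := c.res.or (if c.eq then some (bitOf c.sym) else none)
    eq := true }

/-- The symbol read last comes from the left alphabet: an address bit of the log, or a bit of the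
first component of the input. -/
def isAddrSym (c : Ctl) : Bool :=
  match c.sym with
  | some (.inl _) => true
  | _ => false

/-- Process one symbol of the log. -/
def scanStep : EvalProg :=
  .seq (.act (.push .dump fun c => c.sym.getD (.inl false))) <|
  .seq (.ite isAddrSym
    (.seq (.act (.pop .pat setBit)) <| .seq (.act (.load compareSym)) <|
      .ite (fun c => c.bit.isSome) (.act (.push .tmp fun c => c.bit.getD false)) .skip)
    (.seq (.act (.load noteContent)) tmpToPat)) <|
  .act (.pop .log setSym)

/-- Process the log. -/
def scanLoop : EvalProg := .loop (fun c => c.sym.isSome) scanStep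

/-- Stated with a continuation: a run from the state after the address `a` extends backwards over
`a`. The compared part of the pattern moves to `tmp` so that it can be restored. An exhausted
pattern yields `none` and spoils the comparison. -/
theorem takes_scanLoop_addr (inp : List (Bool ⊕ Bool)) (xs : List Bool) (out : List Bool)
    (res : Option Bool) (act cond : Bool) (op : Op) (s' : Ctl × ∀ k : Stk, List k.Sym)
    (l : List (Bool ⊕ Bool)) (t : ℕ) (a : List Bool) :
    ∀ (tmp pat : List Bool) (dump : List (Bool ⊕ Bool)) (e : Bool) (bt : Option Bool),
      (∀ bt', Takes scanLoop (⟨l.head?, bt', e && a.isPrefixOf pat, res, act, cond, op⟩,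
        stackFn inp xs ((pat.take a.length).reverse ++ tmp) (pat.drop a.length) l.tail
          ((a.map Sum.inl).reverse ++ dump) out) t s') →
      Takes scanLoop (⟨(a.map Sum.inl ++ l).head?, bt, e, res, act, cond, op⟩,
        stackFn inp xs tmp pat (a.map Sum.inl ++ l).tail dump out) (12 * a.length + t) s' := by
  induction a with
  | nil =>
    intro tmp pat dump e bt h
    simpa using h bt
  | cons b a ih =>
    intro tmp pat dump e bt h
    cases pat with
    | nil =>
      have hi := ih tmp [] (.inl b :: dump) false none (by simpa using h)
      refine Run.mono (t := 1 + ((1 + (1 + (0 + 2))) + 2 + 1) + (12 * a.length + t) + 2)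
        (by simp; omega) (Run.loop_true rfl (Run.seq (takes_act _ (by
          simp only [StackAct.apply]; rw [update_dump])) (Run.seq (Run.ite_true rfl
            (Run.seq (takes_act _ (by simp only [StackAct.apply]; rw [update_pat]))
            (Run.seq (takes_act _ rfl) (Run.ite_false rfl (Run.skip _)))))
          (takes_act _ (by simp only [StackAct.apply]; rw [update_log])))) ?_)
      exact hi.congr (by simp [compareSym, setBit, setSym, stackFn]) rfl
    | cons b' pat =>
      have hi := ih (b' :: tmp) pat (.inl b :: dump) (e && b == b') (some b')
        (by simpa [Bool.and_assoc, List.isPrefixOf] using h)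
      refine Run.mono (t := 1 + ((1 + (1 + (1 + 2))) + 2 + 1) + (12 * a.length + t) + 2)
        (by simp; omega) (Run.loop_true rfl (Run.seq (takes_act _ (by
          simp only [StackAct.apply]; rw [update_dump])) (Run.seq (Run.ite_true rfl
            (Run.seq (takes_act _ (by simp only [StackAct.apply]; rw [update_pat]))
            (Run.seq (takes_act _ rfl) (Run.ite_true rfl (takes_act _ (by
              simp only [StackAct.apply]; rw [update_tmp]))))))
          (takes_act _ (by simp only [StackAct.apply]; rw [update_log])))) ?_)
      refine hi.congr ?_ rfl
      have : (some b' == some b) = (b == b') := by cases b <;> cases b' <;> rfl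
      simp [compareSym, setBit, setSym, stackFn, bitOf, this]

/-- The symbol `inr` ends a record: there the content is noted if the address matched, and the
pattern is put back. As `res.or` keeps the earlier find, the most recent record wins although the
whole log is scanned. -/
theorem takes_scanLoop (inp : List (Bool ⊕ Bool)) (xs : List Bool) (out : List Bool)
    (act cond : Bool) (op : Op) (pat : List Bool) (rs : Log) :
    ∀ (dump : List (Bool ⊕ Bool)) (res bt : Option Bool),
      ∃ bt', Takes scanLoop (⟨(encodeLog rs).head?, bt, true, res, act, cond, op⟩,
        stackFn inp xs [] pat (encodeLog rs).tail dump out) (24 * (encodeLog rs).length + 1)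
        (⟨none, bt', true, res.or (lookup pat rs), act, cond, op⟩,
        stackFn inp xs [] pat [] ((encodeLog rs).reverse ++ dump) out) := by
  induction rs with
  | nil =>
    intro dump res bt
    refine ⟨bt, ?_⟩
    simp only [lookup, Option.or_none]
    exact Run.loop_false rfl
  | cons r rs ih =>
    intro dump res bt
    obtain ⟨a, v⟩ := r
    obtain ⟨bt', hi⟩ := ih ((.inr v : Bool ⊕ Bool) :: ((a.map Sum.inl).reverse ++ dump))
      (res.or (if a.isPrefixOf pat then some v else none)) none
    refine ⟨bt', ?_⟩
    have e : encodeLog ((a, v) :: rs) = a.map Sum.inl ++ (.inr v :: encodeLog rs) := by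
      simp [encodeLog]
    rw [e]
    have hlen : (pat.take a.length).length ≤ a.length := by simp
    refine Run.mono (t := 12 * a.length + (4 * a.length + 24 * (encodeLog rs).length + 12))
      (by simp; omega) (takes_scanLoop_addr _ _ _ _ _ _ _ _ _ _ _ _ _ _ _ _ fun bt₁ => ?_)
    refine Run.mono (t := 1 + ((1 + (4 * ((pat.take a.length).reverse ++ []).length + 2)) + 2 + 1) +
      (24 * (encodeLog rs).length + 1) + 2) ?_
      (Run.loop_true rfl (Run.seq (takes_act _ (by
          simp only [StackAct.apply]; rw [update_dump])) (Run.seq (Run.ite_false rfl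
            (Run.seq (takes_act _ rfl) (takes_tmpToPat _ _ _ _ _ _ _ _)))
          (takes_act _ (by simp only [StackAct.apply]; rw [update_log])))) ?_)
    · simp only [List.append_nil, List.length_reverse]
      omega
    · refine hi.congr ?_ ?_
      · simp [setBit, setSym, noteContent, bitOf, stackFn]
      · rw [Option.or_assoc, lookup]
        cases a.isPrefixOf pat <;> simp

end InstrSeq

namespace InstrSeq

open Turing StateTransition

/-! ### The evaluator -/

/-- The effect of an operation on a bit of memory and the two flags, given the next input bit. -/
def Op.exec (o : Op) (b i act cond : Bool) : Bool × Bool × Bool :=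
  match o.m₀, o.m₁ with
  | false, false =>
    if act then (if b then o.e₁ else o.e₀, act, if b then o.y₁ else o.y₀) else (b, act, cond)
  | false, true => (b, b, cond)
  | true, false => (b || (act && cond == o.y₀), act, cond)
  | true, true => (i, act, cond)

/-- The abstract state of the evaluator: flags, remaining input, current address, and memory. -/
structure EvalState where
  act : Bool
  cond : Bool
  xs : List Bool
  pat : List Bool
  rs : Log

/-- The effect of an operation on the abstract state. -/
def EvalState.exec (s : EvalState) (o : Op) : EvalState :=
  let r := o.exec ((lookup s.pat s.rs).getD false) (s.xs.headD false) s.act s.cond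
  { act := r.2.1
    cond := r.2.2
    xs := if o.m₀ && o.m₁ then s.xs.tail else s.xs
    pat := []
    rs := (s.pat, r.1) :: s.rs }

/-- The operation coded by the first six bits. -/
def opOfBits (l : List Bool) : Op :=
  ⟨l.getD 0 false, l.getD 1 false, l.getD 2 false, l.getD 3 false, l.getD 4 false, l.getD 5 false⟩

/-- Interpretation of a bit string as a program: `true` announces a bit of an address, `false` an
operation. -/
def interp : List Bool → EvalState → EvalState
  | [], s => s
  | true :: l, s => interp l.tail { s with pat := l.headD false :: s.pat }
  | false :: l, s => interp (l.drop 6) (s.exec (opOfBits l))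
termination_by l => l.length
decreasing_by
  · simp
  · simp

/-- Prepare for a lookup. -/
def Ctl.startLookup (c : Ctl) : Ctl := { c with eq := true, res := none }

/-- Execute the current operation on the bit found by the lookup. -/
def Ctl.execOp (c : Ctl) : Ctl :=
  let r := c.op.exec (c.res.getD false) (c.bit.getD false) c.act c.cond
  { c with res := some r.1, act := r.2.1, cond := r.2.2 }

/-- Execute the current operation. -/
def opProg : EvalProg :=
  .seq (.act (.load Ctl.startLookup)) <|
  .seq (.act (.pop .log setSym)) <|
  .seq scanLoop <|
  .seq dumpToLog <|
  .seq (.ite (fun c => c.op.m₀ && c.op.m₁) (.act (.pop .xs setBit)) .skip) <|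
  .seq (.act (.load Ctl.execOp)) <|
  .seq (.act (.push .log fun c => .inr (c.res.getD false))) <|
  .seq patToTmp tmpToLog

/-- Writing to memory means prepending a record. The new content is pushed first, then the address,
which travels from `pat` through `tmp`, so that two reversals keep its order. -/
theorem takes_opProg (c : Ctl) (inp : List (Bool ⊕ Bool)) (out : List Bool) (s : EvalState)
    (h₁ : c.act = s.act) (h₂ : c.cond = s.cond) :
    ∃ c' : Ctl, c'.act = (s.exec c.op).act ∧ c'.cond = (s.exec c.op).cond ∧
      Takes opProg (c, stackFn inp s.xs [] s.pat (encodeLog s.rs) [] out)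
        (28 * (encodeLog s.rs).length + 8 * s.pat.length + 14)
        (c', stackFn inp (s.exec c.op).xs [] (s.exec c.op).pat (encodeLog (s.exec c.op).rs) []
          out) := by
  obtain ⟨sym, bit, eq, res, act, cond, op⟩ := c
  obtain ⟨act', cond', xs, pat, rs⟩ := s
  obtain rfl : act = act' := h₁
  obtain rfl : cond = cond' := h₂
  obtain ⟨bt, hscan⟩ := takes_scanLoop inp xs out act cond op pat rs [] none bit
  set r := op.exec ((lookup pat rs).getD false) (xs.headD false) act cond with hr
  set bt' := if op.m₀ && op.m₁ then xs.head? else bt with hbt'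
  have hite : Takes (.ite (fun c => c.op.m₀ && c.op.m₁) (.act (.pop .xs setBit)) .skip)
      (⟨none, bt, true, lookup pat rs, act, cond, op⟩,
        stackFn inp xs [] pat (encodeLog rs) [] out) 3
      (⟨none, bt', true, lookup pat rs, act, cond, op⟩,
        stackFn inp (if op.m₀ && op.m₁ then xs.tail else xs) [] pat (encodeLog rs) [] out) := by
    cases hm : (op.m₀ && op.m₁) with
    | true =>
      refine Run.ite_true hm (takes_act _ ?_)
      simp only [StackAct.apply]
      rw [update_xs, hbt', hm]
      rfl
    | false =>
      refine Run.mono (t := 0 + 2) (by omega) (Run.ite_false hm ?_)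
      rw [hbt', hm]
      exact Run.skip _
  have hexec : Ctl.execOp ⟨none, bt', true, lookup pat rs, act, cond, op⟩ =
      ⟨none, bt', true, some r.1, r.2.1, r.2.2, op⟩ := by
    -- Unless the operation stores an input bit, `bt'` is a leftover of the scan; `Op.exec` then
    -- ignores it.
    have : op.exec ((lookup pat rs).getD false) (bt'.getD false) act cond = r := by
      rw [hr, hbt']
      cases hm₀ : op.m₀ <;> cases hm₁ : op.m₁ <;> simp [Op.exec, hm₀, hm₁]
    simp [Ctl.execOp, this]
  refine ⟨⟨none, none, true, some r.1, r.2.1, r.2.2, op⟩, rfl, rfl, ?_⟩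
  refine Run.mono (t := 1 + (1 + ((24 * (encodeLog rs).length + 1) +
    ((4 * ((encodeLog rs).reverse ++ []).length + 2) + (3 + (1 + (1 +
      ((4 * pat.length + 2) + (4 * (pat.reverse ++ []).length + 2))))))))) (by simp; omega)
    (Run.seq (takes_act _ rfl) (Run.seq (takes_act _ (by
      simp only [StackAct.apply]; rw [update_log]; rfl)) (Run.seq hscan
      (Run.seq (takes_dumpToLog _ _ _ _ _ _ _ _)
      (Run.seq (hite.congr (by simp [setSym]) rfl) (Run.seq (takes_act _ (by
        simp only [StackAct.apply]; rw [hexec]))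
      (Run.seq (takes_act _ (by simp only [StackAct.apply]; rw [update_log]))
      (Run.seq (takes_patToTmp _ _ _ _ _ _ _ _)
        ((takes_tmpToLog _ _ _ _ _ _ _ _).congr rfl ?_)))))))))
  simp [EvalState.exec, setBit, hr, encodeLog, stackFn]

/-- Read the code of an operation. -/
def readOp : EvalProg :=
  .seq (.act (.pop .inp fun c o => { c with op := { c.op with m₀ := bitOf o } })) <|
  .seq (.act (.pop .inp fun c o => { c with op := { c.op with m₁ := bitOf o } })) <|
  .seq (.act (.pop .inp fun c o => { c with op := { c.op with y₀ := bitOf o } })) <|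
  .seq (.act (.pop .inp fun c o => { c with op := { c.op with y₁ := bitOf o } })) <|
  .seq (.act (.pop .inp fun c o => { c with op := { c.op with e₀ := bitOf o } })) <|
  .act (.pop .inp fun c o => { c with op := { c.op with e₁ := bitOf o } })

theorem takes_readOp (c : Ctl) (l xs tmp pat : List Bool) (log dump : List (Bool ⊕ Bool))
    (out : List Bool) :
    Takes readOp (c, stackFn (l.map Sum.inr) xs tmp pat log dump out) 6
      ({ c with op := opOfBits l },
        stackFn ((l.drop 6).map Sum.inr) xs tmp pat log dump out) := by
  refine Run.mono (t := 1 + (1 + (1 + (1 + (1 + 1))))) (by omega)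
    (Run.seq (takes_act _ (by simp only [StackAct.apply]; rw [update_inp]))
    (Run.seq (takes_act _ (by simp only [StackAct.apply]; rw [update_inp]))
    (Run.seq (takes_act _ (by simp only [StackAct.apply]; rw [update_inp]))
    (Run.seq (takes_act _ (by simp only [StackAct.apply]; rw [update_inp]))
    (Run.seq (takes_act _ (by simp only [StackAct.apply]; rw [update_inp]))
    ((takes_act _ (by simp only [StackAct.apply]; rw [update_inp])).congr rfl ?_))))))
  rcases l with _ | ⟨_, _ | ⟨_, _ | ⟨_, _ | ⟨_, _ | ⟨_, _ | ⟨_, l⟩⟩⟩⟩⟩⟩ <;> rfl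

/-- One round of the evaluator. -/
def mainStep : EvalProg :=
  .seq (.ite (fun c => bitOf c.sym)
    (.seq (.act (.pop .inp setSym)) (.act (.push .pat fun c => bitOf c.sym)))
    (.seq readOp opProg)) <|
  .act (.pop .inp setSym)

/-- Process the input. -/
def mainLoop : EvalProg := .loop (fun c => c.sym.isSome) mainStep

theorem length_encodeLog_exec (s : EvalState) (o : Op) :
    (s.exec o).pat.length + (encodeLog (s.exec o).rs).length =
      s.pat.length + (encodeLog s.rs).length + 1 := by
  simp [EvalState.exec, encodeLog]
  omega

theorem length_xs_exec_le (s : EvalState) (o : Op) : (s.exec o).xs.length ≤ s.xs.length := by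
  simp only [EvalState.exec]
  split <;> simp

/-- Each round adds at most one symbol to address and log together and consumes at least one bit of
code. Hence code, address and log never exceed `N` in total, and a round costs at most `40 * (N +
1)`. -/
theorem takes_mainLoop (N : ℕ) (l : List Bool) (s : EvalState) :
    ∀ c : Ctl, c.sym = (l.map Sum.inr).head? → c.act = s.act → c.cond = s.cond →
    l.length + s.pat.length + (encodeLog s.rs).length ≤ N →
    (interp l s).xs.length ≤ s.xs.length ∧
    (interp l s).pat.length + (encodeLog (interp l s).rs).length ≤ N ∧
    ∃ c' : Ctl, c'.act = (interp l s).act ∧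
      Takes mainLoop (c, stackFn (l.map Sum.inr).tail s.xs [] s.pat (encodeLog s.rs) [] [])
        (l.length * (40 * (N + 1)) + 1)
        (c', stackFn [] (interp l s).xs [] (interp l s).pat (encodeLog (interp l s).rs) [] []) := by
  induction l, s using interp.induct with
  | case1 s =>
    intro c hs ha hc hN
    rw [interp]
    refine ⟨le_rfl, by simpa using hN, c, ha, ?_⟩
    refine Run.mono (t := 1) (by omega) (Run.loop_false ?_)
    simp [testState, hs]
  | case2 l s ih =>
    intro c hs ha hc hN
    rw [interp]
    obtain ⟨h1, h2, c', hc', h3⟩ := ih (setSym c (l.tail.map Sum.inr).head?) rfl ha hc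
      (by simp at hN ⊢; omega)
    refine ⟨h1, h2, c', hc', ?_⟩
    refine Run.mono (t := (1 + 1 + 2 + 1) + (l.tail.length * (40 * (N + 1)) + 1) + 2) ?_
      (Run.loop_true (by simp [testState, hs]) (Run.seq (Run.ite_true (by simp [testState, hs, bitOf])
        (Run.seq (takes_act _ (by simp only [StackAct.apply]; rw [update_inp]))
        (takes_act _ (by simp only [StackAct.apply]; rw [update_pat]))))
        (takes_act _ (by simp only [StackAct.apply]; rw [update_inp]))) (h3.congr ?_ rfl))
    · have : l.tail.length * (40 * (N + 1)) ≤ l.length * (40 * (N + 1)) :=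
        Nat.mul_le_mul_right _ (by simp)
      rw [List.length_cons, Nat.add_mul l.length, Nat.one_mul]
      omega
    · cases l with
      | nil => simp [setSym, stackFn, bitOf]
      | cons b l => simp [setSym, stackFn, bitOf]
  | case3 l s ih =>
    intro c hs ha hc hN
    rw [interp]
    obtain ⟨c₁, a1, b1, k1⟩ := takes_opProg { c with op := opOfBits l } ((l.drop 6).map Sum.inr) [] s
      ha hc
    have hlen := length_encodeLog_exec s (opOfBits l)
    obtain ⟨h1, h2, c', hc', h3⟩ := ih (setSym c₁ ((l.drop 6).map Sum.inr).head?) rfl a1 b1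
      (by simp at hN ⊢; omega)
    refine ⟨h1.trans (length_xs_exec_le _ _), h2, c', hc', ?_⟩
    refine Run.mono (t := (6 + (28 * (encodeLog s.rs).length + 8 * s.pat.length + 14) + 2 + 1) +
      ((l.drop 6).length * (40 * (N + 1)) + 1) + 2) ?_
      (Run.loop_true (by simp [testState, hs]) (Run.seq (Run.ite_false (by simp [testState, hs, bitOf])
        (Run.seq (takes_readOp _ _ _ _ _ _ _ _) k1))
        (takes_act _ (by simp only [StackAct.apply]; rw [update_inp]))) (h3.congr ?_ rfl))
    · have : (l.drop 6).length * (40 * (N + 1)) ≤ l.length * (40 * (N + 1)) :=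
        Nat.mul_le_mul_right _ (by simp)
      rw [List.length_cons, Nat.add_mul l.length, Nat.one_mul]
      simp only [List.length_cons] at hN
      omega
    · simp [setSym, stackFn]

/-- Record the bit in the symbol read. -/
def copyBit (c : Ctl) (o : Option (Bool ⊕ Bool)) : Ctl := { c with bit := some (bitOf o) }

/-- Separate the two components of the input. -/
def splitLoop : EvalProg :=
  .loop isAddrSym <|
    .seq (.act (.pop .inp copyBit)) <|
    .seq (.act (.push .tmp fun c => c.bit.getD false)) <|
    .act (.peek .inp setSym)

/-- The loop peeks, so that the first symbol of the code stays on the stack when the input part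
ends. The flags are preserved, since the evaluation starts from their initial values. -/
theorem takes_splitLoop (a x : List Bool) : ∀ (c : Ctl) (tmp : List Bool),
    c.sym = (x.map Sum.inl ++ a.map Sum.inr).head? →
    ∃ c' : Ctl, c'.act = c.act ∧ c'.cond = c.cond ∧
      Takes splitLoop (c, stackFn (x.map Sum.inl ++ a.map Sum.inr) [] tmp [] [] [] [])
        (5 * x.length + 1) (c', stackFn (a.map Sum.inr) [] (x.reverse ++ tmp) [] [] [] []) := by
  induction x with
  | nil =>
    intro c tmp hc
    refine ⟨c, rfl, rfl, Run.loop_false ?_⟩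
    cases a <;> simp_all [testState, isAddrSym]
  | cons b x ih =>
    intro c tmp hc
    obtain ⟨c', h1, h2, h3⟩ := ih
      { c with sym := (x.map Sum.inl ++ a.map Sum.inr).head?, bit := some b } (b :: tmp) rfl
    refine ⟨c', h1, h2, ?_⟩
    refine Run.mono (t := (1 + (1 + 1)) + (5 * x.length + 1) + 2) (by simp; omega)
      (Run.loop_true (by simp [testState, hc, isAddrSym])
        (Run.seq (takes_act _ (by simp only [StackAct.apply]; rw [update_inp]))
        (Run.seq (takes_act _ (by simp only [StackAct.apply]; rw [update_tmp]))
        (takes_act _ rfl))) (h3.congr ?_ (by simp)))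
    simp [StackAct.apply, copyBit, setSym, stackFn, bitOf]

/-- The initial internal state of the evaluator. -/
def Ctl.init : Ctl :=
  ⟨none, none, true, none, true, false, ⟨false, false, false, false, false, false⟩⟩

/-- The evaluator. -/
def evalProg : EvalProg :=
  .seq (.act (.peek .inp setSym)) <|
  .seq splitLoop <|
  .seq tmpToXs <|
  .seq (.act (.pop .inp setSym)) <|
  .seq mainLoop <|
  .seq (clearStack .xs setBit Ctl.bit) <|
  .seq (clearStack .pat setBit Ctl.bit) <|
  .seq (clearStack .log setSym Ctl.sym) <|
  .seq (.act (.push .out Ctl.act)) <|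
  .act (.load fun _ => Ctl.init)

/-- The answer of the program `a` on input `x`. -/
def evalAnswer (x a : List Bool) : Bool := (interp a ⟨true, false, x, [], []⟩).act

/-- A halting configuration must have all stacks but the output empty and the internal state reset,
hence the cleaning at the end. The quadratic bound comes from the main loop. -/
theorem takes_evalProg (x a : List Bool) :
    Takes evalProg (Ctl.init, stackFn (x.map Sum.inl ++ a.map Sum.inr) [] [] [] [] [] [])
      (100 * (x.length + a.length + 1) ^ 2)
      (Ctl.init, stackFn [] [] [] [] [] [] [evalAnswer x a]) := by
  obtain ⟨c₁, a₁, b₁, k₁⟩ := takes_splitLoop a x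
    (setSym Ctl.init (x.map Sum.inl ++ a.map Sum.inr).head?) [] rfl
  obtain ⟨hx, hr, c₂, a₂, k₂⟩ := takes_mainLoop a.length a ⟨true, false, x, [], []⟩
    (setSym (setBit c₁ none) (a.map Sum.inr).head?) rfl a₁ b₁ (by simp [encodeLog])
  rw [evalAnswer]
  generalize interp a ⟨true, false, x, [], []⟩ = s at *
  have k₃ := takes_clearStack (K := Stk) (Γ := Stk.Sym) (k := .xs) (wr := setBit) (rd := Ctl.bit)
    (fun _ _ => rfl) (fun _ _ _ => rfl) c₂ (stackFn [] s.xs [] s.pat (encodeLog s.rs) [] [])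
  rw [update_xs] at k₃
  have k₄ := takes_clearStack (K := Stk) (Γ := Stk.Sym) (k := .pat) (wr := setBit) (rd := Ctl.bit)
    (fun _ _ => rfl) (fun _ _ _ => rfl) (setBit c₂ none)
    (stackFn [] [] [] s.pat (encodeLog s.rs) [] [])
  rw [update_pat] at k₄
  have k₅ := takes_clearStack (K := Stk) (Γ := Stk.Sym) (k := .log) (wr := setSym) (rd := Ctl.sym)
    (fun _ _ => rfl) (fun _ _ _ => rfl) (setBit (setBit c₂ none) none)
    (stackFn [] [] [] [] (encodeLog s.rs) [] [])
  rw [update_log] at k₅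
  refine Run.mono (t := 1 + ((5 * x.length + 1) + ((4 * (x.reverse ++ []).length + 2) + (1 +
    ((a.length * (40 * (a.length + 1)) + 1) + ((4 * s.xs.length + 2) + ((4 * s.pat.length + 2) +
      ((4 * (encodeLog s.rs).length + 2) + (1 + 1))))))))) ?_
    (Run.seq (takes_act _ rfl) (Run.seq k₁ (Run.seq (takes_tmpToXs _ _ _ _ _ _ _ _)
      (Run.seq (takes_act _ (by simp only [StackAct.apply]; rw [update_inp]))
      (Run.seq (k₂.congr (by simp [stackFn, encodeLog]) rfl) (Run.seq k₃ (Run.seq k₄ (Run.seq k₅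
      (Run.seq (takes_act _ (by simp only [StackAct.apply]; rw [update_out]))
        ((takes_act _ rfl).congr rfl ?_))))))))))
  · simp only [List.append_nil, List.length_reverse]
    simp only at hx
    nlinarith [Nat.zero_le (x.length * a.length), Nat.zero_le (x.length ^ 2)]
  · simp [StackAct.apply, stackFn, setBit, setSym, a₂]

/-- Evaluation of coded programs takes polynomial time. -/
theorem polyTimeDecidable_evalAnswer :
    PolyTimeDecidable pairEncoding {p | evalAnswer p.1 p.2 = true} := by
  refine ⟨fun p => evalAnswer p.1 p.2, fun _ => Iff.rfl, ?_⟩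
  refine nonempty_polyTime_of_run (K := Stk) (Γ := Stk.Sym) .inp .out Ctl.init evalProg _ _ _
    (Equiv.refl _) (Equiv.refl _) (.C 100 * (.X + 1) ^ 2) fun p => ?_
  have h := takes_evalProg p.1 p.2
  have e : (fun _ => [] : ∀ k : Stk, List k.Sym) = stackFn [] [] [] [] [] [] [] := by
    funext k
    cases k <;> rfl
  rw [e, update_inp, update_out]
  simp only [pairEncoding, Computability.encodingProd, Computability.encodingList,
    Computability.encodingBoolBool, Computability.encodeBool, Polynomial.eval_mul,
    Polynomial.eval_C, Polynomial.eval_pow, Polynomial.eval_add, Polynomial.eval_X,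
    Polynomial.eval_one, List.length_append, List.length_map, id_eq, Equiv.refl_symm,
    Equiv.coe_refl, List.map_id]
  exact h

end InstrSeq

namespace InstrSeq

/-! ### Programs with numeric addresses -/

/-- A state with memory addressed by numbers. -/
structure NumState where
  act : Bool
  cond : Bool
  xs : List Bool
  mem : ℕ → Bool

/-- The effect of an operation at an address. -/
def NumState.exec (s : NumState) (p : ℕ × Op) : NumState :=
  let r := p.2.exec (s.mem p.1) (s.xs.headD false) s.act s.cond
  { act := r.2.1
    cond := r.2.2
    xs := if p.2.m₀ && p.2.m₁ then s.xs.tail else s.xs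
    mem := Function.update s.mem p.1 r.1 }

/-- The effect of a list of operations. -/
def NumState.run (s : NumState) (l : List (ℕ × Op)) : NumState := l.foldl NumState.exec s

/-- The address `a` as `w` bits. -/
def addressBits (w a : ℕ) : List Bool := (List.range w).map a.testBit

theorem length_addressBits (w a : ℕ) : (addressBits w a).length = w := by simp [addressBits]

theorem addressBits_injOn {w a b : ℕ} (ha : a < 2 ^ w) (hb : b < 2 ^ w)
    (h : addressBits w a = addressBits w b) : a = b := by
  refine Nat.eq_of_testBit_eq fun i => ?_
  by_cases hi : i < w
  · simp only [addressBits, List.map_inj_left] at h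
    exact h i (List.mem_range.2 hi)
  · have hw : 2 ^ w ≤ 2 ^ i := Nat.pow_le_pow_right (by omega) (by omega)
    rw [Nat.testBit_lt_two_pow (ha.trans_le hw), Nat.testBit_lt_two_pow (hb.trans_le hw)]

/-- The bits that code an operation at an address. -/
def encodeOp (w : ℕ) (p : ℕ × Op) : List Bool :=
  (addressBits w p.1).flatMap (fun b => [true, b]) ++
    [false, p.2.m₀, p.2.m₁, p.2.y₀, p.2.y₁, p.2.e₀, p.2.e₁]

theorem length_encodeOp (w : ℕ) (p : ℕ × Op) : (encodeOp w p).length = 2 * w + 7 := by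
  simp [encodeOp, List.length_flatMap, length_addressBits]
  omega

theorem interp_flatMap (l rest : List Bool) (s : EvalState) :
    interp (l.flatMap (fun b => [true, b]) ++ rest) s =
      interp rest { s with pat := l.reverse ++ s.pat } := by
  induction l generalizing s with
  | nil => rfl
  | cons b l ih =>
    rw [List.flatMap_cons, List.append_assoc, List.cons_append, interp]
    simp [ih]

theorem interp_encodeOp (w : ℕ) (p : ℕ × Op) (rest : List Bool) (s : EvalState)
    (hs : s.pat = []) :
    interp (encodeOp w p ++ rest) s =
      interp rest ({ s with pat := (addressBits w p.1).reverse }.exec p.2) := by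
  rw [encodeOp, List.append_assoc, interp_flatMap, List.cons_append, interp]
  simp [hs, opOfBits]

/-- The evaluator state represents a state with numeric addresses. -/
structure Agrees (w : ℕ) (s : EvalState) (s' : NumState) : Prop where
  act : s.act = s'.act
  cond : s.cond = s'.cond
  xs : s.xs = s'.xs
  pat : s.pat = []
  mem : ∀ a < 2 ^ w, (lookup (addressBits w a).reverse s.rs).getD false = s'.mem a

/-- All addresses have the same width, so a prefix match in `lookup` is an equality, and prepending
a record acts as an update of the memory. -/
theorem Agrees.exec {w : ℕ} {s : EvalState} {s' : NumState} (h : Agrees w s s') {p : ℕ × Op}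
    (hp : p.1 < 2 ^ w) :
    Agrees w ({ s with pat := (addressBits w p.1).reverse }.exec p.2) (s'.exec p) := by
  refine ⟨?_, ?_, ?_, rfl, fun a ha => ?_⟩
  · simp [EvalState.exec, NumState.exec, h.mem _ hp, h.act, h.cond, h.xs]
  · simp [EvalState.exec, NumState.exec, h.mem _ hp, h.act, h.cond, h.xs]
  · simp [EvalState.exec, NumState.exec, h.xs]
  · simp only [EvalState.exec, NumState.exec, lookup, h.mem _ hp, h.act, h.cond, h.xs]
    by_cases hap : a = p.1
    · subst hap
      simp
    · have : (addressBits w p.1).reverse.isPrefixOf (addressBits w a).reverse = false := by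
        rw [Bool.eq_false_iff, Ne, List.isPrefixOf_iff_prefix]
        intro hpre
        have heq := hpre.eq_of_length (by simp [length_addressBits])
        exact hap (addressBits_injOn ha hp (List.reverse_injective heq).symm)
      rw [this, Function.update_of_ne hap]
      simpa using h.mem a ha

theorem act_interp_encodeOps {w : ℕ} (l : List (ℕ × Op)) (hl : ∀ p ∈ l, p.1 < 2 ^ w)
    {s : EvalState} {s' : NumState} (h : Agrees w s s') :
    (interp (l.flatMap (encodeOp w)) s).act = (s'.run l).act := by
  induction l generalizing s s' with
  | nil =>
    rw [List.flatMap_nil, interp]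
    exact h.act
  | cons p l ih =>
    rw [List.flatMap_cons, interp_encodeOp _ _ _ _ h.pat]
    exact ih (fun q hq => hl q (List.mem_cons_of_mem _ hq)) (h.exec (hl p List.mem_cons_self))

/-! ### Single pass instruction sequences as programs with numeric addresses -/

/-- The number of a role. -/
def Role.code : Role → ℕ
  | .inp => 1
  | .inout => 2
  | .out0 => 3
  | .out1 => 4
  | .aux0 => 5
  | .aux1 => 6

/-- The address of a register. -/
def regAddr (f : Focus) : ℕ := 8 * f.index + f.role.code

/-- The address of the bit that tells whether the instruction at position `i` is to be executed. -/
def posAddr (i : ℕ) : ℕ := 8 * i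

theorem Role.code_bounds (r : Role) : 1 ≤ r.code ∧ r.code ≤ 6 := by
  cases r <;> simp [Role.code]

theorem regAddr_injective : Function.Injective regAddr := by
  rintro ⟨r, i⟩ ⟨r', i'⟩ h
  simp only [regAddr] at h
  have h1 := r.code_bounds
  have h2 := r'.code_bounds
  have hc : r.code = r'.code := by omega
  have hr : r = r' := by
    cases r <;> cases r' <;> first | rfl | simp [Role.code] at hc
  have hi : i = i' := by omega
  rw [hr, hi]

theorem posAddr_ne_regAddr (i : ℕ) (f : Focus) : posAddr i ≠ regAddr f := by
  have := f.role.code_bounds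
  simp only [posAddr, regAddr]
  omega

theorem posAddr_injective : Function.Injective posAddr := by
  intro i j h
  simp only [posAddr] at h
  omega

/-- Read a bit into the flag `act`. -/
def Op.read : Op := ⟨false, true, false, false, false, false⟩

/-- Apply a method if the flag `act` is set, with the reply in the flag `cond`. -/
def Op.method (m : Method) : Op :=
  ⟨false, false, m.yield.apply false, m.yield.apply true, m.effect.apply false,
    m.effect.apply true⟩

/-- Set a bit if the flag `act` is set and the flag `cond` has the value `b`. -/
def Op.mark (b : Bool) : Op := ⟨true, false, b, false, false, false⟩

/-- Store the next input bit. -/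
def Op.input : Op := ⟨true, true, false, false, false, false⟩

/-- The operations for a basic action at position `i` with next positions `j` (reply `1`) and
`k` (reply `0`). -/
def stepOps (i : ℕ) (a : Action) (j k : ℕ) : List (ℕ × Op) :=
  [(posAddr i, .read), (regAddr a.focus, .method a.method), (posAddr j, .mark true),
    (posAddr k, .mark false)]

/-- With the position bit off, reading it clears `act`, and the three remaining operations are
guarded by `act`: the instruction is passed over. -/
theorem mem_run_stepOps_of_false (s : NumState) (i : ℕ) (a : Action) (j k : ℕ)
    (h : s.mem (posAddr i) = false) : (s.run (stepOps i a j k)).mem = s.mem := by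
  simp [NumState.run, stepOps, NumState.exec, Op.exec, Op.read, Op.method, Op.mark, h]

theorem BitFn.ite_apply (f : BitFn) (b : Bool) :
    (if b then f.apply true else f.apply false) = f.apply b := by
  cases b <;> rfl

open Classical in
-- The reply stays in `cond`, so exactly one of the two guarded marks takes effect. Addresses
-- divisible by `8` belong to positions and never collide with registers.
theorem mem_run_stepOps_of_true (s : NumState) (i : ℕ) (a : Action) (j k : ℕ)
    (h : s.mem (posAddr i) = true) :
    (∀ f, (s.run (stepOps i a j k)).mem (regAddr f) =
      if f = a.focus then a.method.effect.apply (s.mem (regAddr a.focus))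
      else s.mem (regAddr f)) ∧
    ∀ n, (s.run (stepOps i a j k)).mem (posAddr n) = (s.mem (posAddr n) ||
      decide (n = if a.method.yield.apply (s.mem (regAddr a.focus)) then j else k)) := by
  set b := s.mem (regAddr a.focus) with hb
  have e₁ : s.exec (posAddr i, .read) = { s with act := true } := by
    simp [NumState.exec, Op.exec, Op.read, h]
  have e₂ : ({ s with act := true } : NumState).exec (regAddr a.focus, .method a.method) =
      ⟨true, a.method.yield.apply b, s.xs,
        Function.update s.mem (regAddr a.focus) (a.method.effect.apply b)⟩ := by
    simp [NumState.exec, Op.exec, Op.method, ← hb, BitFn.ite_apply]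
  have e : s.run (stepOps i a j k) = ((⟨true, a.method.yield.apply b, s.xs,
        Function.update s.mem (regAddr a.focus) (a.method.effect.apply b)⟩ : NumState).exec
          (posAddr j, .mark true)).exec (posAddr k, .mark false) := by
    rw [← e₂, ← e₁]
    rfl
  rw [e]
  refine ⟨fun f => ?_, fun n => ?_⟩
  · simp only [NumState.exec]
    rw [Function.update_of_ne (posAddr_ne_regAddr _ _).symm,
      Function.update_of_ne (posAddr_ne_regAddr _ _).symm]
    by_cases hf : f = a.focus
    · subst hf
      simp
    · rw [Function.update_of_ne (regAddr_injective.ne hf), if_neg hf]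
  · have hp : ∀ n, Function.update s.mem (regAddr a.focus) (a.method.effect.apply b) (posAddr n) =
        s.mem (posAddr n) := fun n => Function.update_of_ne (posAddr_ne_regAddr _ _) _ _
    simp only [NumState.exec, Op.exec, Op.mark, Bool.true_and, hp]
    by_cases hk : n = k
    · subst hk
      by_cases hj : n = j
      · subst hj
        cases a.method.yield.apply b <;> simp
      · rw [Function.update_self, Function.update_of_ne (posAddr_injective.ne hj), hp]
        cases a.method.yield.apply b <;> simp [hj]
    · rw [Function.update_of_ne (posAddr_injective.ne hk)]
      by_cases hj : n = j
      · subst hj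
        rw [Function.update_self]
        cases a.method.yield.apply b <;> simp [hk]
      · rw [Function.update_of_ne (posAddr_injective.ne hj), hp]
        cases a.method.yield.apply b <;> simp [hk, hj]

/-- An action without effect. -/
def idleAction : Action := ⟨⟨.out0, 1⟩, ⟨.zero, .ident⟩⟩

/-- The operations for the instruction `u` at position `i` of a sequence of length `n`. -/
def instrOps (n i : ℕ) : Instr → List (ℕ × Op)
  | .basic a => stepOps i a (i + 1) (i + 1)
  | .pos a => stepOps i a (i + 1) (min (i + 2) n)
  | .neg a => stepOps i a (min (i + 2) n) (i + 1)
  | .jump k => stepOps i idleAction (min (i + k) n) (min (i + k) n)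
  | .bjump _ => []
  | .term => []

/-- The operations for the instructions from position `i` on. -/
def seqOps (n : ℕ) : ℕ → List Instr → List (ℕ × Op)
  | _, [] => []
  | i, u :: X => instrOps n i u ++ seqOps n (i + 1) X

theorem mem_run_instrOps_of_false (s : NumState) (n i : ℕ) (u : Instr)
    (h : s.mem (posAddr i) = false) : (s.run (instrOps n i u)).mem = s.mem := by
  cases u with
  | bjump k => rfl
  | term => rfl
  | _ => exact mem_run_stepOps_of_false _ _ _ _ _ h

theorem run_append (s : NumState) (l l' : List (ℕ × Op)) : s.run (l ++ l') = (s.run l).run l' := by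
  simp [NumState.run]

/-- After `!` no later position is marked, so the rest of the sweep leaves the final memory alone.
-/
theorem mem_run_seqOps_of_false (n : ℕ) (X : List Instr) (i : ℕ) (s : NumState)
    (h : ∀ j ≥ i, s.mem (posAddr j) = false) : (s.run (seqOps n i X)).mem = s.mem := by
  induction X generalizing i s with
  | nil => rfl
  | cons u X ih =>
    have hu := mem_run_instrOps_of_false s n i u (h i le_rfl)
    rw [seqOps, run_append, ih (i + 1) _ (fun j hj => by rw [hu]; exact h j (by omega)), hu]

theorem exec_jump_zero {X : List Instr} {i : ℕ} (h : X[i]? = some (.jump 0)) (t : ℕ)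
    (M : Memory) : exec X t i M = none := by
  induction t with
  | zero => rfl
  | succ t ih =>
    rw [exec, h]
    exact ih

theorem lt_length_of_exec_eq_some {X : List Instr} {t pc : ℕ} {M M' : Memory}
    (h : exec X t pc M = some M') : pc < X.length := by
  by_contra hpc
  cases t with
  | zero => simp [exec] at h
  | succ t =>
    rw [exec, List.getElem?_eq_none (by omega)] at h
    simp at h

/-- A terminating run of a single pass instruction sequence is simulated by its operations. -/
theorem mem_run_seqOps {X : List Instr} (hX : ∀ u ∈ X, ¬ u.IsBackwardJump) {U : Focus → Prop}
    (hU : ∀ f, Uses X f → U f) (hU' : U idleAction.focus) (X' : List Instr) :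
    ∀ (i : ℕ) (_ : OccursAt X i X') (_ : i + X'.length = X.length) (t pc : ℕ) (M M' : Memory)
      (s : NumState), i ≤ pc → exec X t pc M = some M' →
      (∀ j ≥ i, s.mem (posAddr j) = decide (j = pc)) → (∀ f, U f → s.mem (regAddr f) = M f) →
      ∀ f, U f → (s.run (seqOps X.length i X')).mem (regAddr f) = M' f := by
  classical
  induction X' with
  | nil =>
    intro i _ hi t pc M M' s hpc hex
    have := lt_length_of_exec_eq_some hex
    simp only [List.length_nil, add_zero] at hi
    omega
  | cons u X' ih =>
    intro i hocc hi t pc M M' s hpc hex hpos hreg f hf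
    rw [seqOps, run_append]
    rw [List.length_cons] at hi
    -- The sweep stands at `i`, the run at `pc`. Either the sweep has not caught up and skips `i`,
    -- or it performs one instruction and the run moves strictly forward.
    rcases hpc.lt_or_eq with hlt | rfl
    · have hu := mem_run_instrOps_of_false s X.length i u (by
        rw [hpos i le_rfl]; simp; omega)
      exact ih (i + 1) hocc.2 (by omega) t pc M M' _ hlt hex
        (fun j hj => by rw [hu]; exact hpos j (by omega)) (by rw [hu]; exact hreg) f hf
    · have hmem : u ∈ X := List.mem_of_getElem? hocc.1
      have hact : s.mem (posAddr i) = true := by rw [hpos i le_rfl]; simp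
      -- one simulated instruction, for an arbitrary action with given next positions
      have key : ∀ (a : Action) (j k pc' t' : ℕ) (M₁ : Memory), U a.focus →
          (∀ g, U g → M₁ g = a.perform M g) →
          pc' = (if a.reply M then j else k) → i + 1 ≤ pc' → exec X t' pc' M₁ = some M' →
          ((s.run (stepOps i a j k)).run (seqOps X.length (i + 1) X')).mem (regAddr f) =
            M' f := by
        intro a j k pc' t' M₁ ha hM₁ hpc' hlt hex'
        obtain ⟨h1, h2⟩ := mem_run_stepOps_of_true s i a j k hact
        refine ih (i + 1) hocc.2 (by omega) t' pc' M₁ M' _ hlt hex' (fun n hn => ?_)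
          (fun g hg => ?_) f hf
        · rw [h2, hpos n (by omega), hreg _ ha, hpc', Action.reply]
          simp only [Bool.or_eq_right_iff_imp, decide_eq_true_eq]
          omega
        · rw [h1, hM₁ g hg, Action.perform]
          by_cases hga : g = a.focus
          · subst hga
            simp [hreg _ ha]
          · rw [if_neg hga, Function.update_of_ne hga, hreg g hg]
      cases t with
      | zero => simp [exec] at hex
      | succ t =>
        rw [exec, hocc.1] at hex
        cases u with
        | basic a =>
          exact key a _ _ (i + 1) t _ (hU _ ⟨_, hmem, rfl⟩) (fun _ _ => rfl) (by simp) le_rfl hex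
        | pos a =>
          simp only at hex
          have hlt := lt_length_of_exec_eq_some hex
          refine key a _ _ _ t _ (hU _ ⟨_, hmem, rfl⟩) (fun _ _ => rfl) ?_ ?_ hex
          -- As the run terminates, its next position lies below the length, so cutting off with
          -- `min` changes nothing.
          · cases hr : a.reply M <;> simp only [hr] at hlt ⊢ <;> simp at hlt ⊢
            omega
          · split <;> omega
        | neg a =>
          simp only at hex
          have hlt := lt_length_of_exec_eq_some hex
          refine key a _ _ _ t _ (hU _ ⟨_, hmem, rfl⟩) (fun _ _ => rfl) ?_ ?_ hex
          · cases hr : a.reply M <;> simp only [hr] at hlt ⊢ <;> simp at hlt ⊢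
            omega
          · split <;> omega
        | jump k =>
          simp only at hex
          have hlt := lt_length_of_exec_eq_some hex
          -- A jump by `0` would mark the current position again, which the sweep never revisits;
          -- termination excludes it.
          have hk : k ≠ 0 := by
            rintro rfl
            rw [Nat.add_zero, exec_jump_zero hocc.1] at hex
            simp at hex
          refine key idleAction _ _ (i + k) t M hU' (fun g _ => ?_) ?_ (by omega) hex
          · rw [idleAction, Action.perform_ident]
          · simp; omega
        | bjump k => exact absurd trivial (hX _ hmem)
        | term =>
          simp only [Option.some.injEq] at hex
          subst hex
          change ((s.run []).run _).mem _ = _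
          rw [mem_run_seqOps_of_false]
          · exact hreg f hf
          · intro j hj
            change s.mem _ = _
            rw [hpos j (by omega)]
            simp; omega

end InstrSeq

/-! ### Initialisation of the registers and the complete program -/

namespace InstrSeq

/-- Store the first `k` input bits in the registers `in:1, …, in:k`. -/
def inputOps (k : ℕ) : List (ℕ × Op) := (List.range k).map fun i => (regAddr ⟨.inp, i + 1⟩, .input)

/-- Set a bit. -/
def Op.set : Op := .method ⟨.zero, .one⟩

/-- Set the registers `aux1:1, …, aux1:k`. -/
def oneOps (k : ℕ) : List (ℕ × Op) := (List.range k).map fun i => (regAddr ⟨.aux1, i + 1⟩, .set)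

theorem run_inputOps (s : NumState) (k : ℕ) :
    (s.run (inputOps k)).act = s.act ∧ (s.run (inputOps k)).xs = s.xs.drop k ∧
      (∀ i < k, (s.run (inputOps k)).mem (regAddr ⟨.inp, i + 1⟩) = s.xs.getD i false) ∧
      ∀ a, (∀ i, a ≠ regAddr ⟨.inp, i + 1⟩) → (s.run (inputOps k)).mem a = s.mem a := by
  induction k with
  | zero => simp [inputOps, NumState.run]
  | succ k ih =>
    obtain ⟨h1, h2, h3, h4⟩ := ih
    have e : s.run (inputOps (k + 1)) =
        (s.run (inputOps k)).exec (regAddr ⟨.inp, k + 1⟩, .input) := by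
      rw [inputOps, List.range_succ, List.map_append, run_append]
      rfl
    rw [e]
    refine ⟨?_, ?_, fun i hi => ?_, fun a ha => ?_⟩
    · simp [NumState.exec, Op.exec, Op.input, h1]
    · simp [NumState.exec, Op.input, h2]
    · simp only [NumState.exec, Op.exec, Op.input]
      by_cases hik : i = k
      · subst hik
        rw [Function.update_self, h2]
        simp [List.headD_eq_head?_getD, List.head?_drop]
      · rw [Function.update_of_ne, h3 i (by omega)]
        refine regAddr_injective.ne ?_
        simpa using hik
    · simp only [NumState.exec]
      rw [Function.update_of_ne (ha k), h4 a ha]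

theorem exec_set (s : NumState) (a : ℕ) (h : s.act = true) :
    (s.exec (a, .set)).act = true ∧ (s.exec (a, .set)).mem = Function.update s.mem a true := by
  simp [NumState.exec, Op.exec, Op.set, Op.method, h, BitFn.apply]

/-- The evaluator's memory is `0` by default, so registers `aux1` must be set explicitly. Setting is
guarded by `act`, which is still on at this stage. -/
theorem run_oneOps (s : NumState) (k : ℕ) (h : s.act = true) :
    (s.run (oneOps k)).act = true ∧
      (∀ i < k, (s.run (oneOps k)).mem (regAddr ⟨.aux1, i + 1⟩) = true) ∧
      ∀ a, (∀ i, a ≠ regAddr ⟨.aux1, i + 1⟩) → (s.run (oneOps k)).mem a = s.mem a := by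
  induction k with
  | zero => simp [oneOps, NumState.run, h]
  | succ k ih =>
    obtain ⟨h1, h3, h4⟩ := ih
    have e : s.run (oneOps (k + 1)) =
        (s.run (oneOps k)).exec (regAddr ⟨.aux1, k + 1⟩, .set) := by
      rw [oneOps, List.range_succ, List.map_append, run_append]
      rfl
    obtain ⟨e1, e2⟩ := exec_set (s.run (oneOps k)) (regAddr ⟨.aux1, k + 1⟩) h1
    rw [e]
    refine ⟨e1, fun i hi => ?_, fun a ha => ?_⟩
    · rw [e2]
      by_cases hik : i = k
      · subst hik
        rw [Function.update_self]
      · rw [Function.update_of_ne, h3 i (by omega)]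
        refine regAddr_injective.ne ?_
        simpa using hik
    · rw [e2, Function.update_of_ne (ha k), h4 a ha]

/-- The program for a single pass instruction sequence that uses the registers `in:1, …, in:k`
and `aux1:1, …, aux1:k'`. -/
def programOps (X : List Instr) (k k' : ℕ) : List (ℕ × Op) :=
  inputOps k ++ (oneOps k' ++ ((posAddr 0, .set) ::
    (seqOps X.length 0 X ++ [(regAddr ⟨.out0, 1⟩, .read)])))

/-- The closing operation reads `out0:1` into `act`, where the evaluator leaves its answer. -/
theorem act_run_programOps {X : List Instr} (hX : ∀ u ∈ X, ¬ u.IsBackwardJump) {k k' : ℕ}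
    (hk : {i | Uses X ⟨.inp, i⟩} = Set.Icc 1 k) (hk' : {i | Uses X ⟨.aux1, i⟩} = Set.Icc 1 k')
    (hU : ∀ f, Uses X f → f.role = Role.inp ∨ f = ⟨Role.out0, 1⟩ ∨ f.role.isAux = true)
    (x : List Bool) {t : ℕ} {M : Memory} (hM : exec X t 0 (initMemory (inputBits x)) = some M) :
    ((⟨true, false, x, fun _ => false⟩ : NumState).run (programOps X k k')).act =
      M ⟨.out0, 1⟩ := by
  set s₀ : NumState := ⟨true, false, x, fun _ => false⟩ with hs₀
  obtain ⟨a1, -, m1, n1⟩ := run_inputOps s₀ k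
  obtain ⟨a2, m2, n2⟩ := run_oneOps (s₀.run (inputOps k)) k' a1
  set s₂ := (s₀.run (inputOps k)).run (oneOps k') with hs₂
  obtain ⟨-, e3⟩ := exec_set s₂ (posAddr 0) a2
  set s₃ := s₂.exec (posAddr 0, .set) with hs₃
  have hrun : s₀.run (programOps X k k') =
      (s₃.run (seqOps X.length 0 X)).exec (regAddr ⟨.out0, 1⟩, .read) := by
    rw [programOps, run_append, run_append, ← hs₂]
    change s₃.run _ = _
    rw [run_append]
    rfl
  have hpos : ∀ j, s₂.mem (posAddr j) = false := by
    intro j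
    rw [n2 _ fun i => posAddr_ne_regAddr _ _, n1 _ fun i => posAddr_ne_regAddr _ _]
  -- Only registers in use are initialised, so agreement with the memory of `X` is claimed for these
  -- and for `out0:1`, the register of the answer and of the idle action that stands for jumps.
  have key := mem_run_seqOps hX (U := fun f => Uses X f ∨ f = ⟨.out0, 1⟩) (fun f => Or.inl)
    (Or.inr rfl) X 0 (by simpa using occursAt_append_append [] X []) (by simp) t 0 _ M s₃ le_rfl
    hM (fun j _ => ?_) (fun f hf => ?_) ⟨.out0, 1⟩ (Or.inr rfl)
  · rw [hrun, ← key]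
    simp [NumState.exec, Op.exec, Op.read]
  · rw [e3]
    by_cases hj : j = 0
    · subst hj
      simp
    · rw [Function.update_of_ne (posAddr_injective.ne hj), hpos]
      simp [hj]
  · rw [e3, Function.update_of_ne (posAddr_ne_regAddr _ _).symm]
    have hne : ∀ {r r' : Role} (i j : ℕ), r ≠ r' → regAddr ⟨r, i⟩ ≠ regAddr ⟨r', j⟩ :=
      fun i j h => regAddr_injective.ne fun h' => h (congrArg Focus.role h')
    have hcases : f.role = Role.inp ∧ Uses X f ∨ f = ⟨Role.out0, 1⟩ ∨
        f.role = Role.aux0 ∨ f.role = Role.aux1 ∧ Uses X f := by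
      rcases hf with hf | rfl
      · rcases hU f hf with h | h | h
        · exact Or.inl ⟨h, hf⟩
        · exact Or.inr (Or.inl h)
        · obtain ⟨r, i⟩ := f
          cases r <;> simp_all [Role.isAux]
      · exact Or.inr (Or.inl rfl)
    obtain ⟨r, i⟩ := f
    rcases hcases with ⟨rfl, hu⟩ | h | rfl | ⟨rfl, hu⟩
    · have hi : i ∈ Set.Icc 1 k := hk ▸ hu
      obtain ⟨hi1, hi2⟩ := Set.mem_Icc.1 hi
      obtain ⟨i, rfl⟩ : ∃ j, i = j + 1 := ⟨i - 1, by omega⟩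
      rw [n2 _ fun j => hne _ _ (by simp), m1 i (by omega)]
      simp [initMemory, Role.isInput, inputBits, hs₀]
    · simp only [Focus.mk.injEq] at h
      obtain ⟨rfl, rfl⟩ := h
      rw [n2 _ fun j => hne _ _ (by simp), n1 _ fun j => hne _ _ (by simp)]
      simp [initMemory, Role.isInput, Role.initial, hs₀]
    · rw [n2 _ fun j => hne _ _ (by simp), n1 _ fun j => hne _ _ (by simp)]
      simp [initMemory, Role.isInput, Role.initial, hs₀]
    · have hi : i ∈ Set.Icc 1 k' := hk' ▸ hu
      obtain ⟨hi1, hi2⟩ := Set.mem_Icc.1 hi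
      obtain ⟨i, rfl⟩ : ∃ j, i = j + 1 := ⟨i - 1, by omega⟩
      rw [m2 i (by omega)]
      simp [initMemory, Role.isInput, Role.initial]

/-! ### Length of the advice -/

/-- Each instruction names at most one register, so `k` different numbers need `k` instructions.
This is how low register indices yield addresses of `O(log n)` bits. -/
theorem le_length_of_uses_eq_Icc {X : List Instr} {r : Role} {k : ℕ}
    (h : {i | Uses X ⟨r, i⟩} = Set.Icc 1 k) : k ≤ X.length := by
  classical
  have hsub : Finset.Icc 1 k ⊆ ((X.filterMap Instr.focus?).map Focus.index).toFinset := by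
    intro i hi
    have hu : i ∈ {i | Uses X ⟨r, i⟩} := by
      rw [h]
      simpa using hi
    obtain ⟨u, hu, hf⟩ := hu
    rw [List.mem_toFinset, List.mem_map]
    exact ⟨⟨r, i⟩, List.mem_filterMap.2 ⟨u, hu, hf⟩, rfl⟩
  have h1 := Finset.card_le_card hsub
  have h2 := List.toFinset_card_le ((X.filterMap Instr.focus?).map Focus.index)
  have h3 := List.length_filterMap_le Instr.focus? X
  rw [Nat.card_Icc] at h1
  rw [List.length_map] at h2
  omega

theorem length_instrOps_le (n i : ℕ) (u : Instr) : (instrOps n i u).length ≤ 4 := by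
  cases u <;> simp [instrOps, stepOps]

theorem length_seqOps_le (n : ℕ) (X : List Instr) (i : ℕ) :
    (seqOps n i X).length ≤ 4 * X.length := by
  induction X generalizing i with
  | nil => simp [seqOps]
  | cons u X ih =>
    have h1 := length_instrOps_le n i u
    have h2 := ih (i + 1)
    simp only [seqOps, List.length_append, List.length_cons]
    omega

theorem posAddr_lt {i n : ℕ} (h : i ≤ n) : posAddr i < 8 * (n + 1) := by
  simp only [posAddr]
  omega

theorem regAddr_lt {f : Focus} {n : ℕ} (h : f.index ≤ n) : regAddr f < 8 * (n + 1) := by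
  have := f.role.code_bounds
  simp only [regAddr]
  omega

theorem stepOps_lt {n i j k : ℕ} {a : Action} (hi : i ≤ n) (ha : a.focus.index ≤ n) (hj : j ≤ n)
    (hk : k ≤ n) : ∀ p ∈ stepOps i a j k, p.1 < 8 * (n + 1) := by
  intro p hp
  simp only [stepOps, List.mem_cons, List.not_mem_nil, or_false] at hp
  rcases hp with rfl | rfl | rfl | rfl
  exacts [posAddr_lt hi, regAddr_lt ha, posAddr_lt hj, posAddr_lt hk]

theorem instrOps_lt {n i : ℕ} {u : Instr} (hi : i + 1 ≤ n)
    (hu : ∀ f, u.focus? = some f → f.index ≤ n) : ∀ p ∈ instrOps n i u, p.1 < 8 * (n + 1) := by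
  cases u with
  | basic a => exact stepOps_lt (by omega) (hu _ rfl) hi hi
  | pos a => exact stepOps_lt (by omega) (hu _ rfl) hi (by omega)
  | neg a => exact stepOps_lt (by omega) (hu _ rfl) (by omega) hi
  | jump k => exact stepOps_lt (by omega) (by simp [idleAction]; omega) (by omega) (by omega)
  | bjump k => simp [instrOps]
  | term => simp [instrOps]

theorem seqOps_lt {n : ℕ} (X : List Instr) (i : ℕ) (hi : i + X.length ≤ n)
    (hX : ∀ u ∈ X, ∀ f, u.focus? = some f → f.index ≤ n) :
    ∀ p ∈ seqOps n i X, p.1 < 8 * (n + 1) := by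
  induction X generalizing i with
  | nil => simp [seqOps]
  | cons u X ih =>
    intro p hp
    rw [List.length_cons] at hi
    rcases List.mem_append.1 hp with hp | hp
    · exact instrOps_lt (by omega) (hX u List.mem_cons_self) p hp
    · exact ih (i + 1) (by omega) (fun u hu => hX u (List.mem_cons_of_mem _ hu)) p hp

theorem programOps_lt {X : List Instr} (hX : X ≠ []) (hlow : LowRegisterIndices X) {k k' : ℕ}
    (hk : k ≤ X.length) (hk' : k' ≤ X.length) :
    ∀ p ∈ programOps X k k', p.1 < 8 * (X.length + 1) := by
  have hn : 1 ≤ X.length := List.length_pos_iff.2 hX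
  intro p hp
  simp only [programOps, inputOps, oneOps, List.mem_append, List.mem_map, List.mem_range,
    List.mem_cons, List.not_mem_nil, or_false] at hp
  rcases hp with ⟨i, hi, rfl⟩ | ⟨i, hi, rfl⟩ | rfl | hp | rfl
  · exact regAddr_lt (by simp only; omega)
  · exact regAddr_lt (by simp only; omega)
  · exact posAddr_lt (Nat.zero_le _)
  · refine seqOps_lt X 0 (by omega) (fun u hu f hf => ?_) p hp
    obtain ⟨j, hj⟩ := hlow f.role
    have hf' : f.index ∈ {i | Uses X ⟨f.role, i⟩} := ⟨u, hu, hf⟩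
    rw [hj] at hf'
    exact hf'.2.trans (le_length_of_uses_eq_Icc hj)
  · exact regAddr_lt hn

theorem eight_mul_succ_le {n : ℕ} (hn : 1 ≤ n) : 8 * (n + 1) ≤ 2 ^ (Nat.log 2 n + 5) := by
  have h := Nat.lt_pow_succ_log_self (b := 2) (by omega) n
  have e : 2 ^ (Nat.log 2 n + 5) = 16 * 2 ^ (Nat.log 2 n + 1) := by
    rw [show Nat.log 2 n + 5 = (Nat.log 2 n + 1) + 4 by omega, pow_add]
    omega
  rw [Nat.succ_eq_add_one] at h
  omega

/-- A single pass instruction sequence that decides a language at length `m` can be coded by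
`O(n log n)` bits for the evaluator. -/
theorem exists_advice {Y : List Instr} {L : Language Bool} {m : ℕ} (h : DecidesAt Y L m) :
    ∃ a : List Bool, a.length ≤ 300 * (LLOC Y * Nat.log 2 (LLOC Y) + 1) ∧
      ∀ x : List Bool, x.length = m → (x ∈ L ↔ evalAnswer x a = true) := by
  obtain ⟨⟨hne, hfwd⟩, hlow, huses, hdec⟩ := h
  obtain ⟨k, hk⟩ := hlow .inp
  obtain ⟨k', hk'⟩ := hlow .aux1
  have hkn := le_length_of_uses_eq_Icc hk
  have hkn' := le_length_of_uses_eq_Icc hk'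
  have hn : 1 ≤ Y.length := List.length_pos_iff.2 hne
  set w := Nat.log 2 Y.length + 5 with hw
  refine ⟨(programOps Y k k').flatMap (encodeOp w), ?_, fun x hx => ?_⟩
  -- At most `n` operations each for loading inputs and ones, four per instruction, one to mark the
  -- start and one to read the answer.
  · have hlen : (programOps Y k k').length ≤ 6 * Y.length + 2 := by
      have := length_seqOps_le Y.length Y 0
      simp only [programOps, inputOps, oneOps, List.length_append, List.length_map,
        List.length_range, List.length_cons, List.length_nil]
      omega
    have hbits : ((programOps Y k k').flatMap (encodeOp w)).length =
        (programOps Y k k').length * (2 * w + 7) := by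
      simp [List.length_flatMap, length_encodeOp]
    rw [hbits, LLOC]
    refine (Nat.mul_le_mul_right _ hlen).trans ?_
    rw [hw]
    generalize Y.length = n at *
    -- For `n ≥ 2` the logarithm is at least `1` and absorbs the constants; for `n = 1` the summand
    -- `1` of the bound is needed.
    rcases hn.lt_or_eq with hn2 | rfl
    · have hlog : 1 ≤ Nat.log 2 n := Nat.log_pos (by omega) hn2
      nlinarith [Nat.mul_le_mul hn hlog]
    · simp
  · obtain ⟨β, hβ, hβL⟩ := hdec x hx
    obtain ⟨t, M, hM, rfl⟩ := mem_computed_iff.1 hβ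
    have hact := act_run_programOps hfwd hk hk' (fun f hf => (huses f hf).imp_left And.left) x hM
    rw [← hβL, evalAnswer, act_interp_encodeOps (s' := ⟨true, false, x, fun _ => false⟩)
      (programOps Y k k')
      (fun p hp => (programOps_lt hne hlow hkn hkn' p hp).trans_le (eight_mul_succ_le hn))
      ⟨rfl, rfl, rfl, rfl, fun a _ => rfl⟩, hact]

/-! ### The two inclusions -/

/-- Languages with single pass instruction sequences of polynomial size are in `P/O(n log n)`. -/
theorem mem_PNLogN {L : Language Bool} (h : ∃ (Y : ℕ → List Instr) (q : Polynomial ℕ),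
    ∀ m, DecidesAt (Y m) L m ∧ LLOC (Y m) ≤ q.eval m) : L ∈ PNLogN := by
  refine ⟨h, ?_⟩
  obtain ⟨Y, q, hY⟩ := h
  have hex : ∀ m, ∃ n, ∃ Z, DecidesAt Z L m ∧ LLOC Z = n := fun m => ⟨_, Y m, (hY m).1, rfl⟩
  classical
  -- The advice codes a shortest decider, because its length must be bounded in terms of every
  -- decider at that input length.
  choose Z hZ using fun m => Nat.find_spec (hex m)
  have hmin : ∀ m Z', DecidesAt Z' L m → LLOC (Z m) ≤ LLOC Z' := fun m Z' h => by
    rw [(hZ m).2]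
    exact Nat.find_min' (hex m) ⟨Z', h, rfl⟩
  choose a ha ha' using fun m => exists_advice (hZ m).1
  refine ⟨a, ⟨300, fun m Z' h => (ha m).trans ?_⟩, _, polyTimeDecidable_evalAnswer,
    fun x => ha' _ x rfl⟩
  have hle := hmin m Z' h
  exact Nat.mul_le_mul_left _ (Nat.add_le_add_right
    (Nat.mul_le_mul hle (Nat.log_mono_right hle)) _)

/-- Applying the advice bound to the deciders of polynomial length and using `log n ≤ n` gives a
polynomial in the input length. -/
theorem PNLogN_subset_PPoly : PNLogN ⊆ PPoly := by
  rintro L ⟨⟨Y, q, hY⟩, a, ⟨c, hc⟩, V, hV, hL⟩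
  refine ⟨a, ⟨.C c * (q * q + 1), fun m => (hc m (Y m) (hY m).1).trans ?_⟩, V, hV, hL⟩
  simp only [Polynomial.eval_mul, Polynomial.eval_C, Polynomial.eval_add, Polynomial.eval_one]
  exact Nat.mul_le_mul_left _ (Nat.add_le_add_right (Nat.mul_le_mul (hY m).2
    ((Nat.log_le_self _ _).trans (hY m).2)) _)

end InstrSeq

/-- Applying `Ψ` to the search sequences gives deciders: the computed function is unchanged, only
auxiliary registers are added, and the length is bounded by `p.comp q`. -/
theorem mainTheorem3 (Ψ : List InstrSeq.Instr → List InstrSeq.Instr) (p : Polynomial ℕ)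
    (hΨ : InstrSeq.IsTranslation Ψ)
    (hp : ∀ X, InstrSeq.IsPGLB X → InstrSeq.LowRegisterIndices X →
      InstrSeq.LLOC (Ψ X) ≤ p.eval (InstrSeq.LLOC X)) :
    InstrSeq.NP ⊆ InstrSeq.PPoly ∧ InstrSeq.NP ⊆ InstrSeq.PNLogN := by
  have key : InstrSeq.NP ⊆ InstrSeq.PNLogN := by
    intro L hL
    obtain ⟨q, hq⟩ := InstrSeq.exists_pglb_of_mem_NP hL
    choose X h1 h2 h3 h4 h5 using hq
    refine InstrSeq.mem_PNLogN ⟨fun m => Ψ (X m), p.comp q, fun m => ⟨?_, ?_⟩⟩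
    · obtain ⟨g1, g2, g3, g4⟩ := hΨ (X m) (h1 m) (h2 m)
      refine ⟨g1, g2, fun f hf => ?_, fun x hx => ?_⟩
      · rcases g3 f hf with h | h
        · exact Or.inr (Or.inr h)
        · exact h3 m f h
      · rw [g4]
        exact h4 m x hx
    · rw [Polynomial.eval_comp]
      exact (hp _ (h1 m) (h2 m)).trans (InstrSeq.eval_le_eval_of_le p (h5 m))
  exact ⟨key.trans InstrSeq.PNLogN_subset_PPoly, key⟩
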